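/- Let $\mathcal T$ be a finite double groupoid: a groupoid object in the category of groupoids, with a finite set $\mathcal B$ of boxes, a set $\mathcal H$ of horizontal arrows, a set $\mathcal V$ of vertical arrows and a set $\mathcal P$ of points (all finite). A box $A$ has a top side $t(A)$ and a bottom side $b(A)$ in $\mathcal H$, and a left side $l(A)$ and a right side $r(A)$ in $\mathcal V$; horizontal arrows have a source $l$ and a target $r$ in $\mathcal P$, vertical arrows have a source $t$ and a target $b$ in $\mathcal P$, and $bl(A)=b(l(A))$ is the bottom left vertex of $A$. The horizontal composition $XY$ is defined when $r(X)=l(Y)$, and the vertical composition $\frac{A}{B}$ ($A$ on top of $B$) when $b(A)=t(B)$. Let $\Bbbk$ be a field of characteristic $0$ and let $\vartheta:\mathcal P\to\Bbbk^\times$ be a function such that $$\sum_{V\in\mathcal B:\ t(V)=x,\ r(V)=g}\vartheta(bl(V))=1\qquad\text{for all }(g,x)\in\mathcal V\times\mathcal H\text{ with }t(g)=r(x).$$ Let $\Bbbk^{(\vartheta)}\mathcal T$ be the weak Hopf algebra which is the vector space with basis $\mathcal B$, with product $A\cdot B=\frac{A}{B}$ if $b(A)=t(B)$ and $A\cdot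 B=0$ otherwise, unit $\mathbf 1=\sum_{x\in\mathcal H}\mathrm{id}\,x$ (the sum of the vertical identities), comultiplication $\Delta(A)=\sum_{XY=A}\vartheta(bl(Y))\,X\otimes Y$, and counit $\varepsilon(A)=\vartheta(bl(A))^{-1}$ if $A$ is a horizontal identity $\mathrm{id}\,g$, $g\in\mathcal V$, and $\varepsilon(A)=0$ otherwise. Let $\operatorname{Rep}\Bbbk^{(\vartheta)}\mathcal T$ be the monoidal category of its finite-dimensional left modules: the tensor product of $V$ and $W$ is $\Delta(\mathbf 1)(V\otimes_\Bbbk W)$ with action through $\Delta$, the associativity isomorphisms are the restrictions of the usual ones, and the unit object is the image of the target map $\varepsilon_t(h)=(\varepsilon\otimes\mathrm{id})(\Delta(\mathbf 1)(h\otimes\mathbf 1))$ with action $h\cdot z=\varepsilon_t(hz)$. A fusion category over $\Bbbk$ is an abelian $\Bbbk$-linear rigid monoidal category with $\Bbbk$-bilinear tensor product and finite-dimensional spaces of morphisms, in which every object is a finite direct sum of simple objects, there are finitely many simple objects up to isomorphism, and the unit object is simple. A finite-dimensional semisimple weak Hopf algebra is connected if its category of finite-dimensional representations is a fusion category. Let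 $\mathbf E$ be the set of all boxes $E\in\mathcal B$ such that $r(E)$ and $t(E)$ are identity arrows. Then the category $\operatorname{Rep}\Bbbk^{(\vartheta)}\mathcal T$ is a fusion category if and only if the following two conditions hold, and likewise $\Bbbk^{(\vartheta)}\mathcal T$ is a connected (semisimple) weak Hopf algebra if and only if they hold: (a) the groupoid $\mathcal V\rightrightarrows\mathcal P$ is connected, that is, $\mathcal P\neq\emptyset$ and any two points of $\mathcal P$ are joined by an arrow in $\mathcal V$; (b) for any $x\in\mathcal H$ there is at most one $E\in\mathbf E$ such that $b(E)=x$. -/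

import Mathlib

open CategoryTheory
open scoped TensorProduct

set_option linter.unusedSectionVars false
set_option linter.unusedSimpArgs false

/-- A weak bialgebra over a field `k`: an associative unital algebra and a coassociative counital
coalgebra whose comultiplication is multiplicative, with the weakened axioms for the unit
`Δ²(1) = (Δ(1) ⊗ 1)(1 ⊗ Δ(1)) = (1 ⊗ Δ(1))(Δ(1) ⊗ 1)` and the counit
`ε(abc) = ε(a b₁) ε(b₂ c) = ε(a b₂) ε(b₁ c)`. -/
class WeakBialgebra (k : Type*) (H : Type*) [Field k] [Ring H] [Algebra k H]
    extends Coalgebra k H where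
  comul_mul : ∀ a b : H, comul (a * b) = comul a * comul b
  comul_one_left : comul.lTensor H (comul 1) =
    TensorProduct.assoc k H H H (comul 1 ⊗ₜ[k] (1 : H)) * ((1 : H) ⊗ₜ[k] comul 1)
  comul_one_right : comul.lTensor H (comul 1) =
    ((1 : H) ⊗ₜ[k] comul 1) * TensorProduct.assoc k H H H (comul 1 ⊗ₜ[k] (1 : H))
  counit_mul_left : ∀ a b c : H, counit (a * b * c) =
    LinearMap.mul' k k (TensorProduct.map (counit ∘ₗ LinearMap.mulLeft k a)
      (counit ∘ₗ LinearMap.mulRight k c) (comul b))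
  counit_mul_right : ∀ a b c : H, counit (a * b * c) =
    LinearMap.mul' k k (TensorProduct.map (counit ∘ₗ LinearMap.mulRight k c)
      (counit ∘ₗ LinearMap.mulLeft k a) (comul b))

namespace WeakBialgebra

open Coalgebra

section Maps

variable (k : Type*) (H : Type*) [Field k] [Ring H] [Algebra k H] [WeakBialgebra k H]

/-- The target map `ε_t(h) = (ε ⊗ id)(Δ(1)(h ⊗ 1))`. -/
noncomputable def targetMap : H →ₗ[k] H :=
  (TensorProduct.lid k H).toLinearMap ∘ₗ counit.rTensor H ∘ₗ
    LinearMap.mulLeft k (comul (R := k) (1 : H)) ∘ₗ (TensorProduct.mk k H H).flip 1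

/-- The source map `ε_s(h) = (id ⊗ ε)((1 ⊗ h)Δ(1))`. -/
noncomputable def sourceMap : H →ₗ[k] H :=
  (TensorProduct.rid k H).toLinearMap ∘ₗ counit.lTensor H ∘ₗ
    LinearMap.mulRight k (comul (R := k) (1 : H)) ∘ₗ TensorProduct.mk k H H 1

/-- The map `z ↦ (id ⊗ ε)(Δ(1)(1 ⊗ z))`. -/
noncomputable def barMap : H →ₗ[k] H :=
  (TensorProduct.rid k H).toLinearMap ∘ₗ counit.lTensor H ∘ₗ
    LinearMap.mulLeft k (comul (R := k) (1 : H)) ∘ₗ TensorProduct.mk k H H 1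

end Maps

section Lemmas

variable {k : Type*} {H : Type*} [Field k] [Ring H] [Algebra k H] [WeakBialgebra k H]

/-- A finite expansion `Δ(1) = ∑ aᵢ ⊗ bᵢ` together with its consequences. -/
theorem exists_repr_one : ∃ (s : Finset (H × H)),
    (∑ i ∈ s, i.1 ⊗ₜ[k] i.2 = comul (R := k) (1 : H)) := by
  obtain ⟨s, hs⟩ := TensorProduct.exists_finset (R := k) (comul (R := k) (1 : H))
  exact ⟨s, hs.symm⟩

variable {s : Finset (H × H)}

theorem targetMap_eq
    (hs : ∑ i ∈ s, i.1 ⊗ₜ[k] i.2 = comul (R := k) (1 : H)) (h : H) : targetMap k H h = ∑ i ∈ s, counit (R := k) (i.1 * h) • i.2 := by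
  simp [targetMap, ← hs, Finset.sum_mul]

theorem barMap_eq
    (hs : ∑ i ∈ s, i.1 ⊗ₜ[k] i.2 = comul (R := k) (1 : H)) (h : H) : barMap k H h = ∑ i ∈ s, counit (R := k) (i.2 * h) • i.1 := by
  simp [barMap, ← hs, Finset.sum_mul]

theorem comul_snd_left
    (hs : ∑ i ∈ s, i.1 ⊗ₜ[k] i.2 = comul (R := k) (1 : H)) :
    ∑ i ∈ s, i.1 ⊗ₜ[k] comul (R := k) i.2 =
      ∑ i ∈ s, ∑ j ∈ s, i.1 ⊗ₜ[k] ((i.2 * j.1) ⊗ₜ[k] j.2) := by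
  have := comul_one_left (k := k) (H := H)
  conv_rhs => rw [Finset.sum_comm]
  simpa [← hs, Finset.sum_mul, Finset.mul_sum, TensorProduct.sum_tmul, TensorProduct.tmul_sum]
    using this

theorem comul_snd_right
    (hs : ∑ i ∈ s, i.1 ⊗ₜ[k] i.2 = comul (R := k) (1 : H)) :
    ∑ i ∈ s, i.1 ⊗ₜ[k] comul (R := k) i.2 =
      ∑ i ∈ s, ∑ j ∈ s, i.1 ⊗ₜ[k] ((j.1 * i.2) ⊗ₜ[k] j.2) := by
  have := comul_one_right (k := k) (H := H)
  simpa [← hs, Finset.sum_mul, Finset.mul_sum, TensorProduct.sum_tmul, TensorProduct.tmul_sum]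
    using this

theorem comul_fst_left
    (hs : ∑ i ∈ s, i.1 ⊗ₜ[k] i.2 = comul (R := k) (1 : H)) :
    ∑ i ∈ s, comul (R := k) i.1 ⊗ₜ[k] i.2 =
      ∑ i ∈ s, ∑ j ∈ s, (i.1 ⊗ₜ[k] (i.2 * j.1)) ⊗ₜ[k] j.2 := by
  have h1 := coassoc_symm_apply (R := k) (1 : H)
  rw [← hs] at h1
  simp only [map_sum, LinearMap.lTensor_tmul, LinearMap.rTensor_tmul] at h1
  rw [← h1, ← map_sum, comul_snd_left hs]
  simp

theorem comul_fst_right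
    (hs : ∑ i ∈ s, i.1 ⊗ₜ[k] i.2 = comul (R := k) (1 : H)) :
    ∑ i ∈ s, comul (R := k) i.1 ⊗ₜ[k] i.2 =
      ∑ i ∈ s, ∑ j ∈ s, (i.1 ⊗ₜ[k] (j.1 * i.2)) ⊗ₜ[k] j.2 := by
  have h1 := coassoc_symm_apply (R := k) (1 : H)
  rw [← hs] at h1
  simp only [map_sum, LinearMap.lTensor_tmul, LinearMap.rTensor_tmul] at h1
  rw [← h1, ← map_sum, comul_snd_right hs]
  simp

theorem counit_mul_eq_left
    (hs : ∑ i ∈ s, i.1 ⊗ₜ[k] i.2 = comul (R := k) (1 : H)) (a c : H) :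
    counit (R := k) (a * c) = ∑ i ∈ s, counit (R := k) (a * i.1) * counit (R := k) (i.2 * c) := by
  have := counit_mul_left (k := k) a 1 c
  simpa [← hs] using this

theorem counit_mul_eq_right
    (hs : ∑ i ∈ s, i.1 ⊗ₜ[k] i.2 = comul (R := k) (1 : H)) (a c : H) :
    counit (R := k) (a * c) = ∑ i ∈ s, counit (R := k) (a * i.2) * counit (R := k) (i.1 * c) := by
  have := counit_mul_right (k := k) a 1 c
  simpa [← hs, mul_comm] using this

/-- `Δ(ε_t(h)) = Δ(1)(ε_t(h) ⊗ 1)`. -/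
theorem comul_targetMap_aux
    (hs : ∑ i ∈ s, i.1 ⊗ₜ[k] i.2 = comul (R := k) (1 : H)) (h : H) : comul (R := k) (targetMap k H h) =
    ∑ j ∈ s, (j.1 * targetMap k H h) ⊗ₜ[k] j.2 := by
  have h1 := congrArg (fun x => TensorProduct.lid k (H ⊗[k] H)
    (((counit (R := k)) ∘ₗ LinearMap.mulRight k h).rTensor (H ⊗[k] H) x)) (comul_snd_right hs)
  simp only [map_sum, LinearMap.rTensor_tmul, TensorProduct.lid_tmul, LinearMap.comp_apply,
    LinearMap.mulRight_apply] at h1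
  rw [targetMap_eq hs]
  simp only [map_sum, map_smul, h1, Finset.mul_sum, mul_smul_comm, TensorProduct.sum_tmul]
  rw [Finset.sum_comm]
  simp [TensorProduct.smul_tmul']

/-- `Δ(z̄) = Δ(1)(1 ⊗ z̄)`. -/
theorem comul_barMap_aux
    (hs : ∑ i ∈ s, i.1 ⊗ₜ[k] i.2 = comul (R := k) (1 : H)) (h : H) : comul (R := k) (barMap k H h) =
    ∑ j ∈ s, j.1 ⊗ₜ[k] (j.2 * barMap k H h) := by
  have h1 := congrArg (fun x => TensorProduct.rid k (H ⊗[k] H)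
    (((counit (R := k)) ∘ₗ LinearMap.mulRight k h).lTensor (H ⊗[k] H) x)) (comul_fst_left hs)
  simp only [map_sum, LinearMap.lTensor_tmul, TensorProduct.rid_tmul, LinearMap.comp_apply,
    LinearMap.mulRight_apply] at h1
  rw [barMap_eq hs]
  simp only [map_sum, map_smul, h1, Finset.mul_sum, mul_smul_comm, TensorProduct.tmul_sum,
    TensorProduct.tmul_smul]

theorem targetMap_one
    (hs : ∑ i ∈ s, i.1 ⊗ₜ[k] i.2 = comul (R := k) (1 : H)) : targetMap k H 1 = 1 := by
  rw [targetMap_eq hs]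
  have h1 := rTensor_counit_comul (R := k) (1 : H)
  rw [← hs] at h1
  have h2 := congrArg (TensorProduct.lid k H) h1
  simpa using h2

theorem barMap_one
    (hs : ∑ i ∈ s, i.1 ⊗ₜ[k] i.2 = comul (R := k) (1 : H)) : barMap k H 1 = 1 := by
  rw [barMap_eq hs]
  have h1 := lTensor_counit_comul (R := k) (1 : H)
  rw [← hs] at h1
  have h2 := congrArg (TensorProduct.rid k H) h1
  simpa using h2

theorem counit_mul_targetMap_aux
    (hs : ∑ i ∈ s, i.1 ⊗ₜ[k] i.2 = comul (R := k) (1 : H)) (a c : H) :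
    counit (R := k) (a * targetMap k H c) = counit (R := k) (a * c) := by
  rw [counit_mul_eq_right hs a c, targetMap_eq hs]
  simp [Finset.mul_sum, mul_comm]

theorem counit_mul_barMap_aux
    (hs : ∑ i ∈ s, i.1 ⊗ₜ[k] i.2 = comul (R := k) (1 : H)) (a c : H) :
    counit (R := k) (a * barMap k H c) = counit (R := k) (a * c) := by
  rw [counit_mul_eq_left hs a c, barMap_eq hs]
  simp [Finset.mul_sum, mul_comm]

theorem counit_mul_targetMap (a c : H) :
    counit (R := k) (a * targetMap k H c) = counit (R := k) (a * c) := by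
  obtain ⟨s, hs⟩ := exists_repr_one (k := k) (H := H)
  exact counit_mul_targetMap_aux hs a c

theorem counit_mul_barMap (a c : H) :
    counit (R := k) (a * barMap k H c) = counit (R := k) (a * c) := by
  obtain ⟨s, hs⟩ := exists_repr_one (k := k) (H := H)
  exact counit_mul_barMap_aux hs a c

theorem targetMap_mul_targetMap (g h : H) :
    targetMap k H (g * targetMap k H h) = targetMap k H (g * h) := by
  obtain ⟨s, hs⟩ := exists_repr_one (k := k) (H := H)
  simp only [targetMap_eq hs (g * _), ← mul_assoc, counit_mul_targetMap]

theorem targetMap_mul_barMap (g h : H) :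
    targetMap k H (g * barMap k H h) = targetMap k H (g * h) := by
  obtain ⟨s, hs⟩ := exists_repr_one (k := k) (H := H)
  simp only [targetMap_eq hs (g * _), ← mul_assoc, counit_mul_barMap]

theorem targetMap_targetMap (h : H) : targetMap k H (targetMap k H h) = targetMap k H h := by
  simpa using targetMap_mul_targetMap (k := k) 1 h

theorem barMap_mul_targetMap (g h : H) :
    barMap k H (g * targetMap k H h) = barMap k H (g * h) := by
  obtain ⟨s, hs⟩ := exists_repr_one (k := k) (H := H)
  simp only [barMap_eq hs (g * _), ← mul_assoc, counit_mul_targetMap]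

theorem targetMap_eq_of_mem {z : H} (hz : z ∈ LinearMap.range (targetMap k H)) :
    targetMap k H z = z := by
  obtain ⟨h, rfl⟩ := hz
  exact targetMap_targetMap h

theorem comul_mul_one (h : H) : comul (R := k) h * comul (R := k) 1 = comul (R := k) h := by
  rw [← comul_mul, mul_one]

theorem comul_one_mul (h : H) : comul (R := k) 1 * comul (R := k) h = comul (R := k) h := by
  rw [← comul_mul, one_mul]

theorem comul_mul_target (h : H) {z : H} (hz : z ∈ LinearMap.range (targetMap k H)) :
    comul (R := k) (h * z) = comul (R := k) h * (z ⊗ₜ[k] 1) := by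
  obtain ⟨s, hs⟩ := exists_repr_one (k := k) (H := H)
  obtain ⟨g, rfl⟩ := hz
  have h1 : comul (R := k) 1 * (targetMap k H g ⊗ₜ[k] (1 : H)) =
      comul (R := k) (targetMap k H g) := by
    rw [comul_targetMap_aux hs, ← hs, Finset.sum_mul]
    simp
  rw [comul_mul, ← h1, ← mul_assoc, comul_mul_one]

theorem comul_mul_bar (h z : H) :
    comul (R := k) (h * barMap k H z) = comul (R := k) h * (1 ⊗ₜ[k] barMap k H z) := by
  obtain ⟨s, hs⟩ := exists_repr_one (k := k) (H := H)
  have h1 : comul (R := k) 1 * ((1 : H) ⊗ₜ[k] barMap k H z) =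
      comul (R := k) (barMap k H z) := by
    rw [comul_barMap_aux hs, ← hs, Finset.sum_mul]
    simp
  rw [comul_mul, ← h1, ← mul_assoc, comul_mul_one]

/-- `∑ ε(h₁ z) h₂ = h z` for `z` in the target subalgebra. -/
theorem sum_counit_mul_target (h : H) {z : H} (hz : z ∈ LinearMap.range (targetMap k H)) :
    TensorProduct.lid k H ((counit ∘ₗ LinearMap.mulRight k z).rTensor H (comul (R := k) h)) =
      h * z := by
  have h1 := rTensor_counit_comul (R := k) (h * z)
  rw [comul_mul_target h hz] at h1
  have h2 := congrArg (TensorProduct.lid k H) h1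
  simp only [TensorProduct.lid_tmul, one_smul] at h2
  rw [← h2]
  congr 1
  induction comul (R := k) h using TensorProduct.induction_on with
  | zero => simp
  | tmul x y => simp
  | add x y hx hy => simp only [map_add, add_mul, hx, hy]

/-- `∑ ε(h₂ z) h₁ = h z̄`. -/
theorem sum_counit_mul_bar (h z : H) :
    TensorProduct.rid k H ((counit ∘ₗ LinearMap.mulRight k z).lTensor H (comul (R := k) h)) =
      h * barMap k H z := by
  have h1 := lTensor_counit_comul (R := k) (h * barMap k H z)
  rw [comul_mul_bar h] at h1
  have h2 := congrArg (TensorProduct.rid k H) h1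
  simp only [TensorProduct.rid_tmul, one_smul] at h2
  rw [← h2]
  congr 1
  induction comul (R := k) h using TensorProduct.induction_on with
  | zero => simp
  | tmul x y => simp [counit_mul_barMap]
  | add x y hx hy => simp only [map_add, add_mul, hx, hy]

/-- `Δ(1)(z̄ ⊗ 1) = Δ(1)(1 ⊗ z)` for `z` in the target subalgebra. -/
theorem comul_one_bar {z : H} (hz : z ∈ LinearMap.range (targetMap k H)) :
    comul (R := k) 1 * (barMap k H z ⊗ₜ[k] 1) = comul (R := k) 1 * (1 ⊗ₜ[k] z) := by
  obtain ⟨s, hs⟩ := exists_repr_one (k := k) (H := H)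
  have h1 := coassoc_symm_apply (R := k) (1 : H)
  rw [← hs] at h1
  simp only [map_sum, LinearMap.lTensor_tmul, LinearMap.rTensor_tmul] at h1
  rw [← hs]
  simp only [Finset.sum_mul, Algebra.TensorProduct.tmul_mul_tmul, mul_one]
  let F : (H ⊗[k] H) ⊗[k] H →ₗ[k] H ⊗[k] H :=
    ((TensorProduct.rid k H).toLinearMap ∘ₗ
      (counit ∘ₗ LinearMap.mulRight k z).lTensor H).rTensor H
  have h2 := congrArg F h1
  have h3 : ∀ a : H, ∀ t : H ⊗[k] H, F ((TensorProduct.assoc k H H H).symm (a ⊗ₜ[k] t)) =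
      a ⊗ₜ[k] TensorProduct.lid k H ((counit ∘ₗ LinearMap.mulRight k z).rTensor H t) := by
    intro a t
    induction t using TensorProduct.induction_on with
    | zero => simp
    | tmul x y => simp [F, TensorProduct.smul_tmul]
    | add x y hx hy => simp only [map_add, TensorProduct.tmul_add, hx, hy]
  simp only [map_sum, h3, sum_counit_mul_target _ hz] at h2
  rw [h2]
  refine Finset.sum_congr rfl fun i _ => ?_
  simp only [F, LinearMap.rTensor_tmul, LinearMap.comp_apply, LinearEquiv.coe_coe]
  rw [sum_counit_mul_bar]

end Lemmas

end WeakBialgebra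

namespace WeakBialgebra

open Coalgebra

section Tensor

variable (k : Type*) (H : Type*) [Field k] [Ring H] [Algebra k H]
  (V W U : Type*) [AddCommGroup V] [Module k V] [Module H V] [IsScalarTower k H V]
  [AddCommGroup W] [Module k W] [Module H W] [IsScalarTower k H W]
  [AddCommGroup U] [Module k U] [Module H U] [IsScalarTower k H U]

/-- The action of `H ⊗ H` on `V ⊗ W`, `(a ⊗ b)(v ⊗ w) = a v ⊗ b w`. -/
noncomputable def act : H ⊗[k] H →ₐ[k] Module.End k (V ⊗[k] W) :=
  (Module.endTensorEndAlgHom (R := k) (S := k) (A := k) (M := V) (N := W)).comp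
    (Algebra.TensorProduct.map (Algebra.lsmul k k V) (Algebra.lsmul k k W))

/-- The action of `(H ⊗ H) ⊗ H` on `(V ⊗ W) ⊗ U`. -/
noncomputable def actL : (H ⊗[k] H) ⊗[k] H →ₐ[k] Module.End k ((V ⊗[k] W) ⊗[k] U) :=
  (Module.endTensorEndAlgHom (R := k) (S := k) (A := k) (M := V ⊗[k] W) (N := U)).comp
    (Algebra.TensorProduct.map (act k H V W) (Algebra.lsmul k k U))

/-- The action of `H ⊗ (H ⊗ H)` on `V ⊗ (W ⊗ U)`. -/
noncomputable def actR : H ⊗[k] (H ⊗[k] H) →ₐ[k] Module.End k (V ⊗[k] (W ⊗[k] U)) :=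
  (Module.endTensorEndAlgHom (R := k) (S := k) (A := k) (M := V) (N := W ⊗[k] U)).comp
    (Algebra.TensorProduct.map (Algebra.lsmul k k V) (act k H W U))

variable {k H V W U}

@[simp]
theorem act_tmul (a b : H) (v : V) (w : W) :
    act k H V W (a ⊗ₜ[k] b) (v ⊗ₜ[k] w) = (a • v) ⊗ₜ[k] (b • w) := by
  simp [act]
  rfl

@[simp]
theorem actL_tmul (x : H ⊗[k] H) (b : H) (y : V ⊗[k] W) (u : U) :
    actL k H V W U (x ⊗ₜ[k] b) (y ⊗ₜ[k] u) = (act k H V W x y) ⊗ₜ[k] (b • u) := by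
  simp [actL]
  rfl

@[simp]
theorem actR_tmul (a : H) (x : H ⊗[k] H) (v : V) (y : W ⊗[k] U) :
    actR k H V W U (a ⊗ₜ[k] x) (v ⊗ₜ[k] y) = (a • v) ⊗ₜ[k] (act k H W U x y) := by
  simp [actR]
  rfl

theorem assoc_actL (t : (H ⊗[k] H) ⊗[k] H) (x : (V ⊗[k] W) ⊗[k] U) :
    TensorProduct.assoc k V W U (actL k H V W U t x) =
      actR k H V W U (TensorProduct.assoc k H H H t) (TensorProduct.assoc k V W U x) := by
  induction t using TensorProduct.induction_on with
  | zero => simp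
  | add t t' h h' => simp only [map_add, LinearMap.add_apply, h, h']
  | tmul t c =>
    induction t using TensorProduct.induction_on with
    | zero => simp
    | add t t' h h' => simp only [map_add, LinearMap.add_apply, h, h', TensorProduct.add_tmul]
    | tmul a b =>
      induction x using TensorProduct.induction_on with
      | zero => simp
      | add x x' h h' => simp only [map_add, h, h']
      | tmul x u =>
        induction x using TensorProduct.induction_on with
        | zero => simp
        | add x x' h h' => simp only [map_add, h, h', TensorProduct.add_tmul]
        | tmul v w => simp

end Tensor

section Rep

variable (k : Type*) (H : Type*) [Field k] [Ring H] [Algebra k H] [WeakBialgebra k H]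
  (V W U : Type*) [AddCommGroup V] [Module k V] [Module H V] [IsScalarTower k H V]
  [AddCommGroup W] [Module k W] [Module H W] [IsScalarTower k H W]
  [AddCommGroup U] [Module k U] [Module H U] [IsScalarTower k H U]

/-- The tensor product of two `H`-modules: the subspace `Δ(1)(V ⊗ W)` of `V ⊗ W`, on which
`h` acts as `Δ(h)`. -/
def TensorRep : Type _ := ↥(LinearMap.range (act k H V W (comul (R := k) 1)))

noncomputable instance : AddCommGroup (TensorRep k H V W) :=
  inferInstanceAs (AddCommGroup ↥(LinearMap.range (act k H V W (comul (R := k) 1))))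

noncomputable instance : Module k (TensorRep k H V W) :=
  inferInstanceAs (Module k ↥(LinearMap.range (act k H V W (comul (R := k) 1))))

/-- The inclusion of `Δ(1)(V ⊗ W)` into `V ⊗ W`. -/
noncomputable def incl : TensorRep k H V W →ₗ[k] V ⊗[k] W :=
  (LinearMap.range (act k H V W (comul (R := k) 1))).subtype

/-- The projection `x ↦ Δ(1) x` of `V ⊗ W` onto `Δ(1)(V ⊗ W)`. -/
noncomputable def proj : V ⊗[k] W →ₗ[k] TensorRep k H V W :=
  (act k H V W (comul (R := k) 1)).rangeRestrict

variable {k H V W U}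

theorem incl_injective : Function.Injective (incl k H V W) := Subtype.val_injective

theorem incl_proj (x : V ⊗[k] W) :
    incl k H V W (proj k H V W x) = act k H V W (comul (R := k) 1) x := rfl

theorem act_mul_apply (s t : H ⊗[k] H) (x : V ⊗[k] W) :
    act k H V W s (act k H V W t x) = act k H V W (s * t) x := by
  rw [map_mul]; rfl

theorem act_one_incl (x : TensorRep k H V W) :
    act k H V W (comul (R := k) 1) (incl k H V W x) = incl k H V W x := by
  obtain ⟨_, y, rfl⟩ := x
  change act k H V W _ (act k H V W _ y) = act k H V W _ y
  rw [act_mul_apply, comul_mul_one]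

theorem proj_incl (x : TensorRep k H V W) : proj k H V W (incl k H V W x) = x :=
  incl_injective (by rw [incl_proj, act_one_incl])

noncomputable instance : SMul H (TensorRep k H V W) where
  smul h x := proj k H V W (act k H V W (comul (R := k) h) (incl k H V W x))

theorem incl_smul (h : H) (x : TensorRep k H V W) :
    incl k H V W (h • x) = act k H V W (comul (R := k) h) (incl k H V W x) := by
  change incl k H V W (proj k H V W (act k H V W (comul (R := k) h) (incl k H V W x))) = _
  rw [incl_proj, act_mul_apply, comul_one_mul]

noncomputable instance : Module H (TensorRep k H V W) where
  one_smul x := incl_injective (by rw [incl_smul, act_one_incl])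
  mul_smul g h x := incl_injective (by simp only [incl_smul, act_mul_apply, comul_mul])
  smul_zero h := incl_injective (by simp only [incl_smul, map_zero])
  smul_add h x y := incl_injective (by simp only [incl_smul, map_add])
  add_smul g h x := incl_injective (by simp only [incl_smul, map_add, LinearMap.add_apply])
  zero_smul x := incl_injective (by simp only [incl_smul, map_zero, LinearMap.zero_apply])

instance : IsScalarTower k H (TensorRep k H V W) where
  smul_assoc c h x := incl_injective (by
    simp only [incl_smul, map_smul, LinearMap.smul_apply])

instance [Module.Finite k V] [Module.Finite k W] : Module.Finite k (TensorRep k H V W) :=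
  inferInstanceAs (Module.Finite k ↥(LinearMap.range (act k H V W (comul (R := k) 1))))

theorem proj_act (h : H) (x : V ⊗[k] W) :
    proj k H V W (act k H V W (comul (R := k) h) x) = h • proj k H V W x :=
  incl_injective (by
    rw [incl_proj, incl_smul, incl_proj, act_mul_apply, act_mul_apply, comul_one_mul,
      comul_mul_one])

theorem proj_eq_of_act_eq {x y : V ⊗[k] W}
    (h : act k H V W (comul (R := k) 1) x = act k H V W (comul (R := k) 1) y) :
    proj k H V W x = proj k H V W y := incl_injective h

variable {V' W' V'' W'' U' : Type*}
  [AddCommGroup V'] [Module k V'] [Module H V'] [IsScalarTower k H V']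
  [AddCommGroup W'] [Module k W'] [Module H W'] [IsScalarTower k H W']
  [AddCommGroup U'] [Module k U'] [Module H U'] [IsScalarTower k H U']
  [AddCommGroup V''] [Module k V''] [Module H V''] [IsScalarTower k H V'']
  [AddCommGroup W''] [Module k W''] [Module H W''] [IsScalarTower k H W'']

theorem map_act (f : V →ₗ[H] V') (g : W →ₗ[H] W') (t : H ⊗[k] H) (x : V ⊗[k] W) :
    TensorProduct.map (f.restrictScalars k) (g.restrictScalars k) (act k H V W t x) =
      act k H V' W' t (TensorProduct.map (f.restrictScalars k) (g.restrictScalars k) x) := by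
  induction t using TensorProduct.induction_on with
  | zero => simp
  | add t t' h h' => simp only [map_add, LinearMap.add_apply, h, h']
  | tmul a b =>
    induction x using TensorProduct.induction_on with
    | zero => simp
    | add x x' h h' => simp only [map_add, h, h']
    | tmul v w => simp

/-- The tensor product of two module maps: the restriction of `f ⊗ g`. -/
noncomputable def tensorMap (f : V →ₗ[H] V') (g : W →ₗ[H] W') :
    TensorRep k H V W →ₗ[H] TensorRep k H V' W' where
  toFun x := proj k H V' W'
    (TensorProduct.map (f.restrictScalars k) (g.restrictScalars k) (incl k H V W x))
  map_add' x y := by simp only [map_add]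
  map_smul' h x := by
    simp only [incl_smul, map_act, proj_act, RingHom.id_apply]

theorem incl_tensorMap (f : V →ₗ[H] V') (g : W →ₗ[H] W') (x : TensorRep k H V W) :
    incl k H V' W' (tensorMap f g x) =
      TensorProduct.map (f.restrictScalars k) (g.restrictScalars k) (incl k H V W x) := by
  change incl k H V' W' (proj k H V' W' _) = _
  rw [incl_proj, ← map_act, act_one_incl]

/-- The inclusion of `(V ⊗ W) ⊗ U` (tensor products of representations) into the tensor product
of vector spaces. -/
noncomputable def inclL (k H V W U : Type*) [Field k] [Ring H] [Algebra k H] [WeakBialgebra k H]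
    [AddCommGroup V] [Module k V] [Module H V] [IsScalarTower k H V]
    [AddCommGroup W] [Module k W] [Module H W] [IsScalarTower k H W]
    [AddCommGroup U] [Module k U] [Module H U] [IsScalarTower k H U] :
    TensorRep k H (TensorRep k H V W) U →ₗ[k] (V ⊗[k] W) ⊗[k] U :=
  (incl k H V W).rTensor U ∘ₗ incl k H (TensorRep k H V W) U

/-- The inclusion of `V ⊗ (W ⊗ U)` (tensor products of representations) into the tensor product
of vector spaces. -/
noncomputable def inclR (k H V W U : Type*) [Field k] [Ring H] [Algebra k H] [WeakBialgebra k H]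
    [AddCommGroup V] [Module k V] [Module H V] [IsScalarTower k H V]
    [AddCommGroup W] [Module k W] [Module H W] [IsScalarTower k H W]
    [AddCommGroup U] [Module k U] [Module H U] [IsScalarTower k H U] :
    TensorRep k H V (TensorRep k H W U) →ₗ[k] V ⊗[k] (W ⊗[k] U) :=
  (incl k H W U).lTensor V ∘ₗ incl k H V (TensorRep k H W U)

theorem inclL_injective : Function.Injective (inclL k H V W U) :=
  (Module.Flat.rTensor_preserves_injective_linearMap _ incl_injective).comp incl_injective

theorem inclR_injective : Function.Injective (inclR k H V W U) :=
  (Module.Flat.lTensor_preserves_injective_linearMap _ incl_injective).comp incl_injective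

theorem rTensor_incl_act (t : H ⊗[k] H) (x : TensorRep k H V W ⊗[k] U) :
    (incl k H V W).rTensor U (act k H (TensorRep k H V W) U t x) =
      actL k H V W U (comul.rTensor H t) ((incl k H V W).rTensor U x) := by
  induction t using TensorProduct.induction_on with
  | zero => simp
  | add t t' h h' => simp only [map_add, LinearMap.add_apply, h, h']
  | tmul a b =>
    induction x using TensorProduct.induction_on with
    | zero => simp
    | add x x' h h' => simp only [map_add, h, h']
    | tmul v w => simp [incl_smul]

theorem lTensor_incl_act (t : H ⊗[k] H) (x : V ⊗[k] TensorRep k H W U) :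
    (incl k H W U).lTensor V (act k H V (TensorRep k H W U) t x) =
      actR k H V W U (comul.lTensor H t) ((incl k H W U).lTensor V x) := by
  induction t using TensorProduct.induction_on with
  | zero => simp
  | add t t' h h' => simp only [map_add, LinearMap.add_apply, h, h']
  | tmul a b =>
    induction x using TensorProduct.induction_on with
    | zero => simp
    | add x x' h h' => simp only [map_add, h, h']
    | tmul v w => simp [incl_smul]

theorem inclL_smul (h : H) (x : TensorRep k H (TensorRep k H V W) U) :
    inclL k H V W U (h • x) =
      actL k H V W U (comul.rTensor H (comul (R := k) h)) (inclL k H V W U x) := by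
  simp only [inclL, LinearMap.comp_apply, incl_smul, rTensor_incl_act]

theorem inclR_smul (h : H) (x : TensorRep k H V (TensorRep k H W U)) :
    inclR k H V W U (h • x) =
      actR k H V W U (comul.lTensor H (comul (R := k) h)) (inclR k H V W U x) := by
  simp only [inclR, LinearMap.comp_apply, incl_smul, lTensor_incl_act]

/-- The projection onto `V ⊗ (W ⊗ U)` (tensor products of representations). -/
noncomputable def projR (k H V W U : Type*) [Field k] [Ring H] [Algebra k H] [WeakBialgebra k H]
    [AddCommGroup V] [Module k V] [Module H V] [IsScalarTower k H V]
    [AddCommGroup W] [Module k W] [Module H W] [IsScalarTower k H W]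
    [AddCommGroup U] [Module k U] [Module H U] [IsScalarTower k H U] :
    V ⊗[k] (W ⊗[k] U) →ₗ[k] TensorRep k H V (TensorRep k H W U) :=
  proj k H V (TensorRep k H W U) ∘ₗ (proj k H W U).lTensor V

/-- The projection onto `(V ⊗ W) ⊗ U` (tensor products of representations). -/
noncomputable def projL (k H V W U : Type*) [Field k] [Ring H] [Algebra k H] [WeakBialgebra k H]
    [AddCommGroup V] [Module k V] [Module H V] [IsScalarTower k H V]
    [AddCommGroup W] [Module k W] [Module H W] [IsScalarTower k H W]
    [AddCommGroup U] [Module k U] [Module H U] [IsScalarTower k H U] :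
    (V ⊗[k] W) ⊗[k] U →ₗ[k] TensorRep k H (TensorRep k H V W) U :=
  proj k H (TensorRep k H V W) U ∘ₗ (proj k H V W).rTensor U

theorem rTensor_comul_mul (t : H ⊗[k] H) :
    (comul (R := k)).rTensor H t * (comul (R := k) 1 ⊗ₜ[k] 1) = comul.rTensor H t := by
  induction t using TensorProduct.induction_on with
  | zero => simp
  | add t t' h h' => simp only [map_add, add_mul, h, h']
  | tmul a b => simp [comul_mul_one]

theorem lTensor_comul_mul (t : H ⊗[k] H) :
    (comul (R := k)).lTensor H t * (1 ⊗ₜ[k] comul (R := k) 1) = comul.lTensor H t := by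
  induction t using TensorProduct.induction_on with
  | zero => simp
  | add t t' h h' => simp only [map_add, add_mul, h, h']
  | tmul a b => simp [comul_mul_one]

theorem inclL_projL (x : (V ⊗[k] W) ⊗[k] U) :
    inclL k H V W U (projL k H V W U x) =
      actL k H V W U (comul.rTensor H (comul (R := k) 1)) x := by
  simp only [inclL, projL, LinearMap.comp_apply, incl_proj, rTensor_incl_act]
  have h1 : (incl k H V W).rTensor U ((proj k H V W).rTensor U x) =
      actL k H V W U (comul (R := k) 1 ⊗ₜ[k] 1) x := by
    induction x using TensorProduct.induction_on with
    | zero => simp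
    | add x x' h h' => simp only [map_add, h, h']
    | tmul v w => simp [incl_proj]
  rw [h1, ← Module.End.mul_apply, ← map_mul, rTensor_comul_mul]

theorem inclR_projR (x : V ⊗[k] (W ⊗[k] U)) :
    inclR k H V W U (projR k H V W U x) =
      actR k H V W U (comul.lTensor H (comul (R := k) 1)) x := by
  simp only [inclR, projR, LinearMap.comp_apply, incl_proj, lTensor_incl_act]
  have h1 : (incl k H W U).lTensor V ((proj k H W U).lTensor V x) =
      actR k H V W U (1 ⊗ₜ[k] comul (R := k) 1) x := by
    induction x using TensorProduct.induction_on with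
    | zero => simp
    | add x x' h h' => simp only [map_add, h, h']
    | tmul v w => simp [incl_proj]
  rw [h1, ← Module.End.mul_apply, ← map_mul, lTensor_comul_mul]

theorem actL_inclL (x : TensorRep k H (TensorRep k H V W) U) :
    actL k H V W U (comul.rTensor H (comul (R := k) 1)) (inclL k H V W U x) =
      inclL k H V W U x := by
  rw [← inclL_smul, one_smul]

theorem actR_inclR (x : TensorRep k H V (TensorRep k H W U)) :
    actR k H V W U (comul.lTensor H (comul (R := k) 1)) (inclR k H V W U x) =
      inclR k H V W U x := by
  rw [← inclR_smul, one_smul]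

theorem inclR_projR_assoc (x : TensorRep k H (TensorRep k H V W) U) :
    inclR k H V W U (projR k H V W U (TensorProduct.assoc k V W U (inclL k H V W U x))) =
      TensorProduct.assoc k V W U (inclL k H V W U x) := by
  rw [inclR_projR, ← coassoc_apply, ← assoc_actL, actL_inclL]

theorem inclL_projL_assoc (x : TensorRep k H V (TensorRep k H W U)) :
    inclL k H V W U (projL k H V W U ((TensorProduct.assoc k V W U).symm (inclR k H V W U x))) =
      (TensorProduct.assoc k V W U).symm (inclR k H V W U x) := by
  apply (TensorProduct.assoc k V W U).injective
  rw [inclL_projL, assoc_actL, coassoc_apply, LinearEquiv.apply_symm_apply, actR_inclR]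

/-- The associativity isomorphism: the restriction of `(v ⊗ w) ⊗ u ↦ v ⊗ (w ⊗ u)`. -/
noncomputable def assocEquiv (k H V W U : Type*) [Field k] [Ring H] [Algebra k H]
    [WeakBialgebra k H]
    [AddCommGroup V] [Module k V] [Module H V] [IsScalarTower k H V]
    [AddCommGroup W] [Module k W] [Module H W] [IsScalarTower k H W]
    [AddCommGroup U] [Module k U] [Module H U] [IsScalarTower k H U] :
    TensorRep k H (TensorRep k H V W) U ≃ₗ[H] TensorRep k H V (TensorRep k H W U) where
  toFun x := projR k H V W U (TensorProduct.assoc k V W U (inclL k H V W U x))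
  invFun x := projL k H V W U ((TensorProduct.assoc k V W U).symm (inclR k H V W U x))
  map_add' x y := by simp only [map_add]
  map_smul' h x := inclR_injective (by
    rw [RingHom.id_apply, inclR_smul, inclR_projR_assoc, inclR_projR_assoc, inclL_smul,
      assoc_actL, coassoc_apply])
  left_inv x := inclL_injective (by
    rw [inclL_projL_assoc, inclR_projR_assoc, LinearEquiv.symm_apply_apply])
  right_inv x := inclR_injective (by
    rw [inclR_projR_assoc, inclL_projL_assoc, LinearEquiv.apply_symm_apply])

theorem inclR_assocEquiv (x : TensorRep k H (TensorRep k H V W) U) :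
    inclR k H V W U (assocEquiv k H V W U x) =
      TensorProduct.assoc k V W U (inclL k H V W U x) := inclR_projR_assoc x

theorem inclL_tensorMap (f : V →ₗ[H] V') (g : W →ₗ[H] W') (h : U →ₗ[H] U')
    (x : TensorRep k H (TensorRep k H V W) U) :
    inclL k H V' W' U' (tensorMap (tensorMap f g) h x) =
      TensorProduct.map (TensorProduct.map (f.restrictScalars k) (g.restrictScalars k))
        (h.restrictScalars k) (inclL k H V W U x) := by
  simp only [inclL, LinearMap.comp_apply, incl_tensorMap]
  induction incl k H (TensorRep k H V W) U x using TensorProduct.induction_on with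
  | zero => simp
  | add x x' h h' => simp only [map_add, h, h']
  | tmul v w => simp [incl_tensorMap]

theorem inclR_tensorMap (f : V →ₗ[H] V') (g : W →ₗ[H] W') (h : U →ₗ[H] U')
    (x : TensorRep k H V (TensorRep k H W U)) :
    inclR k H V' W' U' (tensorMap f (tensorMap g h) x) =
      TensorProduct.map (f.restrictScalars k)
        (TensorProduct.map (g.restrictScalars k) (h.restrictScalars k))
        (inclR k H V W U x) := by
  simp only [inclR, LinearMap.comp_apply, incl_tensorMap]
  induction incl k H V (TensorRep k H W U) x using TensorProduct.induction_on with
  | zero => simp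
  | add x x' h h' => simp only [map_add, h, h']
  | tmul v w => simp [incl_tensorMap]

theorem assocEquiv_naturality (f : V →ₗ[H] V') (g : W →ₗ[H] W') (h : U →ₗ[H] U')
    (x : TensorRep k H (TensorRep k H V W) U) :
    assocEquiv k H V' W' U' (tensorMap (tensorMap f g) h x) =
      tensorMap f (tensorMap g h) (assocEquiv k H V W U x) := by
  apply inclR_injective
  rw [inclR_assocEquiv, inclR_tensorMap, inclR_assocEquiv, inclL_tensorMap]
  induction inclL k H V W U x using TensorProduct.induction_on with
  | zero => simp
  | add x x' h h' => simp only [map_add, h, h']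
  | tmul y u =>
    induction y using TensorProduct.induction_on with
    | zero => simp
    | add x x' h h' => simp only [map_add, h, h', TensorProduct.add_tmul]
    | tmul v w => simp

section Pentagon

variable {X : Type*} [AddCommGroup X] [Module k X] [Module H X] [IsScalarTower k H X]

theorem pentagon_apply (x : TensorRep k H (TensorRep k H (TensorRep k H V W) U) X) :
    tensorMap LinearMap.id (assocEquiv k H W U X).toLinearMap
      (assocEquiv k H V (TensorRep k H W U) X
        (tensorMap (assocEquiv k H V W U).toLinearMap LinearMap.id x)) =
      assocEquiv k H V W (TensorRep k H U X)
        (assocEquiv k H (TensorRep k H V W) U X x) := by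
  have inj : Function.Injective ((inclR k H W U X).lTensor V ∘ₗ
      incl k H V (TensorRep k H W (TensorRep k H U X))) :=
    (Module.Flat.lTensor_preserves_injective_linearMap _ inclR_injective).comp incl_injective
  apply inj
  simp only [LinearMap.comp_apply, incl_tensorMap]
  set w := tensorMap (assocEquiv k H V W U).toLinearMap LinearMap.id x with hw
  set z := assocEquiv k H V (TensorRep k H W U) X w with hz
  set y := assocEquiv k H (TensorRep k H V W) U X x with hy
  -- the left-hand side
  have e1 : ∀ t : V ⊗[k] TensorRep k H (TensorRep k H W U) X,
      (inclR k H W U X).lTensor V (TensorProduct.map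
        ((LinearMap.id : V →ₗ[H] V).restrictScalars k)
        ((assocEquiv k H W U X).toLinearMap.restrictScalars k) t) =
      (TensorProduct.assoc k W U X).toLinearMap.lTensor V
        (((incl k H W U).rTensor X).lTensor V ((incl k H (TensorRep k H W U) X).lTensor V t)) := by
    intro t
    induction t using TensorProduct.induction_on with
    | zero => simp
    | add t t' h h' => simp only [map_add, h, h']
    | tmul v t => simp [inclR_assocEquiv, inclL]
  have e2 : (incl k H (TensorRep k H W U) X).lTensor V
      (incl k H V (TensorRep k H (TensorRep k H W U) X) z) =
      TensorProduct.assoc k V (TensorRep k H W U) X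
        (inclL k H V (TensorRep k H W U) X w) := inclR_assocEquiv w
  have e3 : ∀ t : (V ⊗[k] TensorRep k H W U) ⊗[k] X,
      ((incl k H W U).rTensor X).lTensor V (TensorProduct.assoc k V (TensorRep k H W U) X t) =
      TensorProduct.assoc k V (W ⊗[k] U) X (((incl k H W U).lTensor V).rTensor X t) := by
    intro t
    induction t using TensorProduct.induction_on with
    | zero => simp
    | add t t' h h' => simp only [map_add, h, h']
    | tmul t c =>
      induction t using TensorProduct.induction_on with
      | zero => simp
      | add t t' h h' => simp only [map_add, h, h', TensorProduct.add_tmul]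
      | tmul a b => simp
  have e4 : ∀ t : TensorRep k H (TensorRep k H V W) U ⊗[k] X,
      ((incl k H W U).lTensor V).rTensor X ((incl k H V (TensorRep k H W U)).rTensor X
        (TensorProduct.map ((assocEquiv k H V W U).toLinearMap.restrictScalars k)
          ((LinearMap.id : X →ₗ[H] X).restrictScalars k) t)) =
      (TensorProduct.assoc k V W U).toLinearMap.rTensor X ((inclL k H V W U).rTensor X t) := by
    intro t
    induction t using TensorProduct.induction_on with
    | zero => simp
    | add t t' h h' => simp only [map_add, h, h']
    | tmul t c =>
      have := inclR_assocEquiv t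
      simp only [inclR, LinearMap.comp_apply] at this
      simp [this]
  -- the right-hand side
  have f1 : ∀ t : V ⊗[k] TensorRep k H W (TensorRep k H U X),
      (inclR k H W U X).lTensor V t = ((incl k H U X).lTensor W).lTensor V
        ((incl k H W (TensorRep k H U X)).lTensor V t) := by
    intro t
    rw [← LinearMap.comp_apply, ← LinearMap.lTensor_comp]
    rfl
  have f2 : (incl k H W (TensorRep k H U X)).lTensor V
      (incl k H V (TensorRep k H W (TensorRep k H U X))
        (assocEquiv k H V W (TensorRep k H U X) y)) =
      TensorProduct.assoc k V W (TensorRep k H U X)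
        (inclL k H V W (TensorRep k H U X) y) := inclR_assocEquiv y
  have f3 : ∀ t : TensorRep k H V W ⊗[k] TensorRep k H U X,
      ((incl k H U X).lTensor W).lTensor V (TensorProduct.assoc k V W (TensorRep k H U X)
        ((incl k H V W).rTensor (TensorRep k H U X) t)) =
      TensorProduct.assoc k V W (U ⊗[k] X) ((incl k H V W).rTensor (U ⊗[k] X)
        ((incl k H U X).lTensor (TensorRep k H V W) t)) := by
    intro t
    induction t using TensorProduct.induction_on with
    | zero => simp
    | add t t' h h' => simp only [map_add, h, h']
    | tmul t c =>
      simp only [LinearMap.rTensor_tmul, LinearMap.lTensor_tmul]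
      induction incl k H V W t using TensorProduct.induction_on with
      | zero => simp
      | add t t' h h' => simp only [map_add, h, h', TensorProduct.add_tmul]
      | tmul a b => simp
  have f4 : (incl k H U X).lTensor (TensorRep k H V W)
      (incl k H (TensorRep k H V W) (TensorRep k H U X) y) =
      TensorProduct.assoc k (TensorRep k H V W) U X
        (inclL k H (TensorRep k H V W) U X x) := inclR_assocEquiv x
  have f5 : ∀ t : TensorRep k H (TensorRep k H V W) U ⊗[k] X,
      (incl k H V W).rTensor (U ⊗[k] X) (TensorProduct.assoc k (TensorRep k H V W) U X
        ((incl k H (TensorRep k H V W) U).rTensor X t)) =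
      TensorProduct.assoc k (V ⊗[k] W) U X ((inclL k H V W U).rTensor X t) := by
    intro t
    induction t using TensorProduct.induction_on with
    | zero => simp
    | add t t' h h' => simp only [map_add, h, h']
    | tmul t c =>
      simp only [LinearMap.rTensor_tmul, inclL, LinearMap.comp_apply]
      induction incl k H (TensorRep k H V W) U t using TensorProduct.induction_on with
      | zero => simp
      | add t t' h h' => simp only [map_add, h, h', TensorProduct.add_tmul]
      | tmul a b => simp
  -- the pentagon for vector spaces
  have g1 : ∀ t : ((V ⊗[k] W) ⊗[k] U) ⊗[k] X,
      (TensorProduct.assoc k W U X).toLinearMap.lTensor V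
        (TensorProduct.assoc k V (W ⊗[k] U) X
          ((TensorProduct.assoc k V W U).toLinearMap.rTensor X t)) =
      TensorProduct.assoc k V W (U ⊗[k] X) (TensorProduct.assoc k (V ⊗[k] W) U X t) := by
    intro t
    induction t using TensorProduct.induction_on with
    | zero => simp
    | add t t' h h' => simp only [map_add, h, h']
    | tmul t c =>
      induction t using TensorProduct.induction_on with
      | zero => simp
      | add t t' h h' => simp only [map_add, h, h', TensorProduct.add_tmul]
      | tmul t b =>
        induction t using TensorProduct.induction_on with
        | zero => simp
        | add t t' h h' => simp only [map_add, h, h', TensorProduct.add_tmul]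
        | tmul a b => simp
  rw [e1, e2, e3, f1, f2]
  simp only [inclL, LinearMap.comp_apply]
  rw [f3, f4]
  simp only [inclL, LinearMap.comp_apply]
  rw [f5, hw, incl_tensorMap, e4, g1]

end Pentagon

/-- The unit object: the target subalgebra `H_t`, on which `h` acts by `h · z = ε_t(h z)`. -/
def UnitRep (k H : Type*) [Field k] [Ring H] [Algebra k H] [WeakBialgebra k H] : Type _ :=
  ↥(LinearMap.range (targetMap k H))

namespace UnitRep

noncomputable instance : AddCommGroup (UnitRep k H) :=
  inferInstanceAs (AddCommGroup ↥(LinearMap.range (targetMap k H)))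

noncomputable instance : Module k (UnitRep k H) :=
  inferInstanceAs (Module k ↥(LinearMap.range (targetMap k H)))

/-- The inclusion of the target subalgebra into the algebra. -/
noncomputable def val : UnitRep k H →ₗ[k] H := (LinearMap.range (targetMap k H)).subtype

/-- The element `ε_t(h)` of the target subalgebra. -/
noncomputable def mk : H →ₗ[k] UnitRep k H := (targetMap k H).rangeRestrict

theorem val_injective : Function.Injective (val : UnitRep k H →ₗ[k] H) := Subtype.val_injective

theorem val_mk (h : H) : val (mk (k := k) h) = targetMap k H h := rfl

theorem val_mem (z : UnitRep k H) : val z ∈ LinearMap.range (targetMap k H) := z.2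

theorem mk_val (z : UnitRep k H) : mk (val z) = z :=
  val_injective (targetMap_eq_of_mem (val_mem z))

noncomputable instance : SMul H (UnitRep k H) where
  smul h z := mk (h * val z)

theorem smul_def (h : H) (z : UnitRep k H) : h • z = mk (h * val z) := rfl

theorem val_smul (h : H) (z : UnitRep k H) : val (h • z) = targetMap k H (h * val z) := rfl

noncomputable instance : Module H (UnitRep k H) where
  one_smul z := by rw [smul_def, one_mul, mk_val]
  mul_smul g h z := val_injective (by
    simp only [val_smul, targetMap_mul_targetMap, mul_assoc])
  smul_zero h := val_injective (by simp only [val_smul, map_zero, mul_zero])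
  smul_add h x y := val_injective (by simp only [val_smul, map_add, mul_add])
  add_smul g h x := val_injective (by simp only [val_smul, map_add, add_mul])
  zero_smul x := val_injective (by simp only [val_smul, map_zero, zero_mul])

instance : IsScalarTower k H (UnitRep k H) where
  smul_assoc c h x := val_injective (by
    simp only [val_smul, map_smul, Algebra.smul_mul_assoc])

instance [Module.Finite k H] : Module.Finite k (UnitRep k H) :=
  inferInstanceAs (Module.Finite k ↥(LinearMap.range (targetMap k H)))

noncomputable instance : One (UnitRep k H) := ⟨mk 1⟩

theorem val_one : val (1 : UnitRep k H) = 1 := by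
  obtain ⟨s, hs⟩ := exists_repr_one (k := k) (H := H)
  exact targetMap_one hs

end UnitRep

/-- The linear map `z ⊗ v ↦ z v`. -/
noncomputable def leftAct (k H V : Type*) [Field k] [Ring H] [Algebra k H] [WeakBialgebra k H]
    [AddCommGroup V] [Module k V] [Module H V] [IsScalarTower k H V] :
    UnitRep k H ⊗[k] V →ₗ[k] V :=
  TensorProduct.lift ((Algebra.lsmul k k V).toLinearMap ∘ₗ UnitRep.val)

/-- The linear map `v ⊗ z ↦ z̄ v`, where `z̄ = (id ⊗ ε)(Δ(1)(1 ⊗ z))`. -/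
noncomputable def rightAct (k H V : Type*) [Field k] [Ring H] [Algebra k H] [WeakBialgebra k H]
    [AddCommGroup V] [Module k V] [Module H V] [IsScalarTower k H V] :
    V ⊗[k] UnitRep k H →ₗ[k] V :=
  TensorProduct.lift ((Algebra.lsmul k k V).toLinearMap ∘ₗ barMap k H ∘ₗ UnitRep.val).flip

@[simp]
theorem leftAct_tmul (z : UnitRep k H) (v : V) :
    leftAct k H V (z ⊗ₜ[k] v) = UnitRep.val z • v := rfl

@[simp]
theorem rightAct_tmul (z : UnitRep k H) (v : V) :
    rightAct k H V (v ⊗ₜ[k] z) = barMap k H (UnitRep.val z) • v := rfl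

theorem leftAct_act (h : H) (x : UnitRep k H ⊗[k] V) :
    leftAct k H V (act k H (UnitRep k H) V (comul (R := k) h) x) = h • leftAct k H V x := by
  induction x using TensorProduct.induction_on with
  | zero => simp
  | add t t' h h' => simp only [map_add, smul_add, h, h']
  | tmul z v =>
    have key : ∀ t : H ⊗[k] H, leftAct k H V (act k H (UnitRep k H) V t (z ⊗ₜ[k] v)) =
        TensorProduct.lid k H ((counit ∘ₗ LinearMap.mulRight k (UnitRep.val z)).rTensor H
          (comul (R := k) (1 : H) * t)) • v := by
      intro t
      obtain ⟨s, hs⟩ := exists_repr_one (k := k) (H := H)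
      induction t using TensorProduct.induction_on with
      | zero => simp
      | add t t' h h' => simp only [map_add, LinearMap.add_apply, h, h', mul_add, add_smul]
      | tmul a b =>
        rw [act_tmul, leftAct_tmul, UnitRep.val_smul, targetMap_eq hs, ← hs]
        simp [Finset.sum_mul, Finset.sum_smul, mul_smul, mul_assoc]
    rw [key, comul_one_mul, sum_counit_mul_target _ (UnitRep.val_mem z), mul_smul, leftAct_tmul]

theorem rightAct_act (h : H) (x : V ⊗[k] UnitRep k H) :
    rightAct k H V (act k H V (UnitRep k H) (comul (R := k) h) x) = h • rightAct k H V x := by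
  induction x using TensorProduct.induction_on with
  | zero => simp
  | add t t' h h' => simp only [map_add, smul_add, h, h']
  | tmul v z =>
    have key : ∀ t : H ⊗[k] H, rightAct k H V (act k H V (UnitRep k H) t (v ⊗ₜ[k] z)) =
        TensorProduct.rid k H ((counit ∘ₗ LinearMap.mulRight k (UnitRep.val z)).lTensor H
          (comul (R := k) (1 : H) * t)) • v := by
      intro t
      obtain ⟨s, hs⟩ := exists_repr_one (k := k) (H := H)
      induction t using TensorProduct.induction_on with
      | zero => simp
      | add t t' h h' => simp only [map_add, LinearMap.add_apply, h, h', mul_add, add_smul]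
      | tmul a b =>
        rw [act_tmul, rightAct_tmul, UnitRep.val_smul]
        have := barMap_mul_targetMap (k := k) 1 (b * UnitRep.val z)
        simp only [one_mul] at this
        rw [this, barMap_eq hs, ← hs]
        simp [Finset.sum_mul, Finset.sum_smul, mul_smul, mul_assoc]
    rw [key, comul_one_mul, sum_counit_mul_bar, mul_smul, rightAct_tmul]

/-- `Δ(1)(v ⊗ z w) = Δ(1)(z̄ v ⊗ w)`. -/
theorem act_one_bar (z : UnitRep k H) (v : V) (w : W) :
    act k H V W (comul (R := k) 1) ((barMap k H (UnitRep.val z) • v) ⊗ₜ[k] w) =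
      act k H V W (comul (R := k) 1) (v ⊗ₜ[k] (UnitRep.val z • w)) := by
  have h1 : (barMap k H (UnitRep.val z) • v) ⊗ₜ[k] w =
      act k H V W (barMap k H (UnitRep.val z) ⊗ₜ[k] 1) (v ⊗ₜ[k] w) := by simp
  have h2 : v ⊗ₜ[k] (UnitRep.val z • w) =
      act k H V W (1 ⊗ₜ[k] UnitRep.val z) (v ⊗ₜ[k] w) := by simp
  rw [h1, h2, act_mul_apply, act_mul_apply, comul_one_bar (UnitRep.val_mem z)]

theorem act_one_left (z : UnitRep k H) (v : V) :
    act k H (UnitRep k H) V (comul (R := k) 1) ((1 : UnitRep k H) ⊗ₜ[k] (UnitRep.val z • v)) =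
      act k H (UnitRep k H) V (comul (R := k) 1) (z ⊗ₜ[k] v) := by
  rw [← act_one_bar]
  congr 2
  apply UnitRep.val_injective
  rw [UnitRep.val_smul, UnitRep.val_one, mul_one]
  have := targetMap_mul_barMap (k := k) 1 (UnitRep.val z)
  simp only [one_mul] at this
  rw [this, targetMap_eq_of_mem (UnitRep.val_mem z)]

theorem act_one_right (z : UnitRep k H) (v : V) :
    act k H V (UnitRep k H) (comul (R := k) 1)
      ((barMap k H (UnitRep.val z) • v) ⊗ₜ[k] (1 : UnitRep k H)) =
      act k H V (UnitRep k H) (comul (R := k) 1) (v ⊗ₜ[k] z) := by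
  rw [act_one_bar]
  congr 2
  apply UnitRep.val_injective
  rw [UnitRep.val_smul, UnitRep.val_one, mul_one, targetMap_eq_of_mem (UnitRep.val_mem z)]

/-- The left unit isomorphism, induced by `z ⊗ v ↦ z v`. -/
noncomputable def leftUnitEquiv (k H V : Type*) [Field k] [Ring H] [Algebra k H]
    [WeakBialgebra k H] [AddCommGroup V] [Module k V] [Module H V] [IsScalarTower k H V] :
    TensorRep k H (UnitRep k H) V ≃ₗ[H] V where
  toFun x := leftAct k H V (incl k H (UnitRep k H) V x)
  invFun v := proj k H (UnitRep k H) V (1 ⊗ₜ[k] v)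
  map_add' x y := by simp only [map_add]
  map_smul' h x := by rw [incl_smul, leftAct_act, RingHom.id_apply]
  left_inv x := by
    have key : ∀ t : UnitRep k H ⊗[k] V,
        proj k H (UnitRep k H) V (1 ⊗ₜ[k] leftAct k H V t) = proj k H (UnitRep k H) V t := by
      intro t
      induction t using TensorProduct.induction_on with
      | zero => simp
      | add t t' h h' => simp only [map_add, TensorProduct.tmul_add, h, h']
      | tmul z v => exact proj_eq_of_act_eq (act_one_left z v)
    simp only [key, proj_incl]
  right_inv v := by
    simp only [incl_proj, leftAct_act, one_smul, leftAct_tmul, UnitRep.val_one]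

/-- The right unit isomorphism, induced by `v ⊗ z ↦ z̄ v`. -/
noncomputable def rightUnitEquiv (k H V : Type*) [Field k] [Ring H] [Algebra k H]
    [WeakBialgebra k H] [AddCommGroup V] [Module k V] [Module H V] [IsScalarTower k H V] :
    TensorRep k H V (UnitRep k H) ≃ₗ[H] V where
  toFun x := rightAct k H V (incl k H V (UnitRep k H) x)
  invFun v := proj k H V (UnitRep k H) (v ⊗ₜ[k] 1)
  map_add' x y := by simp only [map_add]
  map_smul' h x := by rw [incl_smul, rightAct_act, RingHom.id_apply]
  left_inv x := by
    have key : ∀ t : V ⊗[k] UnitRep k H,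
        proj k H V (UnitRep k H) (rightAct k H V t ⊗ₜ[k] 1) = proj k H V (UnitRep k H) t := by
      intro t
      induction t using TensorProduct.induction_on with
      | zero => simp
      | add t t' h h' => simp only [map_add, TensorProduct.add_tmul, h, h']
      | tmul v z => exact proj_eq_of_act_eq (act_one_right z v)
    simp only [key, proj_incl]
  right_inv v := by
    obtain ⟨s, hs⟩ := exists_repr_one (k := k) (H := H)
    simp only [incl_proj, rightAct_act, one_smul, rightAct_tmul, UnitRep.val_one, barMap_one hs]

theorem leftUnitEquiv_apply (x : TensorRep k H (UnitRep k H) V) :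
    leftUnitEquiv k H V x = leftAct k H V (incl k H (UnitRep k H) V x) := rfl

theorem rightUnitEquiv_apply (x : TensorRep k H V (UnitRep k H)) :
    rightUnitEquiv k H V x = rightAct k H V (incl k H V (UnitRep k H) x) := rfl

theorem leftUnitEquiv_naturality (f : V →ₗ[H] V') (x : TensorRep k H (UnitRep k H) V) :
    leftUnitEquiv k H V' (tensorMap LinearMap.id f x) = f (leftUnitEquiv k H V x) := by
  rw [leftUnitEquiv_apply, leftUnitEquiv_apply, incl_tensorMap]
  induction incl k H (UnitRep k H) V x using TensorProduct.induction_on with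
  | zero => simp
  | add t t' h h' => simp only [map_add, h, h']
  | tmul z v => simp

theorem rightUnitEquiv_naturality (f : V →ₗ[H] V') (x : TensorRep k H V (UnitRep k H)) :
    rightUnitEquiv k H V' (tensorMap f LinearMap.id x) = f (rightUnitEquiv k H V x) := by
  rw [rightUnitEquiv_apply, rightUnitEquiv_apply, incl_tensorMap]
  induction incl k H V (UnitRep k H) x using TensorProduct.induction_on with
  | zero => simp
  | add t t' h h' => simp only [map_add, h, h']
  | tmul z v => simp

theorem triangle_apply (x : TensorRep k H (TensorRep k H V (UnitRep k H)) W) :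
    tensorMap LinearMap.id (leftUnitEquiv k H W).toLinearMap
      (assocEquiv k H V (UnitRep k H) W x) =
      tensorMap (rightUnitEquiv k H V).toLinearMap LinearMap.id x := by
  apply incl_injective
  rw [← act_one_incl (tensorMap (rightUnitEquiv k H V).toLinearMap LinearMap.id x),
    ← act_one_incl (tensorMap LinearMap.id (leftUnitEquiv k H W).toLinearMap _),
    incl_tensorMap, incl_tensorMap]
  have e1 : ∀ t : V ⊗[k] TensorRep k H (UnitRep k H) W,
      TensorProduct.map ((LinearMap.id : V →ₗ[H] V).restrictScalars k)
        ((leftUnitEquiv k H W).toLinearMap.restrictScalars k) t =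
      (leftAct k H W).lTensor V ((incl k H (UnitRep k H) W).lTensor V t) := by
    intro t
    induction t using TensorProduct.induction_on with
    | zero => simp
    | add t t' h h' => simp only [map_add, h, h']
    | tmul z v => simp [leftUnitEquiv_apply]
  have e2 : ∀ t : TensorRep k H V (UnitRep k H) ⊗[k] W,
      TensorProduct.map ((rightUnitEquiv k H V).toLinearMap.restrictScalars k)
        ((LinearMap.id : W →ₗ[H] W).restrictScalars k) t =
      (rightAct k H V).rTensor W ((incl k H V (UnitRep k H)).rTensor W t) := by
    intro t
    induction t using TensorProduct.induction_on with
    | zero => simp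
    | add t t' h h' => simp only [map_add, h, h']
    | tmul z v => simp [rightUnitEquiv_apply]
  have e3 : (incl k H (UnitRep k H) W).lTensor V
      (incl k H V (TensorRep k H (UnitRep k H) W) (assocEquiv k H V (UnitRep k H) W x)) =
      TensorProduct.assoc k V (UnitRep k H) W
        ((incl k H V (UnitRep k H)).rTensor W (incl k H (TensorRep k H V (UnitRep k H)) W x)) :=
    inclR_assocEquiv x
  rw [e1, e2, e3]
  induction (incl k H V (UnitRep k H)).rTensor W
    (incl k H (TensorRep k H V (UnitRep k H)) W x) using TensorProduct.induction_on with
  | zero => simp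
  | add t t' h h' => simp only [map_add, h, h']
  | tmul t w =>
    induction t using TensorProduct.induction_on with
    | zero => simp
    | add t t' h h' => simp only [map_add, h, h', TensorProduct.add_tmul]
    | tmul v z => simpa using (act_one_bar z v w).symm

end Rep

end WeakBialgebra

universe u w

/-- A finite-dimensional left module over a `k`-algebra `H`. -/
structure FinRep (k : Type u) (H : Type w) [Field k] [Ring H] [Algebra k H] where
  carrier : Type w
  [addCommGroup : AddCommGroup carrier]
  [moduleBase : Module k carrier]
  [module : Module H carrier]
  [isScalarTower : IsScalarTower k H carrier]
  [finite : Module.Finite k carrier]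

namespace FinRep

attribute [instance] addCommGroup moduleBase module isScalarTower finite

section Category

variable {k : Type u} {H : Type w} [Field k] [Ring H] [Algebra k H]

instance : CoeSort (FinRep k H) (Type w) := ⟨FinRep.carrier⟩

/-- The morphisms are the `H`-linear maps. -/
instance : Category (FinRep k H) where
  Hom V W := V →ₗ[H] W
  id V := LinearMap.id
  comp f g := g ∘ₗ f

instance : Preadditive (FinRep k H) where
  homGroup V W := inferInstanceAs (AddCommGroup (V →ₗ[H] W))
  add_comp _ _ _ f f' g := LinearMap.comp_add f f' g
  comp_add _ _ _ _ _ _ := rfl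

instance : Linear k (FinRep k H) where
  homModule V W := inferInstanceAs (Module k (V →ₗ[H] W))
  smul_comp U V W c f g := LinearMap.ext fun x =>
    (LinearMap.restrictScalars k (show V →ₗ[H] W from g)).map_smul c
      ((show U →ₗ[H] V from f) x)
  comp_smul _ _ _ _ _ _ := rfl

/-- A linear equivalence of modules as an isomorphism in the category. -/
def isoOfEquiv {V W : FinRep k H} (e : (V : Type w) ≃ₗ[H] W) : V ≅ W where
  hom := e.toLinearMap
  inv := e.symm.toLinearMap
  hom_inv_id := LinearMap.ext fun x => e.symm_apply_apply x
  inv_hom_id := LinearMap.ext fun x => e.apply_symm_apply x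

end Category

section Monoidal

open WeakBialgebra

variable {k : Type u} {H : Type w} [Field k] [Ring H] [Algebra k H] [WeakBialgebra k H]
  [Module.Finite k H]

noncomputable instance : MonoidalCategoryStruct (FinRep k H) where
  tensorObj V W := ⟨TensorRep k H V W⟩
  whiskerLeft V _ _ g := tensorMap (LinearMap.id : V →ₗ[H] V) g
  whiskerRight f W := tensorMap f (LinearMap.id : W →ₗ[H] W)
  tensorHom f g := tensorMap f g
  tensorUnit := ⟨UnitRep k H⟩
  associator V W U := isoOfEquiv (assocEquiv k H V W U)
  leftUnitor V := isoOfEquiv (leftUnitEquiv k H V)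
  rightUnitor V := isoOfEquiv (rightUnitEquiv k H V)

/-- The monoidal category of finite-dimensional representations of a finite-dimensional weak
bialgebra. -/
noncomputable instance : MonoidalCategory (FinRep k H) :=
  MonoidalCategory.ofTensorHom
    (id_tensorHom_id := fun V W => LinearMap.ext fun x => incl_injective (by
      refine (incl_tensorMap _ _ x).trans ?_
      refine (DFunLike.congr_fun (TensorProduct.map_id (R := k) (M := V) (N := W)) _).trans rfl))
    (id_tensorHom := fun _ _ _ _ => rfl)
    (tensorHom_id := fun _ _ => rfl)
    (tensorHom_comp_tensorHom := fun f₁ f₂ g₁ g₂ => LinearMap.ext fun x => incl_injective (by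
      refine (incl_tensorMap g₁ g₂ (tensorMap f₁ f₂ x)).trans ?_
      refine Eq.trans ?_ (incl_tensorMap (k := k) (g₁ ∘ₗ f₁) (g₂ ∘ₗ f₂) x).symm
      rw [incl_tensorMap]
      exact (DFunLike.congr_fun (TensorProduct.map_comp (g₁.restrictScalars k)
        (g₂.restrictScalars k) (f₁.restrictScalars k) (f₂.restrictScalars k)) _).symm))
    (associator_naturality := fun f g h => LinearMap.ext fun x => assocEquiv_naturality f g h x)
    (leftUnitor_naturality := fun f => LinearMap.ext fun x => leftUnitEquiv_naturality f x)
    (rightUnitor_naturality := fun f => LinearMap.ext fun x => rightUnitEquiv_naturality f x)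
    (pentagon := fun _ _ _ _ => LinearMap.ext fun x => pentagon_apply x)
    (triangle := fun _ _ => LinearMap.ext fun x => triangle_apply x)

end Monoidal

end FinRep

/-- A fusion category over `k`: an abelian `k`-linear rigid monoidal category with `k`-bilinear
tensor product, finite-dimensional spaces of morphisms, every object a finite direct sum of simple
objects, finitely many simple objects up to isomorphism, and a simple unit object. -/
structure IsFusionCategory (k : Type*) [Field k] (C : Type*) [Category C] [Preadditive C]
    [Linear k C] [MonoidalCategory C] : Prop where
  [hasFiniteProducts : Limits.HasFiniteProducts C]
  [hasKernels : Limits.HasKernels C]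
  [hasCokernels : Limits.HasCokernels C]
  [normalMono : IsNormalMonoCategory C]
  [normalEpi : IsNormalEpiCategory C]
  [monoidalPreadditive : MonoidalPreadditive C]
  [monoidalLinear : MonoidalLinear k C]
  rigid : ∀ X : C, Nonempty (HasLeftDual X) ∧ Nonempty (HasRightDual X)
  finite_hom : ∀ X Y : C, Module.Finite k (X ⟶ Y)
  semisimple : ∀ X : C, ∃ (n : ℕ) (S : Fin n → C) (b : Limits.Bicone S),
    (∀ i, Simple (S i)) ∧ Nonempty b.IsBilimit ∧ Nonempty (X ≅ b.pt)
  finite_simples : ∃ (n : ℕ) (S : Fin n → C), ∀ X : C, Simple X → ∃ i, Nonempty (X ≅ S i)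
  simple_unit : Simple (MonoidalCategoryStruct.tensorUnit C)

/-- A weak Hopf algebra is a weak bialgebra with an antipode: a linear map `S` such that
`m(id ⊗ S)Δ = ε_t`, `m(S ⊗ id)Δ = ε_s` and `m²(S ⊗ id ⊗ S)Δ² = S`. -/
def IsWeakHopf (k : Type*) (H : Type*) [Field k] [Ring H] [Algebra k H] [WeakBialgebra k H] :
    Prop :=
  ∃ S : H →ₗ[k] H,
    LinearMap.mul' k H ∘ₗ S.lTensor H ∘ₗ Coalgebra.comul = WeakBialgebra.targetMap k H ∧
    LinearMap.mul' k H ∘ₗ S.rTensor H ∘ₗ Coalgebra.comul = WeakBialgebra.sourceMap k H ∧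
    LinearMap.mul' k H ∘ₗ
      TensorProduct.map S (LinearMap.mul' k H ∘ₗ S.lTensor H ∘ₗ Coalgebra.comul) ∘ₗ
        Coalgebra.comul = S

/-- A finite-dimensional semisimple weak Hopf algebra is connected if its category of
finite-dimensional representations is a fusion category. -/
structure IsConnectedWeakHopf (k : Type u) (H : Type w) [Field k] [Ring H] [Algebra k H]
    [WeakBialgebra k H] [Module.Finite k H] : Prop where
  isWeakHopf : IsWeakHopf k H
  isSemisimpleRing : IsSemisimpleRing H
  isFusion : IsFusionCategory k (FinRep k H)

/-- A groupoid with set of objects `P` and set of arrows `G`. Composition is written from left to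
right; `comp a b` is meaningful only if `tgt a = src b`, and every axiom is conditional on this. -/
structure SetGroupoid (P G : Type*) where
  src : G → P
  tgt : G → P
  one : P → G
  comp : G → G → G
  inv : G → G
  src_one : ∀ p, src (one p) = p
  tgt_one : ∀ p, tgt (one p) = p
  src_comp : ∀ a b, tgt a = src b → src (comp a b) = src a
  tgt_comp : ∀ a b, tgt a = src b → tgt (comp a b) = tgt b
  one_comp : ∀ a, comp (one (src a)) a = a
  comp_one : ∀ a, comp a (one (tgt a)) = a
  assoc : ∀ a b c, tgt a = src b → tgt b = src c → comp (comp a b) c = comp a (comp b c)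
  src_inv : ∀ a, src (inv a) = tgt a
  tgt_inv : ∀ a, tgt (inv a) = src a
  inv_comp : ∀ a, comp (inv a) a = one (tgt a)
  comp_inv : ∀ a, comp a (inv a) = one (src a)

namespace SetGroupoid

section Basic

variable {P G : Type*} (𝒢 : SetGroupoid P G)

/-- A groupoid is connected if it is nonempty and any two objects are joined by an arrow. -/
def IsConnected : Prop :=
  Nonempty P ∧ ∀ p q : P, ∃ g : G, 𝒢.src g = p ∧ 𝒢.tgt g = q

/-- The opposite groupoid. -/
def op : SetGroupoid P G where
  src := 𝒢.tgt
  tgt := 𝒢.src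
  one := 𝒢.one
  comp a b := 𝒢.comp b a
  inv := 𝒢.inv
  src_one := 𝒢.tgt_one
  tgt_one := 𝒢.src_one
  src_comp a b h := 𝒢.tgt_comp b a h.symm
  tgt_comp a b h := 𝒢.src_comp b a h.symm
  one_comp := 𝒢.comp_one
  comp_one := 𝒢.one_comp
  assoc a b c h h' := (𝒢.assoc c b a h'.symm h.symm).symm
  src_inv := 𝒢.tgt_inv
  tgt_inv := 𝒢.src_inv
  inv_comp := 𝒢.comp_inv
  comp_inv := 𝒢.inv_comp

variable {𝒢}

theorem one_comp' {a : G} {p : P} (h : 𝒢.src a = p) : 𝒢.comp (𝒢.one p) a = a := by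
  rw [← h, 𝒢.one_comp]

theorem comp_one' {a : G} {p : P} (h : 𝒢.tgt a = p) : 𝒢.comp a (𝒢.one p) = a := by
  rw [← h, 𝒢.comp_one]

theorem inv_comp_cancel {a b : G} (h : 𝒢.tgt a = 𝒢.src b) :
    𝒢.comp (𝒢.inv a) (𝒢.comp a b) = b := by
  rw [← 𝒢.assoc _ _ _ (𝒢.tgt_inv a) h, 𝒢.inv_comp, one_comp' h.symm]

theorem comp_inv_cancel {a b : G} (h : 𝒢.src a = 𝒢.src b) :
    𝒢.comp a (𝒢.comp (𝒢.inv a) b) = b := by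
  rw [← 𝒢.assoc _ _ _ (𝒢.src_inv a).symm ((𝒢.tgt_inv a).trans h), 𝒢.comp_inv, one_comp' h.symm]

theorem comp_comp_inv_cancel {a b : G} (h : 𝒢.tgt a = 𝒢.src b) :
    𝒢.comp (𝒢.comp a b) (𝒢.inv b) = a := by
  rw [𝒢.assoc _ _ _ h (𝒢.src_inv b).symm, 𝒢.comp_inv, comp_one' h]

theorem comp_inv_comp_cancel {a b : G} (h : 𝒢.tgt a = 𝒢.tgt b) :
    𝒢.comp (𝒢.comp a (𝒢.inv b)) b = a := by
  rw [𝒢.assoc _ _ _ (h.trans (𝒢.src_inv b).symm) (𝒢.tgt_inv b), 𝒢.inv_comp, comp_one' h]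

theorem left_cancel {a b c : G} (hb : 𝒢.tgt a = 𝒢.src b) (hc : 𝒢.tgt a = 𝒢.src c)
    (h : 𝒢.comp a b = 𝒢.comp a c) : b = c := by
  rw [← inv_comp_cancel hb, h, inv_comp_cancel hc]

theorem right_cancel {a b c : G} (hb : 𝒢.tgt b = 𝒢.src a) (hc : 𝒢.tgt c = 𝒢.src a)
    (h : 𝒢.comp b a = 𝒢.comp c a) : b = c := by
  rw [← comp_comp_inv_cancel hb, h, comp_comp_inv_cancel hc]

end Basic

section Algebra

variable {P G : Type*} (𝒢 : SetGroupoid P G) (k : Type*) [Field k]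

/-- The groupoid algebra: the vector space with basis the set of arrows; the product of two arrows
is their composition if they are composable, and zero otherwise. -/
def Alg (_ : SetGroupoid P G) (k : Type*) [Field k] : Type _ := G →₀ k

namespace Alg

noncomputable instance : AddCommGroup (𝒢.Alg k) := inferInstanceAs (AddCommGroup (G →₀ k))

noncomputable instance : Module k (𝒢.Alg k) := inferInstanceAs (Module k (G →₀ k))

instance [Finite G] : Module.Finite k (𝒢.Alg k) := inferInstanceAs (Module.Finite k (G →₀ k))

variable {k}

/-- The basis element given by an arrow. -/
noncomputable def e (a : G) : 𝒢.Alg k := Finsupp.single a 1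

/-- The linear map with prescribed values on the basis of arrows. -/
noncomputable def lin {M : Type*} [AddCommGroup M] [Module k M] (f : G → M) : 𝒢.Alg k →ₗ[k] M :=
  Finsupp.linearCombination k f

variable {𝒢}

@[simp]
theorem lin_e {M : Type*} [AddCommGroup M] [Module k M] (f : G → M) (a : G) :
    lin 𝒢 f (e 𝒢 a : 𝒢.Alg k) = f a :=
  (Finsupp.linearCombination_single k (1 : k) a).trans (one_smul k (f a))

theorem hom_ext {M : Type*} [AddCommGroup M] [Module k M] {f g : 𝒢.Alg k →ₗ[k] M}
    (h : ∀ a, f (e 𝒢 a) = g (e 𝒢 a)) : f = g :=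
  Finsupp.lhom_ext' fun a => LinearMap.ext_ring (h a)

open scoped Classical in
/-- The bilinear extension of the composition of arrows. -/
noncomputable def mulMap (𝒢 : SetGroupoid P G) : 𝒢.Alg k →ₗ[k] 𝒢.Alg k →ₗ[k] 𝒢.Alg k :=
  lin 𝒢 fun a => lin 𝒢 fun b => if 𝒢.tgt a = 𝒢.src b then e 𝒢 (𝒢.comp a b) else 0

noncomputable instance : Mul (𝒢.Alg k) := ⟨fun x y => mulMap 𝒢 x y⟩

theorem mul_def (x y : 𝒢.Alg k) : x * y = mulMap 𝒢 x y := rfl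

open scoped Classical in
theorem e_mul_e (a b : G) : (e 𝒢 a * e 𝒢 b : 𝒢.Alg k) =
    if 𝒢.tgt a = 𝒢.src b then e 𝒢 (𝒢.comp a b) else 0 := by
  rw [mul_def, mulMap, lin_e, lin_e]

theorem basis_induction {p : 𝒢.Alg k → Prop} (x : 𝒢.Alg k) (zero : p 0)
    (add : ∀ x y, p x → p y → p (x + y)) (basis : ∀ (c : k) (a : G), p (c • e 𝒢 a)) : p x :=
  Finsupp.induction_linear x zero (fun x y => add x y) fun a c => by
    have := basis c a
    rwa [show (c • e 𝒢 a : 𝒢.Alg k) = Finsupp.single a c from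
      (Finsupp.smul_single' c a 1).trans (by rw [mul_one])] at this

protected theorem add_mul (x y z : 𝒢.Alg k) : (x + y) * z = x * z + y * z := by
  simp only [mul_def, map_add, LinearMap.add_apply]

protected theorem mul_add (x y z : 𝒢.Alg k) : x * (y + z) = x * y + x * z := by
  simp only [mul_def, map_add]

protected theorem zero_mul (x : 𝒢.Alg k) : 0 * x = 0 := by
  simp only [mul_def, map_zero, LinearMap.zero_apply]

protected theorem mul_zero (x : 𝒢.Alg k) : x * 0 = 0 := by
  simp only [mul_def, map_zero]

protected theorem smul_mul (c : k) (x y : 𝒢.Alg k) : c • x * y = c • (x * y) := by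
  simp only [mul_def, map_smul, LinearMap.smul_apply]

protected theorem mul_smul (c : k) (x y : 𝒢.Alg k) : x * c • y = c • (x * y) := by
  simp only [mul_def, map_smul]

protected theorem mul_assoc (x y z : 𝒢.Alg k) : x * y * z = x * (y * z) := by
  induction x using basis_induction with
  | zero => simp only [Alg.zero_mul]
  | add x x' h h' => simp only [Alg.add_mul, h, h']
  | basis r a =>
    induction y using basis_induction with
    | zero => simp only [Alg.zero_mul, Alg.mul_zero]
    | add x x' h h' => simp only [Alg.add_mul, Alg.mul_add, h, h']
    | basis s b =>
      induction z using basis_induction with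
      | zero => simp only [Alg.mul_zero]
      | add x x' h h' => simp only [Alg.mul_add, h, h']
      | basis t c =>
        simp only [Alg.smul_mul, Alg.mul_smul]
        congr 3
        rw [e_mul_e, e_mul_e]
        by_cases h1 : 𝒢.tgt a = 𝒢.src b
        · by_cases h2 : 𝒢.tgt b = 𝒢.src c
          · rw [if_pos h1, if_pos h2, e_mul_e, e_mul_e, if_pos ((𝒢.tgt_comp a b h1).trans h2),
              if_pos (h1.trans (𝒢.src_comp b c h2).symm), 𝒢.assoc a b c h1 h2]
          · rw [if_pos h1, if_neg h2, e_mul_e, Alg.mul_zero, if_neg]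
            rwa [𝒢.tgt_comp a b h1]
        · by_cases h2 : 𝒢.tgt b = 𝒢.src c
          · rw [if_neg h1, if_pos h2, e_mul_e, Alg.zero_mul, if_neg]
            rwa [𝒢.src_comp b c h2]
          · rw [if_neg h1, if_neg h2, Alg.zero_mul, Alg.mul_zero]

variable [Fintype P]

/-- The unit is the sum of the identity arrows. -/
noncomputable instance : One (𝒢.Alg k) := ⟨∑ p, e 𝒢 (𝒢.one p)⟩

theorem one_def : (1 : 𝒢.Alg k) = ∑ p, e 𝒢 (𝒢.one p) := rfl

protected theorem one_mul (x : 𝒢.Alg k) : 1 * x = x := by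
  induction x using basis_induction with
  | zero => simp only [Alg.mul_zero]
  | add x x' h h' => simp only [Alg.mul_add, h, h']
  | basis c a =>
    classical
    rw [Alg.mul_smul, one_def, mul_def, map_sum, LinearMap.sum_apply,
      Finset.sum_eq_single (𝒢.src a), ← mul_def, e_mul_e, if_pos (𝒢.tgt_one _), 𝒢.one_comp]
    · intro p _ hp
      rw [← mul_def, e_mul_e, if_neg]
      rwa [𝒢.tgt_one]
    · intro h
      exact absurd (Finset.mem_univ _) h

protected theorem mul_one (x : 𝒢.Alg k) : x * 1 = x := by
  induction x using basis_induction with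
  | zero => simp only [Alg.zero_mul]
  | add x x' h h' => simp only [Alg.add_mul, h, h']
  | basis c a =>
    classical
    rw [Alg.smul_mul, one_def, mul_def, map_sum,
      Finset.sum_eq_single (𝒢.tgt a), ← mul_def, e_mul_e, if_pos (𝒢.src_one _).symm, 𝒢.comp_one]
    · intro p _ hp
      rw [← mul_def, e_mul_e, if_neg]
      rw [𝒢.src_one]
      exact hp.symm
    · intro h
      exact absurd (Finset.mem_univ _) h

noncomputable instance : Ring (𝒢.Alg k) where
  __ := (inferInstance : AddCommGroup (𝒢.Alg k))
  zero_mul := Alg.zero_mul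
  mul_zero := Alg.mul_zero
  left_distrib := Alg.mul_add
  right_distrib := Alg.add_mul
  mul_assoc := Alg.mul_assoc
  one_mul := Alg.one_mul
  mul_one := Alg.mul_one

noncomputable instance : Algebra k (𝒢.Alg k) :=
  Algebra.ofModule Alg.smul_mul Alg.mul_smul

end Alg

end Algebra

end SetGroupoid

/-- A double groupoid: a groupoid object in the category of groupoids, given by its four related
groupoids with sets of boxes `B`, horizontal arrows `H`, vertical arrows `V` and points `P`.

* `hor : H ⇉ P` has source `l` and target `r`; `ver : V ⇉ P` has source `t` and target `b`;
* `hbox : B ⇉ V` (horizontal composition) has source `l`, target `r` and identities `id : V → B`;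
* `vbox : B ⇉ H` (vertical composition) has source `t`, target `b` and identities `id : H → B`.

The axioms say that the source, target, identity and composition maps of `hbox` are functors
between the vertical groupoids, and vice versa. -/
structure DoubleGroupoid (P H V B : Type*) where
  hor : SetGroupoid P H
  ver : SetGroupoid P V
  hbox : SetGroupoid V B
  vbox : SetGroupoid H B
  top_left : ∀ A, ver.src (hbox.src A) = hor.src (vbox.src A)
  top_right : ∀ A, ver.src (hbox.tgt A) = hor.tgt (vbox.src A)
  bot_left : ∀ A, ver.tgt (hbox.src A) = hor.src (vbox.tgt A)
  bot_right : ∀ A, ver.tgt (hbox.tgt A) = hor.tgt (vbox.tgt A)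
  top_hcomp : ∀ A B, hbox.tgt A = hbox.src B →
    vbox.src (hbox.comp A B) = hor.comp (vbox.src A) (vbox.src B)
  bot_hcomp : ∀ A B, hbox.tgt A = hbox.src B →
    vbox.tgt (hbox.comp A B) = hor.comp (vbox.tgt A) (vbox.tgt B)
  left_vcomp : ∀ A B, vbox.tgt A = vbox.src B →
    hbox.src (vbox.comp A B) = ver.comp (hbox.src A) (hbox.src B)
  right_vcomp : ∀ A B, vbox.tgt A = vbox.src B →
    hbox.tgt (vbox.comp A B) = ver.comp (hbox.tgt A) (hbox.tgt B)
  top_hone : ∀ g, vbox.src (hbox.one g) = hor.one (ver.src g)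
  bot_hone : ∀ g, vbox.tgt (hbox.one g) = hor.one (ver.tgt g)
  left_vone : ∀ x, hbox.src (vbox.one x) = ver.one (hor.src x)
  right_vone : ∀ x, hbox.tgt (vbox.one x) = ver.one (hor.tgt x)
  one_one : ∀ p, vbox.one (hor.one p) = hbox.one (ver.one p)
  vone_comp : ∀ x y, hor.tgt x = hor.src y →
    vbox.one (hor.comp x y) = hbox.comp (vbox.one x) (vbox.one y)
  hone_comp : ∀ g h, ver.tgt g = ver.src h →
    hbox.one (ver.comp g h) = vbox.comp (hbox.one g) (hbox.one h)
  interchange : ∀ A B C D, hbox.tgt A = hbox.src B → hbox.tgt C = hbox.src D →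
    vbox.tgt A = vbox.src C → vbox.tgt B = vbox.src D →
    vbox.comp (hbox.comp A B) (hbox.comp C D) = hbox.comp (vbox.comp A C) (vbox.comp B D)

namespace DoubleGroupoid

section Boxes

variable {P H V B : Type*} (T : DoubleGroupoid P H V B)

/-- The top side `t(A)` of a box. -/
abbrev top (A : B) : H := T.vbox.src A

/-- The bottom side `b(A)` of a box. -/
abbrev bot (A : B) : H := T.vbox.tgt A

/-- The left side `l(A)` of a box. -/
abbrev left (A : B) : V := T.hbox.src A

/-- The right side `r(A)` of a box. -/
abbrev right (A : B) : V := T.hbox.tgt A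

/-- The bottom left vertex `bl(A)` of a box. -/
abbrev botLeft (A : B) : P := T.ver.tgt (T.left A)

/-- The transpose double groupoid. -/
def transpose : DoubleGroupoid P V H B where
  hor := T.ver
  ver := T.hor
  hbox := T.vbox
  vbox := T.hbox
  top_left A := (T.top_left A).symm
  top_right A := (T.bot_left A).symm
  bot_left A := (T.top_right A).symm
  bot_right A := (T.bot_right A).symm
  top_hcomp := T.left_vcomp
  bot_hcomp := T.right_vcomp
  left_vcomp := T.top_hcomp
  right_vcomp := T.bot_hcomp
  top_hone := T.left_vone
  bot_hone := T.right_vone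
  left_vone := T.top_hone
  right_vone := T.bot_hone
  one_one p := (T.one_one p).symm
  vone_comp := T.hone_comp
  hone_comp := T.vone_comp
  interchange A B C D h1 h2 h3 h4 := (T.interchange A C B D h3 h4 h1 h2).symm

/-- The double groupoid obtained by reversing the vertical direction. -/
def flip : DoubleGroupoid P H V B where
  hor := T.hor
  ver := T.ver.op
  hbox := T.hbox
  vbox := T.vbox.op
  top_left := T.bot_left
  top_right := T.bot_right
  bot_left := T.top_left
  bot_right := T.top_right
  top_hcomp := T.bot_hcomp
  bot_hcomp := T.top_hcomp
  left_vcomp A B h := T.left_vcomp B A h.symm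
  right_vcomp A B h := T.right_vcomp B A h.symm
  top_hone := T.bot_hone
  bot_hone := T.top_hone
  left_vone := T.left_vone
  right_vone := T.right_vone
  one_one := T.one_one
  vone_comp := T.vone_comp
  hone_comp g h e := T.hone_comp h g e.symm
  interchange A B C D h1 h2 h3 h4 := T.interchange C D A B h2 h1 h3.symm h4.symm

/-- A box belongs to `H` if it is a vertical identity `id x`, `x ∈ H`. -/
def IsVId (A : B) : Prop := ∃ x, A = T.vbox.one x

/-- A box belongs to `V` if it is a horizontal identity `id g`, `g ∈ V`. -/
def IsHId (A : B) : Prop := ∃ g, A = T.hbox.one g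

variable {T}

theorem isVId_iff {A : B} : T.IsVId A ↔ A = T.vbox.one (T.vbox.src A) := by
  constructor
  · rintro ⟨x, rfl⟩
    rw [T.vbox.src_one]
  · intro h
    exact ⟨_, h⟩

theorem IsVId.left {A : B} (h : T.IsVId A) : T.hbox.src A = T.ver.one (T.ver.src (T.hbox.src A)) := by
  obtain ⟨x, rfl⟩ := h
  rw [T.left_vone, T.ver.src_one]

theorem IsVId.right {A : B} (h : T.IsVId A) :
    T.hbox.tgt A = T.ver.one (T.ver.src (T.hbox.tgt A)) := by
  obtain ⟨x, rfl⟩ := h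
  rw [T.right_vone, T.ver.src_one]

theorem IsVId.hcomp {A A' : B} (h : T.IsVId A) (h' : T.IsVId A') (e : T.hbox.tgt A = T.hbox.src A') :
    T.IsVId (T.hbox.comp A A') := by
  obtain ⟨x, rfl⟩ := h
  obtain ⟨y, rfl⟩ := h'
  refine ⟨T.hor.comp x y, (T.vone_comp x y ?_).symm⟩
  have := congrArg T.ver.src e
  rwa [T.right_vone, T.left_vone, T.ver.src_one,
    T.ver.src_one] at this

/-- Factorizations `Y = U / V` with `X U` and `V Z` vertical identities correspond to horizontal
products `X Y Z` that are vertical identities. -/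
theorem exists_unit_factorization (T : DoubleGroupoid P H V B) :
    ∃ F : B → B → B × B, ∀ X Y Z U W : B,
      (T.hbox.tgt X = T.hbox.src U ∧ T.IsVId (T.hbox.comp X U) ∧ T.hbox.tgt W = T.hbox.src Z ∧
        T.IsVId (T.hbox.comp W Z) ∧ T.vbox.tgt U = T.vbox.src W ∧ T.vbox.comp U W = Y) ↔
      (T.hbox.tgt X = T.hbox.src Y ∧ T.hbox.tgt Y = T.hbox.src Z ∧
        T.IsVId (T.hbox.comp X (T.hbox.comp Y Z))) ∧ (U, W) = F X Y := by
  refine ⟨fun X Y =>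
    let U := T.hbox.comp (T.hbox.inv X) (T.vbox.one (T.hor.comp (T.vbox.src X) (T.vbox.src Y)))
    (U, T.vbox.comp (T.vbox.inv U) Y), fun X Y Z U W => ⟨?_, ?_⟩⟩
  · rintro ⟨hXU, iXU, hWZ, iWZ, hUW, rfl⟩
    have lW : T.hbox.src W = T.ver.one (T.ver.src (T.hbox.src W)) := by
      have := iWZ.left
      rwa [T.hbox.src_comp _ _ hWZ] at this
    have rU : T.hbox.tgt U = T.ver.one (T.ver.src (T.hbox.tgt U)) := by
      have := iXU.right
      rwa [T.hbox.tgt_comp _ _ hXU] at this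
    have lUlW : T.ver.tgt (T.hbox.src U) = T.ver.src (T.hbox.src W) := by
      rw [T.bot_left, T.top_left, hUW]
    have rUrW : T.ver.tgt (T.hbox.tgt U) = T.ver.src (T.hbox.tgt W) := by
      rw [T.bot_right, T.top_right, hUW]
    have lY : T.hbox.src (T.vbox.comp U W) = T.hbox.src U := by
      rw [T.left_vcomp _ _ hUW]
      rw [lW]
      exact SetGroupoid.comp_one' lUlW
    have rY : T.hbox.tgt (T.vbox.comp U W) = T.hbox.tgt W := by
      rw [T.right_vcomp _ _ hUW]
      rw [rU]
      refine SetGroupoid.one_comp' ?_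
      rw [← rUrW, rU, T.ver.tgt_one, T.ver.src_one]
    have hXW : T.hbox.tgt (T.vbox.one (T.vbox.tgt X)) = T.hbox.src W := by
      rw [T.right_vone, lW, ← T.bot_right, ← lUlW, hXU]
    have key : T.hbox.comp X (T.vbox.comp U W) =
        T.hbox.comp (T.vbox.one (T.vbox.tgt X)) W := by
      have h1 := T.interchange X U (T.vbox.one (T.vbox.tgt X)) W hXU hXW (T.vbox.src_one _).symm hUW
      rw [T.vbox.comp_one] at h1
      rw [← h1]
      obtain ⟨x, hx⟩ := iXU
      rw [hx]
      apply SetGroupoid.one_comp'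
      rw [T.top_hcomp _ _ hXW, T.vbox.src_one, ← hUW, ← T.bot_hcomp _ _ hXU, hx, T.vbox.tgt_one]
    refine ⟨⟨hXU.trans lY.symm, rY.trans hWZ, ?_⟩, ?_⟩
    · rw [← T.hbox.assoc _ _ _ (hXU.trans lY.symm) (rY.trans hWZ), key,
        T.hbox.assoc _ _ _ hXW hWZ]
      exact IsVId.hcomp ⟨_, rfl⟩ iWZ (by
        rw [T.hbox.src_comp _ _ hWZ]; exact hXW)
    · have hU : T.hbox.comp (T.hbox.inv X)
          (T.vbox.one (T.hor.comp (T.vbox.src X) (T.vbox.src (T.vbox.comp U W)))) = U := by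
        rw [T.vbox.src_comp _ _ hUW, ← T.top_hcomp _ _ hXU, ← isVId_iff.1 iXU]
        exact SetGroupoid.inv_comp_cancel hXU
      simp only [hU]
      rw [SetGroupoid.inv_comp_cancel hUW]
  · rintro ⟨⟨hXY, hYZ, iXYZ⟩, hF⟩
    obtain ⟨rfl, rfl⟩ := Prod.mk.injEq _ _ _ _ |>.mp hF
    clear hF
    set I := T.vbox.one (T.hor.comp (T.vbox.src X) (T.vbox.src Y)) with hI
    set U := T.hbox.comp (T.hbox.inv X) I with hU
    have hXYZ : T.hbox.tgt X = T.hbox.src (T.hbox.comp Y Z) := by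
      rw [T.hbox.src_comp _ _ hYZ]; exact hXY
    have tXY : T.hor.tgt (T.vbox.src X) = T.hor.src (T.vbox.src Y) := by
      rw [← T.top_right, ← T.top_left]; exact congrArg _ hXY
    have lX : T.hbox.src X = T.ver.one (T.ver.src (T.hbox.src X)) := by
      have := iXYZ.left
      rwa [T.hbox.src_comp _ _ hXYZ] at this
    have lI : T.hbox.src X = T.hbox.src I := by
      rw [hI, T.left_vone, T.hor.src_comp _ _ tXY,
        ← T.top_left]
      exact lX
    have hXI : T.hbox.tgt (T.hbox.inv X) = T.hbox.src I := by
      rw [T.hbox.tgt_inv]; exact lI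
    have hXU : T.hbox.tgt X = T.hbox.src U := by
      rw [T.hbox.src_comp _ _ hXI, T.hbox.src_inv]
    have eXU : T.hbox.comp X U = I := SetGroupoid.comp_inv_cancel lI
    have iXU : T.IsVId (T.hbox.comp X U) := ⟨_, eXU⟩
    have tU : T.vbox.src U = T.vbox.src Y := by
      have h1 := T.top_hcomp X U hXU
      rw [eXU, hI, T.vbox.src_one] at h1
      refine (SetGroupoid.left_cancel (𝒢 := T.hor) tXY ?_ h1).symm
      rw [← T.top_right, ← T.top_left]; exact congrArg _ hXU
    have hUY : T.vbox.tgt (T.vbox.inv U) = T.vbox.src Y := by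
      rw [T.vbox.tgt_inv]; exact tU
    set W := T.vbox.comp (T.vbox.inv U) Y with hW
    have hUW : T.vbox.tgt U = T.vbox.src W := by
      rw [T.vbox.src_comp _ _ hUY, T.vbox.src_inv]
    have eUW : T.vbox.comp U W = Y := SetGroupoid.comp_inv_cancel tU
    have rU : T.hbox.tgt U = T.ver.one (T.ver.src (T.hbox.tgt U)) := by
      have := iXU.right
      rwa [T.hbox.tgt_comp _ _ hXU] at this
    have lUlW : T.ver.tgt (T.hbox.src U) = T.ver.src (T.hbox.src W) := by
      rw [T.bot_left, T.top_left, hUW]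
    have rUrW : T.ver.tgt (T.hbox.tgt U) = T.ver.src (T.hbox.tgt W) := by
      rw [T.bot_right, T.top_right, hUW]
    have rW : T.hbox.tgt W = T.hbox.tgt Y := by
      rw [← eUW, T.right_vcomp _ _ hUW]
      rw [rU]
      refine (SetGroupoid.one_comp' ?_).symm
      rw [← rUrW, rU, T.ver.tgt_one, T.ver.src_one]
    have hWZ : T.hbox.tgt W = T.hbox.src Z := rW.trans hYZ
    have lW : T.hbox.src W = T.ver.one (T.ver.src (T.hbox.src W)) := by
      refine SetGroupoid.left_cancel (𝒢 := T.ver) lUlW ?_ ?_ (a := T.hbox.src U)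
      · rw [T.ver.src_one]; exact lUlW
      · rw [SetGroupoid.comp_one' lUlW]
        have := T.left_vcomp U W hUW
        rw [eUW] at this
        rw [← this, ← hXU]
        exact hXY.symm
    have hXW : T.hbox.tgt (T.vbox.one (T.vbox.tgt X)) = T.hbox.src W := by
      rw [T.right_vone, lW, ← T.bot_right, ← lUlW, hXU]
    have key : T.hbox.comp X Y = T.hbox.comp (T.vbox.one (T.vbox.tgt X)) W := by
      have h1 := T.interchange X U (T.vbox.one (T.vbox.tgt X)) W hXU hXW (T.vbox.src_one _).symm hUW
      rw [T.vbox.comp_one, eUW] at h1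
      rw [← h1, eXU]
      apply SetGroupoid.one_comp'
      rw [T.top_hcomp _ _ hXW, T.vbox.src_one, ← hUW, ← T.bot_hcomp _ _ hXU, eXU, T.vbox.tgt_one]
    refine ⟨hXU, iXU, hWZ, ?_, hUW, eUW⟩
    rw [← T.hbox.assoc _ _ _ hXY hYZ, key, T.hbox.assoc _ _ _ hXW hWZ] at iXYZ
    have hXWZ : T.hbox.tgt (T.vbox.one (T.vbox.tgt X)) = T.hbox.src (T.hbox.comp W Z) := by
      rw [T.hbox.src_comp _ _ hWZ]; exact hXW
    have hinv : T.hbox.tgt (T.vbox.one (T.hor.inv (T.vbox.tgt X))) = T.hbox.src (T.vbox.one (T.vbox.tgt X)) := by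
      rw [T.right_vone, T.left_vone, T.hor.tgt_inv]
    have e1 : T.hbox.comp (T.vbox.one (T.hor.inv (T.vbox.tgt X)))
        (T.hbox.comp (T.vbox.one (T.vbox.tgt X)) (T.hbox.comp W Z)) = T.hbox.comp W Z := by
      rw [← T.hbox.assoc _ _ _ hinv hXWZ, ← T.vone_comp _ _ (T.hor.tgt_inv _), T.hor.inv_comp,
        T.one_one]
      apply SetGroupoid.one_comp'
      have := hXWZ
      rw [T.right_vone] at this
      exact this.symm
    rw [← e1]
    refine IsVId.hcomp ⟨_, rfl⟩ iXYZ ?_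
    rw [T.hbox.src_comp _ _ hXWZ]
    exact hinv

/-- Double factorizations of `X Y = A / A'` correspond to boxes `W` with `t(W) = t(Y)` and
`r(W) = r(A)`. -/
theorem exists_double_factorization (T : DoubleGroupoid P H V B) :
    ∃ F : B → B → B → B → B × B × B, ∀ X Y A A' U W R S : B,
      ((T.hbox.tgt U = T.hbox.src W ∧ T.hbox.comp U W = A) ∧
        (T.hbox.tgt R = T.hbox.src S ∧ T.hbox.comp R S = A') ∧
        (T.vbox.tgt U = T.vbox.src R ∧ T.vbox.comp U R = X) ∧ (T.vbox.tgt W = T.vbox.src S ∧ T.vbox.comp W S = Y)) ↔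
      ((T.vbox.tgt A = T.vbox.src A' ∧ T.hbox.tgt X = T.hbox.src Y ∧ T.hbox.comp X Y = T.vbox.comp A A') ∧
        T.vbox.src W = T.vbox.src Y ∧ T.hbox.tgt W = T.hbox.tgt A) ∧ (U, R, S) = F X Y A W := by
  refine ⟨fun X Y A W =>
    let U := T.hbox.comp A (T.hbox.inv W)
    (U, T.vbox.comp (T.vbox.inv U) X, T.vbox.comp (T.vbox.inv W) Y),
    fun X Y A A' U W R S => ⟨?_, ?_⟩⟩
  · rintro ⟨⟨h1, rfl⟩, ⟨h2, rfl⟩, ⟨h3, rfl⟩, ⟨h4, rfl⟩⟩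
    refine ⟨⟨⟨?_, ?_, ?_⟩, ?_, ?_⟩, ?_⟩
    · rw [T.bot_hcomp _ _ h1, T.top_hcomp _ _ h2, h3, h4]
    · rw [T.right_vcomp _ _ h3, T.left_vcomp _ _ h4,
        h1, h2]
    · exact (T.interchange _ _ _ _ h1 h2 h3 h4).symm
    · exact (T.vbox.src_comp _ _ h4).symm
    · exact (T.hbox.tgt_comp _ _ h1).symm
    · simp only [SetGroupoid.comp_comp_inv_cancel h1, SetGroupoid.inv_comp_cancel h3,
        SetGroupoid.inv_comp_cancel h4]
  · rintro ⟨⟨⟨hA, hXY, e⟩, tW, rW⟩, hF⟩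
    obtain ⟨rfl, hF'⟩ := Prod.mk.injEq _ _ _ _ |>.mp hF
    obtain ⟨rfl, rfl⟩ := Prod.mk.injEq _ _ _ _ |>.mp hF'
    clear hF hF'
    set U := T.hbox.comp A (T.hbox.inv W) with hU
    have hAW : T.hbox.tgt A = T.hbox.src (T.hbox.inv W) := by
      rw [T.hbox.src_inv]; exact rW.symm
    have h1 : T.hbox.tgt U = T.hbox.src W := by
      rw [T.hbox.tgt_comp _ _ hAW, T.hbox.tgt_inv]
    have e1 : T.hbox.comp U W = A := SetGroupoid.comp_inv_comp_cancel rW.symm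
    have tU : T.vbox.src U = T.vbox.src X := by
      have a1 := T.top_hcomp U W h1
      have a2 := T.top_hcomp X Y hXY
      rw [e1] at a1
      rw [e, T.vbox.src_comp _ _ hA, a1] at a2
      refine SetGroupoid.right_cancel (𝒢 := T.hor) (a := T.vbox.src W) ?_ ?_ ?_
      · rw [← T.top_right, ← T.top_left]; exact congrArg _ h1
      · rw [tW, ← T.top_right, ← T.top_left]; exact congrArg _ hXY
      · rw [a2, ← tW]
    have e3 : T.vbox.comp U (T.vbox.comp (T.vbox.inv U) X) = X := SetGroupoid.comp_inv_cancel tU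
    have e4 : T.vbox.comp W (T.vbox.comp (T.vbox.inv W) Y) = Y := SetGroupoid.comp_inv_cancel tW
    have h3' : T.vbox.tgt (T.vbox.inv U) = T.vbox.src X := by rw [T.vbox.tgt_inv]; exact tU
    have h4' : T.vbox.tgt (T.vbox.inv W) = T.vbox.src Y := by rw [T.vbox.tgt_inv]; exact tW
    have h3 : T.vbox.tgt U = T.vbox.src (T.vbox.comp (T.vbox.inv U) X) := by
      rw [T.vbox.src_comp _ _ h3', T.vbox.src_inv]
    have h4 : T.vbox.tgt W = T.vbox.src (T.vbox.comp (T.vbox.inv W) Y) := by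
      rw [T.vbox.src_comp _ _ h4', T.vbox.src_inv]
    set R := T.vbox.comp (T.vbox.inv U) X with hR
    set S := T.vbox.comp (T.vbox.inv W) Y with hS
    have h2 : T.hbox.tgt R = T.hbox.src S := by
      have a1 := T.right_vcomp U R h3
      have a2 := T.left_vcomp W S h4
      rw [e3] at a1
      rw [e4] at a2
      refine SetGroupoid.left_cancel (𝒢 := T.ver) (a := T.hbox.tgt U) ?_ ?_ ?_
      · rw [T.bot_right, T.top_right, h3]
      · rw [h1, T.bot_left, T.top_left, h4]
      · rw [← a1, h1, ← a2]; exact hXY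
    refine ⟨⟨h1, e1⟩, ⟨h2, ?_⟩, ⟨h3, e3⟩, ⟨h4, e4⟩⟩
    refine SetGroupoid.left_cancel (𝒢 := T.vbox) (a := A) ?_ hA ?_
    · rw [T.top_hcomp _ _ h2, ← h3, ← h4, ← T.bot_hcomp _ _ h1, e1]
    · rw [← e, ← e3, ← e4, ← T.interchange _ _ _ _ h1 h2 h3 h4, e1]

end Boxes

end DoubleGroupoid

namespace DoubleGroupoid

section Weight

variable {P H V B : Type*}

open scoped Classical in
/-- A function `ϑ : P → kˣ` such that `∑ ϑ(bl(A)) = 1`, where the sum is over all boxes `A` with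
`t(A) = x` and `r(A) = g`, for all `(g, x)` with `t(g) = r(x)`. -/
structure CornerWeight (T : DoubleGroupoid P H V B) [Fintype B] (k : Type*) [Field k] where
  weight : P → kˣ
  sum_eq_one : ∀ (g : V) (x : H), T.ver.src g = T.hor.tgt x →
    ∑ A : B, (if T.top A = x ∧ T.right A = g then (weight (T.botLeft A) : k) else 0) = 1

variable {T : DoubleGroupoid P H V B} [Fintype B] {k : Type*} [Field k]

/-- The function `A ↦ ϑ(bl(A))`. -/
def CornerWeight.onBox (ϑ : T.CornerWeight k) (A : B) : k := ϑ.weight (T.botLeft A)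

theorem CornerWeight.onBox_ne_zero (ϑ : T.CornerWeight k) (A : B) : ϑ.onBox A ≠ 0 :=
  (ϑ.weight _).ne_zero

/-- The vector space with basis `B`, with the groupoid algebra structure of the vertical
composition of boxes, and the comultiplication deformed by `ϑ` below. -/
def BoxAlg (T : DoubleGroupoid P H V B) (_ : T.CornerWeight k) : Type _ := T.vbox.Alg k

end Weight

namespace BoxAlg

variable {P H V B : Type*} {T : DoubleGroupoid P H V B} [Fintype H] [Fintype B]
  {k : Type*} [Field k] (ϑ : T.CornerWeight k)

noncomputable instance : Ring (T.BoxAlg ϑ) := inferInstanceAs (Ring (T.vbox.Alg k))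

noncomputable instance : Algebra k (T.BoxAlg ϑ) := inferInstanceAs (Algebra k (T.vbox.Alg k))

instance : Module.Finite k (T.BoxAlg ϑ) := inferInstanceAs (Module.Finite k (T.vbox.Alg k))

/-- The basis element given by a box. -/
noncomputable def e (A : B) : T.BoxAlg ϑ := SetGroupoid.Alg.e T.vbox A

/-- The linear map with prescribed values on the basis of boxes. -/
noncomputable def lin {M : Type*} [AddCommGroup M] [Module k M] (f : B → M) :
    T.BoxAlg ϑ →ₗ[k] M :=
  SetGroupoid.Alg.lin T.vbox f

variable {ϑ}

@[simp]
theorem lin_e {M : Type*} [AddCommGroup M] [Module k M] (f : B → M) (A : B) :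
    lin ϑ f (e ϑ A) = f A := SetGroupoid.Alg.lin_e f A

theorem hom_ext {M : Type*} [AddCommGroup M] [Module k M] {f g : T.BoxAlg ϑ →ₗ[k] M}
    (h : ∀ A, f (e ϑ A) = g (e ϑ A)) : f = g := SetGroupoid.Alg.hom_ext h

theorem basis_induction {p : T.BoxAlg ϑ → Prop} (x : T.BoxAlg ϑ) (zero : p 0)
    (add : ∀ x y, p x → p y → p (x + y)) (basis : ∀ (c : k) (A : B), p (c • e ϑ A)) : p x :=
  SetGroupoid.Alg.basis_induction x zero add basis

open scoped Classical in
theorem e_mul_e (A A' : B) : e ϑ A * e ϑ A' =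
    if T.vbox.tgt A = T.vbox.src A' then e ϑ (T.vbox.comp A A') else 0 :=
  SetGroupoid.Alg.e_mul_e A A'

theorem one_def : (1 : T.BoxAlg ϑ) = ∑ x, e ϑ (T.vbox.one x) := rfl

variable (ϑ)

open scoped Classical in
/-- The comultiplication `Δ(A) = ∑ ϑ(bl(Y)) X ⊗ Y`, the sum over all horizontal factorizations
`X Y = A`, and the counit `ε(A) = ϑ(bl(A))⁻¹` if `A` is a horizontal identity, `ε(A) = 0`
otherwise. -/
noncomputable instance : CoalgebraStruct k (T.BoxAlg ϑ) where
  comul := lin ϑ fun A => ∑ X : B, ∑ Y : B,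
    if T.right X = T.left Y ∧ T.hbox.comp X Y = A then ϑ.onBox Y • (e ϑ X ⊗ₜ[k] e ϑ Y) else 0
  counit := lin ϑ fun A => if T.IsHId A then (ϑ.onBox A)⁻¹ else 0

variable {ϑ}

open Coalgebra

open scoped Classical in
theorem comul_e (A : B) : comul (R := k) (e ϑ A) = ∑ X : B, ∑ Y : B,
    if T.right X = T.left Y ∧ T.hbox.comp X Y = A then ϑ.onBox Y • (e ϑ X ⊗ₜ[k] e ϑ Y) else 0 :=
  lin_e _ A

open scoped Classical in
theorem counit_e (A : B) : counit (R := k) (e ϑ A) =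
    if T.IsHId A then (ϑ.onBox A)⁻¹ else 0 :=
  lin_e _ A

theorem onBox_hcomp {X Y : B} (h : T.hbox.tgt X = T.hbox.src Y) :
    ϑ.onBox (T.hbox.comp X Y) = ϑ.onBox X := by
  simp only [CornerWeight.onBox, botLeft, left, T.hbox.src_comp _ _ h]

theorem onBox_vcomp {X Y : B} (h : T.vbox.tgt X = T.vbox.src Y) :
    ϑ.onBox (T.vbox.comp X Y) = ϑ.onBox Y := by
  simp only [CornerWeight.onBox, botLeft, left, T.bot_left, T.vbox.tgt_comp _ _ h]

theorem sum_ite_smul {M : Type*} [AddCommMonoid M] [DecidableEq B] (p : B → Prop)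
    [DecidablePred p] (q : Prop) [Decidable q] (A : B) (m : B → M) :
    ∑ W, (if q ∧ A = W then (if p W then m W else 0) else 0) =
      if q ∧ p A then m A else 0 := by
  by_cases hq : q
  · simp [hq]
  · simp [hq]

theorem sum_comm4 {B M : Type*} [Fintype B] [AddCommMonoid M] (f : B → B → B → B → M) :
    ∑ W, ∑ Z, ∑ X, ∑ Y, f W Z X Y = ∑ X, ∑ Y, ∑ Z, ∑ W, f W Z X Y := by
  calc ∑ W, ∑ Z, ∑ X, ∑ Y, f W Z X Y = ∑ W, ∑ X, ∑ Z, ∑ Y, f W Z X Y :=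
        Finset.sum_congr rfl fun W _ => Finset.sum_comm
    _ = ∑ X, ∑ W, ∑ Z, ∑ Y, f W Z X Y := Finset.sum_comm
    _ = ∑ X, ∑ W, ∑ Y, ∑ Z, f W Z X Y :=
        Finset.sum_congr rfl fun X _ => Finset.sum_congr rfl fun W _ => Finset.sum_comm
    _ = ∑ X, ∑ Y, ∑ W, ∑ Z, f W Z X Y := Finset.sum_congr rfl fun X _ => Finset.sum_comm
    _ = ∑ X, ∑ Y, ∑ Z, ∑ W, f W Z X Y :=
        Finset.sum_congr rfl fun X _ => Finset.sum_congr rfl fun W _ => Finset.sum_comm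

open scoped Classical in
theorem map_comul_e {M : Type*} [AddCommGroup M] [Module k M]
    (F : T.BoxAlg ϑ ⊗[k] T.BoxAlg ϑ →ₗ[k] M) (A : B) :
    F (comul (R := k) (e ϑ A)) = ∑ X : B, ∑ Y : B,
      if T.hbox.tgt X = T.hbox.src Y ∧ T.hbox.comp X Y = A then
        ϑ.onBox Y • F (e ϑ X ⊗ₜ[k] e ϑ Y) else 0 := by
  rw [comul_e]
  simp only [map_sum, apply_ite F, map_smul, map_zero]

open scoped Classical in
theorem coassoc_left (A : B) :
    TensorProduct.assoc k _ _ _ ((comul (R := k)).rTensor (T.BoxAlg ϑ) (comul (R := k) (e ϑ A))) =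
      ∑ X : B, ∑ Y : B, ∑ Z : B,
        if T.hbox.tgt X = T.hbox.src Y ∧ T.hbox.tgt Y = T.hbox.src Z ∧
            T.hbox.comp X (T.hbox.comp Y Z) = A then
          (ϑ.onBox Y * ϑ.onBox Z) • (e ϑ X ⊗ₜ[k] (e ϑ Y ⊗ₜ[k] e ϑ Z)) else 0 := by
  have h1 : ∀ X Y Z : B, (if T.hbox.tgt X = T.hbox.src Y ∧ T.hbox.tgt Y = T.hbox.src Z ∧
      T.hbox.comp X (T.hbox.comp Y Z) = A then
        (ϑ.onBox Y * ϑ.onBox Z) • (e ϑ X ⊗ₜ[k] (e ϑ Y ⊗ₜ[k] e ϑ Z)) else 0) =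
      ∑ W, if T.hbox.tgt X = T.hbox.src Y ∧ T.hbox.comp X Y = W then
        (if T.hbox.tgt W = T.hbox.src Z ∧ T.hbox.comp W Z = A then
        (ϑ.onBox Y * ϑ.onBox Z) • (e ϑ X ⊗ₜ[k] (e ϑ Y ⊗ₜ[k] e ϑ Z)) else 0) else 0 := by
    intro X Y Z
    refine Eq.trans ?_ (sum_ite_smul (fun W => T.hbox.tgt W = T.hbox.src Z ∧ T.hbox.comp W Z = A)
      (T.hbox.tgt X = T.hbox.src Y) (T.hbox.comp X Y) _).symm
    refine if_congr ?_ rfl rfl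
    refine and_congr_right fun h1 => ?_
    rw [T.hbox.tgt_comp _ _ h1]
    exact and_congr_right fun h2 => by rw [T.hbox.assoc _ _ _ h1 h2]
  have h2 := map_comul_e ((TensorProduct.assoc k _ _ _).toLinearMap ∘ₗ
    (comul (R := k)).rTensor (T.BoxAlg ϑ)) A
  refine h2.trans ?_
  have h3 : ∀ W Z : B, ((TensorProduct.assoc k _ _ _).toLinearMap ∘ₗ
      (comul (R := k)).rTensor (T.BoxAlg ϑ)) (e ϑ W ⊗ₜ[k] e ϑ Z) = ∑ X : B, ∑ Y : B,
      if T.hbox.tgt X = T.hbox.src Y ∧ T.hbox.comp X Y = W then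
        ϑ.onBox Y • (e ϑ X ⊗ₜ[k] (e ϑ Y ⊗ₜ[k] e ϑ Z)) else 0 := fun W Z =>
    map_comul_e ((TensorProduct.assoc k _ _ _).toLinearMap ∘ₗ
      (TensorProduct.mk k _ _).flip (e ϑ Z)) W
  simp only [h1, h3]
  -- both sides are sums over `W, Z, X, Y`
  have h4 : ∀ W Z : B, (if T.hbox.tgt W = T.hbox.src Z ∧ T.hbox.comp W Z = A then
      ϑ.onBox Z • ∑ X : B, ∑ Y : B,
      (if T.hbox.tgt X = T.hbox.src Y ∧ T.hbox.comp X Y = W then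
        ϑ.onBox Y • (e ϑ X ⊗ₜ[k] (e ϑ Y ⊗ₜ[k] e ϑ Z)) else 0) else 0) =
      ∑ X : B, ∑ Y : B, if T.hbox.tgt X = T.hbox.src Y ∧ T.hbox.comp X Y = W then
        (if T.hbox.tgt W = T.hbox.src Z ∧ T.hbox.comp W Z = A then
        (ϑ.onBox Y * ϑ.onBox Z) • (e ϑ X ⊗ₜ[k] (e ϑ Y ⊗ₜ[k] e ϑ Z)) else 0) else 0 := by
    intro W Z
    split_ifs
    · simp only [Finset.smul_sum, smul_ite, smul_zero, smul_smul, mul_comm]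
    · simp
  simp only [h4]
  exact sum_comm4 _

open scoped Classical in
theorem coassoc_right (A : B) :
    (comul (R := k)).lTensor (T.BoxAlg ϑ) (comul (R := k) (e ϑ A)) =
      ∑ X : B, ∑ Y : B, ∑ Z : B,
        if T.hbox.tgt X = T.hbox.src Y ∧ T.hbox.tgt Y = T.hbox.src Z ∧
            T.hbox.comp X (T.hbox.comp Y Z) = A then
          (ϑ.onBox Y * ϑ.onBox Z) • (e ϑ X ⊗ₜ[k] (e ϑ Y ⊗ₜ[k] e ϑ Z)) else 0 := by
  have h1 : ∀ X Y Z : B, (if T.hbox.tgt X = T.hbox.src Y ∧ T.hbox.tgt Y = T.hbox.src Z ∧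
      T.hbox.comp X (T.hbox.comp Y Z) = A then
        (ϑ.onBox Y * ϑ.onBox Z) • (e ϑ X ⊗ₜ[k] (e ϑ Y ⊗ₜ[k] e ϑ Z)) else 0) =
      ∑ W, if T.hbox.tgt Y = T.hbox.src Z ∧ T.hbox.comp Y Z = W then
        (if T.hbox.tgt X = T.hbox.src W ∧ T.hbox.comp X W = A then
        (ϑ.onBox W * ϑ.onBox Z) • (e ϑ X ⊗ₜ[k] (e ϑ Y ⊗ₜ[k] e ϑ Z)) else 0) else 0 := by
    intro X Y Z
    refine Eq.trans ?_ (sum_ite_smul (fun W => T.hbox.tgt X = T.hbox.src W ∧ T.hbox.comp X W = A)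
      (T.hbox.tgt Y = T.hbox.src Z) (T.hbox.comp Y Z) _).symm
    by_cases h : T.hbox.tgt Y = T.hbox.src Z
    · rw [onBox_hcomp h, T.hbox.src_comp _ _ h]
      simp only [h, true_and]
    · simp only [h, false_and, and_false, if_false]
  have h2 := map_comul_e ((comul (R := k)).lTensor (T.BoxAlg ϑ)) A
  refine h2.trans ?_
  have h3 : ∀ X W : B, (comul (R := k)).lTensor (T.BoxAlg ϑ) (e ϑ X ⊗ₜ[k] e ϑ W) =
      ∑ Y : B, ∑ Z : B, if T.hbox.tgt Y = T.hbox.src Z ∧ T.hbox.comp Y Z = W then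
        ϑ.onBox Z • (e ϑ X ⊗ₜ[k] (e ϑ Y ⊗ₜ[k] e ϑ Z)) else 0 := fun X W =>
    map_comul_e (TensorProduct.mk k _ _ (e ϑ X)) W
  simp only [h1, h3]
  have h4 : ∀ X W : B, (if T.hbox.tgt X = T.hbox.src W ∧ T.hbox.comp X W = A then
      ϑ.onBox W • ∑ Y : B, ∑ Z : B,
      (if T.hbox.tgt Y = T.hbox.src Z ∧ T.hbox.comp Y Z = W then
        ϑ.onBox Z • (e ϑ X ⊗ₜ[k] (e ϑ Y ⊗ₜ[k] e ϑ Z)) else 0) else 0) =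
      ∑ Y : B, ∑ Z : B, if T.hbox.tgt Y = T.hbox.src Z ∧ T.hbox.comp Y Z = W then
        (if T.hbox.tgt X = T.hbox.src W ∧ T.hbox.comp X W = A then
        (ϑ.onBox W * ϑ.onBox Z) • (e ϑ X ⊗ₜ[k] (e ϑ Y ⊗ₜ[k] e ϑ Z)) else 0) else 0 := by
    intro X W
    split_ifs
    · simp only [Finset.smul_sum, smul_ite, smul_zero, smul_smul]
    · simp
  simp only [h4]
  refine Finset.sum_congr rfl fun X _ => ?_
  rw [Finset.sum_comm]
  refine Finset.sum_congr rfl fun Y _ => ?_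
  rw [Finset.sum_comm]

theorem isHId_left {A : B} (h : T.IsHId A) : A = T.hbox.one (T.hbox.src A) := by
  obtain ⟨g, rfl⟩ := h
  rw [T.hbox.src_one]

open scoped Classical in
theorem counit_left (A : B) :
    (counit (R := k)).rTensor (T.BoxAlg ϑ) (comul (R := k) (e ϑ A)) = 1 ⊗ₜ[k] e ϑ A := by
  rw [map_comul_e]
  rw [Finset.sum_eq_single (T.hbox.one (T.hbox.src A)), Finset.sum_eq_single A]
  · rw [if_pos ⟨T.hbox.tgt_one _, T.hbox.one_comp A⟩, LinearMap.rTensor_tmul, counit_e,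
      if_pos ⟨_, rfl⟩, TensorProduct.smul_tmul', smul_eq_mul]
    have : ϑ.onBox (T.hbox.one (T.hbox.src A)) = ϑ.onBox A := by
      simp only [CornerWeight.onBox, botLeft, left, T.hbox.src_one]
    rw [this, mul_inv_cancel₀ (ϑ.onBox_ne_zero A)]
  · intro Y _ hY
    rw [if_neg]
    rintro ⟨h1, h2⟩
    rw [T.hbox.tgt_one] at h1
    rw [h1, T.hbox.one_comp] at h2
    exact hY h2
  · intro h
    exact absurd (Finset.mem_univ _) h
  · intro X _ hX
    refine Finset.sum_eq_zero fun Y _ => ?_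
    split_ifs with h
    · rw [LinearMap.rTensor_tmul, counit_e, if_neg, TensorProduct.zero_tmul, smul_zero]
      intro h'
      apply hX
      rw [← h.2, T.hbox.src_comp _ _ h.1]
      exact isHId_left h'
    · rfl
  · intro h
    exact absurd (Finset.mem_univ _) h

open scoped Classical in
theorem counit_right (A : B) :
    (counit (R := k)).lTensor (T.BoxAlg ϑ) (comul (R := k) (e ϑ A)) = e ϑ A ⊗ₜ[k] 1 := by
  rw [map_comul_e]
  rw [Finset.sum_eq_single A, Finset.sum_eq_single (T.hbox.one (T.hbox.tgt A))]
  · rw [if_pos ⟨(T.hbox.src_one _).symm, T.hbox.comp_one A⟩, LinearMap.lTensor_tmul, counit_e,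
      if_pos ⟨_, rfl⟩, ← TensorProduct.tmul_smul, smul_eq_mul,
      mul_inv_cancel₀ (ϑ.onBox_ne_zero _)]
  · intro Y _ hY
    split_ifs with h
    · rw [LinearMap.lTensor_tmul, counit_e, if_neg, TensorProduct.tmul_zero, smul_zero]
      intro h'
      apply hY
      rw [h.1]
      exact isHId_left h'
    · rfl
  · intro h
    exact absurd (Finset.mem_univ _) h
  · intro X _ hX
    refine Finset.sum_eq_zero fun Y _ => ?_
    split_ifs with h
    · rw [LinearMap.lTensor_tmul, counit_e, if_neg, TensorProduct.tmul_zero, smul_zero]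
      intro h'
      apply hX
      rw [← h.2, isHId_left h', ← h.1, T.hbox.comp_one]
    · rfl
  · intro h
    exact absurd (Finset.mem_univ _) h

noncomputable instance : Coalgebra k (T.BoxAlg ϑ) where
  coassoc := hom_ext fun A => (coassoc_left A).trans (coassoc_right A).symm
  rTensor_counit_comp_comul := hom_ext counit_left
  lTensor_counit_comp_comul := hom_ext counit_right

end BoxAlg

end DoubleGroupoid

namespace DoubleGroupoid

namespace BoxAlg

section Sums

variable {B M : Type*} [Fintype B] [AddCommMonoid M]

theorem sum_rotate5 {ι : Type*} [Fintype ι] (f : B → B → B → B → ι → M) :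
    ∑ a, ∑ b, ∑ c, ∑ d, ∑ y, f a b c d y = ∑ y, ∑ a, ∑ b, ∑ c, ∑ d, f a b c d y := by
  calc ∑ a, ∑ b, ∑ c, ∑ d, ∑ y, f a b c d y = ∑ a, ∑ b, ∑ c, ∑ y, ∑ d, f a b c d y :=
        Finset.sum_congr rfl fun a _ => Finset.sum_congr rfl fun b _ =>
          Finset.sum_congr rfl fun c _ => Finset.sum_comm
    _ = ∑ a, ∑ b, ∑ y, ∑ c, ∑ d, f a b c d y :=
        Finset.sum_congr rfl fun a _ => Finset.sum_congr rfl fun b _ => Finset.sum_comm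
    _ = ∑ a, ∑ y, ∑ b, ∑ c, ∑ d, f a b c d y :=
        Finset.sum_congr rfl fun a _ => Finset.sum_comm
    _ = ∑ y, ∑ a, ∑ b, ∑ c, ∑ d, f a b c d y := Finset.sum_comm

theorem sum_comm6 (f : B → B → B → B → B → B → M) :
    ∑ U, ∑ W, ∑ R, ∑ S, ∑ X, ∑ Y, f U W R S X Y =
      ∑ X, ∑ Y, ∑ W, ∑ p : B × B × B, f p.1 W p.2.1 p.2.2 X Y := by
  rw [sum_rotate5 (fun U W R S X => ∑ Y, f U W R S X Y)]
  refine Finset.sum_congr rfl fun X _ => ?_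
  rw [sum_rotate5 (fun U W R S Y => f U W R S X Y)]
  refine Finset.sum_congr rfl fun Y _ => ?_
  rw [Finset.sum_comm]
  simp only [Fintype.sum_prod_type]

theorem sum_comm5 (f : B → B → B → B → B → M) :
    ∑ X, ∑ U, ∑ W, ∑ Z, ∑ Y, f X U W Z Y =
      ∑ X, ∑ Y, ∑ Z, ∑ p : B × B, f X p.1 p.2 Z Y := by
  refine Finset.sum_congr rfl fun X _ => ?_
  calc ∑ U, ∑ W, ∑ Z, ∑ Y, f X U W Z Y = ∑ U, ∑ W, ∑ Y, ∑ Z, f X U W Z Y :=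
        Finset.sum_congr rfl fun U _ => Finset.sum_congr rfl fun W _ => Finset.sum_comm
    _ = ∑ U, ∑ Y, ∑ W, ∑ Z, f X U W Z Y :=
        Finset.sum_congr rfl fun U _ => Finset.sum_comm
    _ = ∑ Y, ∑ U, ∑ W, ∑ Z, f X U W Z Y := Finset.sum_comm
    _ = ∑ Y, ∑ Z, ∑ p : B × B, f X p.1 p.2 Z Y := by
        refine Finset.sum_congr rfl fun Y _ => ?_
        simp only [Fintype.sum_prod_type]
        calc ∑ U, ∑ W, ∑ Z, f X U W Z Y = ∑ U, ∑ Z, ∑ W, f X U W Z Y :=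
              Finset.sum_congr rfl fun U _ => Finset.sum_comm
          _ = ∑ Z, ∑ U, ∑ W, f X U W Z Y := Finset.sum_comm

theorem sum_ite_and_eq {ι : Type*} [Fintype ι] [DecidableEq ι] (c : Prop) [Decidable c] (a : ι)
    [∀ p : ι, Decidable (c ∧ p = a)] (m : M) :
    ∑ p, (if c ∧ p = a then m else 0) = if c then m else 0 := by
  by_cases hc : c
  · simp [hc]
  · simp [hc]

end Sums

variable {P H V B : Type*} {T : DoubleGroupoid P H V B} [Fintype H] [Fintype B]
  {k : Type*} [Field k] {ϑ : T.CornerWeight k}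

open Coalgebra

open scoped Classical in
theorem e_mul_e_sum (A A' : B) : e ϑ A * e ϑ A' =
    ∑ X, if T.vbox.tgt A = T.vbox.src A' ∧ T.vbox.comp A A' = X then e ϑ X else 0 := by
  rw [e_mul_e]
  by_cases h : T.vbox.tgt A = T.vbox.src A'
  · simp [h]
  · simp [h]

open scoped Classical in
theorem comul_mul_e (A A' : B) : comul (R := k) (e ϑ A * e ϑ A') =
    comul (R := k) (e ϑ A) * comul (R := k) (e ϑ A') := by
  have h1 := map_comul_e (LinearMap.mulRight k (comul (R := k) (e ϑ A'))) A
  have h2 : ∀ U W, (LinearMap.mulRight k (comul (R := k) (e ϑ A'))) (e ϑ U ⊗ₜ[k] e ϑ W) = _ :=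
    fun U W => map_comul_e (LinearMap.mulLeft k (e ϑ U ⊗ₜ[k] e ϑ W)) A'
  simp only [LinearMap.mulLeft_apply, Algebra.TensorProduct.tmul_mul_tmul] at h2
  obtain ⟨F, hF⟩ := T.exists_double_factorization
  have h3 : ∀ U W R S : B, (e ϑ U * e ϑ R) ⊗ₜ[k] (e ϑ W * e ϑ S) = ∑ X, ∑ Y,
      if (T.vbox.tgt U = T.vbox.src R ∧ T.vbox.comp U R = X) ∧
        (T.vbox.tgt W = T.vbox.src S ∧ T.vbox.comp W S = Y) then e ϑ X ⊗ₜ[k] e ϑ Y else 0 := by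
    intro U W R S
    rw [e_mul_e_sum U, e_mul_e_sum W]
    simp only [TensorProduct.sum_tmul, TensorProduct.tmul_sum]
    rw [Finset.sum_comm]
    refine Finset.sum_congr rfl fun X _ => Finset.sum_congr rfl fun Y _ => ?_
    by_cases c1 : T.vbox.tgt U = T.vbox.src R ∧ T.vbox.comp U R = X <;>
      by_cases c2 : T.vbox.tgt W = T.vbox.src S ∧ T.vbox.comp W S = Y <;> simp [c1, c2]
  symm
  refine h1.trans ?_
  simp only [h2, h3]
  have h4 : ∀ U W : B, (if T.hbox.tgt U = T.hbox.src W ∧ T.hbox.comp U W = A then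
      ϑ.onBox W • ∑ R, ∑ S, (if T.hbox.tgt R = T.hbox.src S ∧ T.hbox.comp R S = A' then
        ϑ.onBox S • ∑ X, ∑ Y, (if (T.vbox.tgt U = T.vbox.src R ∧ T.vbox.comp U R = X) ∧
        (T.vbox.tgt W = T.vbox.src S ∧ T.vbox.comp W S = Y) then e ϑ X ⊗ₜ[k] e ϑ Y else 0)
        else 0) else 0) =
      ∑ R, ∑ S, ∑ X, ∑ Y, if ((T.vbox.tgt A = T.vbox.src A' ∧ T.hbox.tgt X = T.hbox.src Y ∧
          T.hbox.comp X Y = T.vbox.comp A A') ∧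
        T.vbox.src W = T.vbox.src Y ∧ T.hbox.tgt W = T.hbox.tgt A) ∧ (U, R, S) = F X Y A W then
          (ϑ.onBox W * ϑ.onBox Y) • (e ϑ X ⊗ₜ[k] e ϑ Y) else 0 := by
    intro U W
    simp only [← hF]
    by_cases c1 : T.hbox.tgt U = T.hbox.src W ∧ T.hbox.comp U W = A
    · rw [if_pos c1, Finset.smul_sum]
      refine Finset.sum_congr rfl fun R _ => ?_
      rw [Finset.smul_sum]
      refine Finset.sum_congr rfl fun S _ => ?_
      by_cases c2 : T.hbox.tgt R = T.hbox.src S ∧ T.hbox.comp R S = A'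
      · rw [if_pos c2, Finset.smul_sum, Finset.smul_sum]
        refine Finset.sum_congr rfl fun X _ => ?_
        rw [Finset.smul_sum, Finset.smul_sum]
        refine Finset.sum_congr rfl fun Y _ => ?_
        by_cases c3 : (T.vbox.tgt U = T.vbox.src R ∧ T.vbox.comp U R = X) ∧
            (T.vbox.tgt W = T.vbox.src S ∧ T.vbox.comp W S = Y)
        · rw [if_pos c3, if_pos ⟨c1, c2, c3⟩, smul_smul, ← c3.2.2, onBox_vcomp c3.2.1]
        · rw [if_neg c3, if_neg fun h => c3 h.2.2, smul_zero, smul_zero]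
      · rw [if_neg c2, smul_zero]
        exact (Finset.sum_eq_zero fun X _ => Finset.sum_eq_zero fun Y _ =>
          if_neg fun h => c2 h.2.1).symm
    · rw [if_neg c1]
      exact (Finset.sum_eq_zero fun R _ => Finset.sum_eq_zero fun S _ =>
        Finset.sum_eq_zero fun X _ => Finset.sum_eq_zero fun Y _ => if_neg fun h => c1 h.1).symm
  simp only [h4]
  rw [sum_comm6 (fun U W R S X Y => if ((T.vbox.tgt A = T.vbox.src A' ∧
          T.hbox.tgt X = T.hbox.src Y ∧ T.hbox.comp X Y = T.vbox.comp A A') ∧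
        T.vbox.src W = T.vbox.src Y ∧ T.hbox.tgt W = T.hbox.tgt A) ∧ (U, R, S) = F X Y A W then
          (ϑ.onBox W * ϑ.onBox Y) • (e ϑ X ⊗ₜ[k] e ϑ Y) else 0)]
  simp only [Prod.mk.eta, sum_ite_and_eq]
  rw [e_mul_e]
  by_cases hA : T.vbox.tgt A = T.vbox.src A'
  · rw [if_pos hA, comul_e]
    refine Finset.sum_congr rfl fun X _ => Finset.sum_congr rfl fun Y _ => ?_
    by_cases hXY : T.hbox.tgt X = T.hbox.src Y ∧ T.hbox.comp X Y = T.vbox.comp A A'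
    · simp only [hA, hXY, true_and]
      have h5 := ϑ.sum_eq_one (T.hbox.tgt A) (T.vbox.src Y) (by
        have := congrArg (fun D => T.ver.src (T.hbox.tgt D)) hXY.2
        simp only [T.hbox.tgt_comp _ _ hXY.1, T.right_vcomp _ _ hA] at this
        rw [T.ver.src_comp] at this
        · rw [← this, T.top_right]
        · rw [T.bot_right, T.top_right, hA])
      refine Eq.trans ?_ (one_smul k (ϑ.onBox Y • (e ϑ X ⊗ₜ[k] e ϑ Y)))
      rw [← h5, Finset.sum_smul]
      refine Finset.sum_congr rfl fun W _ => ?_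
      rw [ite_smul, zero_smul, smul_smul]
      rfl
    · rw [if_neg hXY]
      simp [hXY]
  · simp [hA]

theorem sum_isVId {M : Type*} [AddCommMonoid M] (c : Prop) (A : B) (m : M)
    [∀ x, Decidable (c ∧ A = T.vbox.one x)] [Decidable (c ∧ T.IsVId A)] :
    ∑ x, (if c ∧ A = T.vbox.one x then m else 0) = if c ∧ T.IsVId A then m else 0 := by
  by_cases h : c ∧ T.IsVId A
  · rw [if_pos h]
    obtain ⟨hc, x, rfl⟩ := h
    rw [Finset.sum_eq_single x]
    · exact if_pos ⟨hc, rfl⟩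
    · intro y _ hy
      refine if_neg fun h' => hy ?_
      have := congrArg T.vbox.src h'.2
      rw [T.vbox.src_one, T.vbox.src_one] at this
      exact this.symm
    · exact fun h => absurd (Finset.mem_univ _) h
  · rw [if_neg h]
    exact Finset.sum_eq_zero fun x _ => if_neg fun h' => h ⟨h'.1, x, h'.2⟩

open scoped Classical in
theorem map_comul_one {M : Type*} [AddCommGroup M] [Module k M]
    (F : T.BoxAlg ϑ ⊗[k] T.BoxAlg ϑ →ₗ[k] M) :
    F (comul (R := k) (1 : T.BoxAlg ϑ)) = ∑ X : B, ∑ Y : B,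
      if T.hbox.tgt X = T.hbox.src Y ∧ T.IsVId (T.hbox.comp X Y) then
        ϑ.onBox Y • F (e ϑ X ⊗ₜ[k] e ϑ Y) else 0 := by
  rw [one_def, map_sum, map_sum]
  simp only [map_comul_e]
  rw [Finset.sum_comm]
  refine Finset.sum_congr rfl fun X _ => ?_
  rw [Finset.sum_comm]
  refine Finset.sum_congr rfl fun Y _ => ?_
  exact sum_isVId _ _ _

open scoped Classical in
/-- The common value of the three expressions for `Δ²(1)`. -/
theorem coassoc_one : (comul (R := k)).lTensor (T.BoxAlg ϑ) (comul (R := k) (1 : T.BoxAlg ϑ)) =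
    ∑ X : B, ∑ Y : B, ∑ Z : B,
      if T.hbox.tgt X = T.hbox.src Y ∧ T.hbox.tgt Y = T.hbox.src Z ∧
          T.IsVId (T.hbox.comp X (T.hbox.comp Y Z)) then
        (ϑ.onBox Y * ϑ.onBox Z) • (e ϑ X ⊗ₜ[k] (e ϑ Y ⊗ₜ[k] e ϑ Z)) else 0 := by
  rw [one_def, map_sum, map_sum]
  simp only [coassoc_right]
  rw [Finset.sum_comm]
  refine Finset.sum_congr rfl fun X _ => ?_
  rw [Finset.sum_comm]
  refine Finset.sum_congr rfl fun Y _ => ?_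
  rw [Finset.sum_comm]
  refine Finset.sum_congr rfl fun Z _ => ?_
  refine Eq.trans ?_ ((sum_isVId (T := T) (T.hbox.tgt X = T.hbox.src Y ∧
    T.hbox.tgt Y = T.hbox.src Z) (T.hbox.comp X (T.hbox.comp Y Z))
    ((ϑ.onBox Y * ϑ.onBox Z) • (e ϑ X ⊗ₜ[k] (e ϑ Y ⊗ₜ[k] e ϑ Z)))).trans ?_)
  · exact Finset.sum_congr rfl fun x _ => if_congr and_assoc.symm rfl rfl
  · exact if_congr and_assoc rfl rfl

open scoped Classical in
theorem sum_unit_aux {M : Type*} [AddCommGroup M] [Module k M] (m : B → B → B → M)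
    (Q : B → B → B → Prop) [∀ U W Y, Decidable (Q U W Y)] (F : B → B → B × B)
    (hF : ∀ X Y Z U W : B,
      (T.hbox.tgt X = T.hbox.src U ∧ T.IsVId (T.hbox.comp X U) ∧ T.hbox.tgt W = T.hbox.src Z ∧
        T.IsVId (T.hbox.comp W Z) ∧ Q U W Y) ↔
      (T.hbox.tgt X = T.hbox.src Y ∧ T.hbox.tgt Y = T.hbox.src Z ∧
        T.IsVId (T.hbox.comp X (T.hbox.comp Y Z))) ∧ (U, W) = F X Y) :
    (∑ X, ∑ U, if T.hbox.tgt X = T.hbox.src U ∧ T.IsVId (T.hbox.comp X U) then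
      ϑ.onBox U • ∑ W, ∑ Z, (if T.hbox.tgt W = T.hbox.src Z ∧ T.IsVId (T.hbox.comp W Z) then
        ϑ.onBox Z • ∑ Y, (if Q U W Y then m X Y Z else 0) else 0) else 0) =
    ∑ X : B, ∑ Y : B, ∑ Z : B,
      if T.hbox.tgt X = T.hbox.src Y ∧ T.hbox.tgt Y = T.hbox.src Z ∧
          T.IsVId (T.hbox.comp X (T.hbox.comp Y Z)) then
        (ϑ.onBox Y * ϑ.onBox Z) • m X Y Z else 0 := by
  have h4 : ∀ X U : B, (if T.hbox.tgt X = T.hbox.src U ∧ T.IsVId (T.hbox.comp X U) then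
      ϑ.onBox U • ∑ W, ∑ Z, (if T.hbox.tgt W = T.hbox.src Z ∧ T.IsVId (T.hbox.comp W Z) then
        ϑ.onBox Z • ∑ Y, (if Q U W Y then m X Y Z else 0) else 0) else 0) =
      ∑ W, ∑ Z, ∑ Y, if (T.hbox.tgt X = T.hbox.src Y ∧ T.hbox.tgt Y = T.hbox.src Z ∧
        T.IsVId (T.hbox.comp X (T.hbox.comp Y Z))) ∧ (U, W) = F X Y then
          (ϑ.onBox Y * ϑ.onBox Z) • m X Y Z else 0 := by
    intro X U
    by_cases c1 : T.hbox.tgt X = T.hbox.src U ∧ T.IsVId (T.hbox.comp X U)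
    · rw [if_pos c1, Finset.smul_sum]
      refine Finset.sum_congr rfl fun W _ => ?_
      rw [Finset.smul_sum]
      refine Finset.sum_congr rfl fun Z _ => ?_
      by_cases c2 : T.hbox.tgt W = T.hbox.src Z ∧ T.IsVId (T.hbox.comp W Z)
      · rw [if_pos c2, Finset.smul_sum, Finset.smul_sum]
        refine Finset.sum_congr rfl fun Y _ => ?_
        by_cases c3 : Q U W Y
        · have c4 := (hF X Y Z U W).1 ⟨c1.1, c1.2, c2.1, c2.2, c3⟩
          have c5 : ϑ.onBox U = ϑ.onBox Y := by
            simp only [CornerWeight.onBox, botLeft, left, ← c1.1, ← c4.1.1]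
          rw [if_pos c3, if_pos c4, smul_smul, c5]
        · rw [if_neg c3, if_neg fun h => c3 ((hF X Y Z U W).2 h).2.2.2.2, smul_zero, smul_zero]
      · rw [if_neg c2, smul_zero]
        refine (Finset.sum_eq_zero fun Y _ => if_neg fun h => c2 ?_).symm
        have := (hF X Y Z U W).2 h
        exact ⟨this.2.2.1, this.2.2.2.1⟩
    · rw [if_neg c1]
      refine (Finset.sum_eq_zero fun W _ => Finset.sum_eq_zero fun Z _ =>
        Finset.sum_eq_zero fun Y _ => if_neg fun h => c1 ?_).symm
      have := (hF X Y Z U W).2 h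
      exact ⟨this.1, this.2.1⟩
  simp only [h4]
  rw [sum_comm5 (fun X U W Z Y => if (T.hbox.tgt X = T.hbox.src Y ∧
        T.hbox.tgt Y = T.hbox.src Z ∧
        T.IsVId (T.hbox.comp X (T.hbox.comp Y Z))) ∧ (U, W) = F X Y then
          (ϑ.onBox Y * ϑ.onBox Z) • m X Y Z else 0)]
  simp only [Prod.mk.eta, sum_ite_and_eq]

open scoped Classical in
theorem unit_left : (comul (R := k)).lTensor (T.BoxAlg ϑ) (comul (R := k) (1 : T.BoxAlg ϑ)) =
    TensorProduct.assoc k _ _ _ (comul (R := k) (1 : T.BoxAlg ϑ) ⊗ₜ[k] (1 : T.BoxAlg ϑ)) *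
      ((1 : T.BoxAlg ϑ) ⊗ₜ[k] comul (R := k) (1 : T.BoxAlg ϑ)) := by
  obtain ⟨F, hF⟩ := T.exists_unit_factorization
  rw [coassoc_one, ← sum_unit_aux (T := T) (ϑ := ϑ) (fun X Y Z => e ϑ X ⊗ₜ[k] (e ϑ Y ⊗ₜ[k] e ϑ Z))
    (fun U W Y => T.vbox.tgt U = T.vbox.src W ∧ T.vbox.comp U W = Y) F hF]
  symm
  refine (map_comul_one (LinearMap.mulRight k ((1 : T.BoxAlg ϑ) ⊗ₜ[k] comul (R := k) (1 : T.BoxAlg ϑ)) ∘ₗ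
    (TensorProduct.assoc k (T.BoxAlg ϑ) (T.BoxAlg ϑ) (T.BoxAlg ϑ)).toLinearMap ∘ₗ
      (TensorProduct.mk k (T.BoxAlg ϑ ⊗[k] T.BoxAlg ϑ) (T.BoxAlg ϑ)).flip 1)).trans ?_
  have h2 : ∀ X U : B, (LinearMap.mulRight k ((1 : T.BoxAlg ϑ) ⊗ₜ[k] comul (R := k) (1 : T.BoxAlg ϑ)) ∘ₗ
      (TensorProduct.assoc k (T.BoxAlg ϑ) (T.BoxAlg ϑ) (T.BoxAlg ϑ)).toLinearMap ∘ₗ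
      (TensorProduct.mk k (T.BoxAlg ϑ ⊗[k] T.BoxAlg ϑ) (T.BoxAlg ϑ)).flip 1)
        (e ϑ X ⊗ₜ[k] e ϑ U) = ∑ W, ∑ Z,
          (if T.hbox.tgt W = T.hbox.src Z ∧ T.IsVId (T.hbox.comp W Z) then ϑ.onBox Z •
            ∑ Y, (if T.vbox.tgt U = T.vbox.src W ∧ T.vbox.comp U W = Y then
              e ϑ X ⊗ₜ[k] (e ϑ Y ⊗ₜ[k] e ϑ Z) else 0) else 0) := by
    intro X U
    have := map_comul_one (LinearMap.mulLeft k (e ϑ X ⊗ₜ[k] (e ϑ U ⊗ₜ[k] (1 : T.BoxAlg ϑ))) ∘ₗ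
      TensorProduct.mk k (T.BoxAlg ϑ) (T.BoxAlg ϑ ⊗[k] T.BoxAlg ϑ) 1)
    refine this.trans ?_
    refine Finset.sum_congr rfl fun W _ => Finset.sum_congr rfl fun Z _ => if_congr Iff.rfl ?_ rfl
    congr 1
    simp only [LinearMap.comp_apply, TensorProduct.mk_apply, LinearMap.mulLeft_apply,
      Algebra.TensorProduct.tmul_mul_tmul, mul_one, one_mul]
    rw [e_mul_e_sum]
    simp only [TensorProduct.sum_tmul, TensorProduct.tmul_sum]
    refine Finset.sum_congr rfl fun Y _ => ?_
    split_ifs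
    · rfl
    · rw [TensorProduct.zero_tmul, TensorProduct.tmul_zero]
  simp only [h2]

open scoped Classical in
theorem unit_right : (comul (R := k)).lTensor (T.BoxAlg ϑ) (comul (R := k) (1 : T.BoxAlg ϑ)) =
    ((1 : T.BoxAlg ϑ) ⊗ₜ[k] comul (R := k) (1 : T.BoxAlg ϑ)) *
    TensorProduct.assoc k _ _ _ (comul (R := k) (1 : T.BoxAlg ϑ) ⊗ₜ[k] (1 : T.BoxAlg ϑ)) := by
  obtain ⟨F, hF⟩ := T.flip.exists_unit_factorization
  rw [coassoc_one, ← sum_unit_aux (T := T) (ϑ := ϑ) (fun X Y Z => e ϑ X ⊗ₜ[k] (e ϑ Y ⊗ₜ[k] e ϑ Z))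
    (fun U W Y => T.vbox.src U = T.vbox.tgt W ∧ T.vbox.comp W U = Y) F hF]
  symm
  refine (map_comul_one (LinearMap.mulLeft k ((1 : T.BoxAlg ϑ) ⊗ₜ[k] comul (R := k) (1 : T.BoxAlg ϑ)) ∘ₗ
    (TensorProduct.assoc k (T.BoxAlg ϑ) (T.BoxAlg ϑ) (T.BoxAlg ϑ)).toLinearMap ∘ₗ
      (TensorProduct.mk k (T.BoxAlg ϑ ⊗[k] T.BoxAlg ϑ) (T.BoxAlg ϑ)).flip 1)).trans ?_
  have h2 : ∀ X U : B, (LinearMap.mulLeft k ((1 : T.BoxAlg ϑ) ⊗ₜ[k] comul (R := k) (1 : T.BoxAlg ϑ)) ∘ₗ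
      (TensorProduct.assoc k (T.BoxAlg ϑ) (T.BoxAlg ϑ) (T.BoxAlg ϑ)).toLinearMap ∘ₗ
      (TensorProduct.mk k (T.BoxAlg ϑ ⊗[k] T.BoxAlg ϑ) (T.BoxAlg ϑ)).flip 1)
        (e ϑ X ⊗ₜ[k] e ϑ U) = ∑ W, ∑ Z,
          (if T.hbox.tgt W = T.hbox.src Z ∧ T.IsVId (T.hbox.comp W Z) then ϑ.onBox Z •
            ∑ Y, (if T.vbox.src U = T.vbox.tgt W ∧ T.vbox.comp W U = Y then
              e ϑ X ⊗ₜ[k] (e ϑ Y ⊗ₜ[k] e ϑ Z) else 0) else 0) := by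
    intro X U
    have := map_comul_one (LinearMap.mulRight k (e ϑ X ⊗ₜ[k] (e ϑ U ⊗ₜ[k] (1 : T.BoxAlg ϑ))) ∘ₗ
      TensorProduct.mk k (T.BoxAlg ϑ) (T.BoxAlg ϑ ⊗[k] T.BoxAlg ϑ) 1)
    refine this.trans ?_
    refine Finset.sum_congr rfl fun W _ => Finset.sum_congr rfl fun Z _ => if_congr Iff.rfl ?_ rfl
    congr 1
    simp only [LinearMap.comp_apply, TensorProduct.mk_apply, LinearMap.mulRight_apply,
      Algebra.TensorProduct.tmul_mul_tmul, mul_one, one_mul]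
    rw [e_mul_e_sum]
    simp only [TensorProduct.sum_tmul, TensorProduct.tmul_sum]
    refine Finset.sum_congr rfl fun Y _ => ?_
    simp only [eq_comm (a := T.vbox.src U)]
    split_ifs
    · rfl
    · rw [TensorProduct.zero_tmul, TensorProduct.tmul_zero]
  simp only [h2]

open scoped Classical in
theorem counit_mul_e (A A' : B) : counit (R := k) (e ϑ A * e ϑ A') =
    if T.vbox.tgt A = T.vbox.src A' ∧ T.IsHId (T.vbox.comp A A') then (ϑ.onBox A')⁻¹ else 0 := by
  rw [e_mul_e]
  by_cases h : T.vbox.tgt A = T.vbox.src A'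
  · rw [if_pos h, counit_e, onBox_vcomp h]
    simp only [h, true_and]
  · rw [if_neg h, map_zero, if_neg fun h' => h h'.1]

open scoped Classical in
theorem counit_mul_mul_e (A A' A'' : B) : counit (R := k) (e ϑ A * e ϑ A' * e ϑ A'') =
    if T.vbox.tgt A = T.vbox.src A' ∧ T.vbox.tgt A' = T.vbox.src A'' ∧
      T.IsHId (T.vbox.comp A (T.vbox.comp A' A'')) then (ϑ.onBox A'')⁻¹ else 0 := by
  rw [mul_assoc, e_mul_e A']
  by_cases h : T.vbox.tgt A' = T.vbox.src A''
  · rw [if_pos h, counit_mul_e, onBox_vcomp h, T.vbox.src_comp _ _ h]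
    simp only [h, true_and]
  · rw [if_neg h, mul_zero, map_zero, if_neg fun h' => h h'.2.1]

/-- If `A / U` is a horizontal identity and `U W` is defined, then `bl(U) = bl(W)`. -/
theorem onBox_eq_of_isHId {A U W : B} (h1 : T.vbox.tgt A = T.vbox.src U)
    (h2 : T.IsHId (T.vbox.comp A U)) (h3 : T.hbox.tgt U = T.hbox.src W) :
    ϑ.onBox U = ϑ.onBox W := by
  obtain ⟨g, hg⟩ := h2
  have h4 : T.vbox.tgt U = T.hor.one (T.ver.tgt g) := by
    rw [← T.vbox.tgt_comp _ _ h1, hg, T.bot_hone]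
  simp only [CornerWeight.onBox, botLeft, left, ← h3]
  rw [T.bot_left, T.bot_right, h4, T.hor.src_one, T.hor.tgt_one]

open scoped Classical in
theorem counit_left_e (A A' A'' : B) : counit (R := k) (e ϑ A * e ϑ A' * e ϑ A'') =
    LinearMap.mul' k k (TensorProduct.map (counit ∘ₗ LinearMap.mulLeft k (e ϑ A))
      (counit ∘ₗ LinearMap.mulRight k (e ϑ A'')) (comul (R := k) (e ϑ A'))) := by
  symm
  refine (map_comul_e (LinearMap.mul' k k ∘ₗ TensorProduct.map
    (counit ∘ₗ LinearMap.mulLeft k (e ϑ A)) (counit ∘ₗ LinearMap.mulRight k (e ϑ A''))) A').trans ?_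
  obtain ⟨F, hF⟩ := T.transpose.exists_unit_factorization
  rw [counit_mul_mul_e]
  have h1 := sum_ite_and_eq (T.vbox.tgt A = T.vbox.src A' ∧ T.vbox.tgt A' = T.vbox.src A'' ∧
      T.IsHId (T.vbox.comp A (T.vbox.comp A' A''))) (F A A') (ϑ.onBox A'')⁻¹
  rw [← h1, Fintype.sum_prod_type]
  refine Finset.sum_congr rfl fun U _ => Finset.sum_congr rfl fun W _ => ?_
  have h2 := hF A A' A'' U W
  simp only [LinearMap.comp_apply, TensorProduct.map_tmul, LinearMap.mul'_apply,
    LinearMap.mulLeft_apply, LinearMap.mulRight_apply, counit_mul_e]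
  by_cases c : (T.vbox.tgt A = T.vbox.src A' ∧ T.vbox.tgt A' = T.vbox.src A'' ∧
      T.IsHId (T.vbox.comp A (T.vbox.comp A' A''))) ∧ (U, W) = F A A'
  · obtain ⟨c1, c2, c3, c4, c5, c6⟩ := h2.2 c
    rw [if_pos c, if_pos ⟨c5, c6⟩, if_pos ⟨c1, c2⟩, if_pos ⟨c3, c4⟩,
      onBox_eq_of_isHId (ϑ := ϑ) c1 c2 c5, smul_eq_mul, mul_inv_cancel_left₀ (ϑ.onBox_ne_zero W)]
  · rw [if_neg c]
    by_cases d1 : T.hbox.tgt U = T.hbox.src W ∧ T.hbox.comp U W = A'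
    · by_cases d2 : T.vbox.tgt A = T.vbox.src U ∧ T.IsHId (T.vbox.comp A U)
      · by_cases d3 : T.vbox.tgt W = T.vbox.src A'' ∧ T.IsHId (T.vbox.comp W A'')
        · exact absurd (h2.1 ⟨d2.1, d2.2, d3.1, d3.2, d1.1, d1.2⟩) c
        · rw [if_neg d3, mul_zero, smul_zero, ite_self]
      · rw [if_neg d2, zero_mul, smul_zero, ite_self]
    · rw [if_neg d1]

open scoped Classical in
theorem counit_right_e (A A' A'' : B) : counit (R := k) (e ϑ A * e ϑ A' * e ϑ A'') =
    LinearMap.mul' k k (TensorProduct.map (counit ∘ₗ LinearMap.mulRight k (e ϑ A''))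
      (counit ∘ₗ LinearMap.mulLeft k (e ϑ A)) (comul (R := k) (e ϑ A'))) := by
  symm
  refine (map_comul_e (LinearMap.mul' k k ∘ₗ TensorProduct.map
    (counit ∘ₗ LinearMap.mulRight k (e ϑ A'')) (counit ∘ₗ LinearMap.mulLeft k (e ϑ A))) A').trans ?_
  obtain ⟨F, hF⟩ := T.transpose.flip.exists_unit_factorization
  rw [counit_mul_mul_e]
  have h1 := sum_ite_and_eq (T.vbox.tgt A = T.vbox.src A' ∧ T.vbox.tgt A' = T.vbox.src A'' ∧
      T.IsHId (T.vbox.comp A (T.vbox.comp A' A''))) (F A A') (ϑ.onBox A'')⁻¹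
  rw [← h1, Fintype.sum_prod_type, Finset.sum_comm]
  refine Finset.sum_congr rfl fun W _ => Finset.sum_congr rfl fun U _ => ?_
  have h2 := hF A A' A'' W U
  simp only [LinearMap.comp_apply, TensorProduct.map_tmul, LinearMap.mul'_apply,
    LinearMap.mulLeft_apply, LinearMap.mulRight_apply, counit_mul_e]
  by_cases c : (T.vbox.tgt A = T.vbox.src A' ∧ T.vbox.tgt A' = T.vbox.src A'' ∧
      T.IsHId (T.vbox.comp A (T.vbox.comp A' A''))) ∧ (W, U) = F A A'
  · obtain ⟨c1, c2, c3, c4, c5, c6⟩ := h2.2 c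
    rw [if_pos c, if_pos ⟨Eq.symm c5, c6⟩, if_pos ⟨c3, c4⟩, if_pos ⟨c1, c2⟩, smul_eq_mul,
      mul_left_comm, mul_inv_cancel₀ (ϑ.onBox_ne_zero W), mul_one]
  · rw [if_neg c]
    by_cases d1 : T.hbox.tgt U = T.hbox.src W ∧ T.hbox.comp U W = A'
    · by_cases d2 : T.vbox.tgt A = T.vbox.src W ∧ T.IsHId (T.vbox.comp A W)
      · by_cases d3 : T.vbox.tgt U = T.vbox.src A'' ∧ T.IsHId (T.vbox.comp U A'')
        · exact absurd (h2.1 ⟨d2.1, d2.2, d3.1, d3.2, d1.1.symm, d1.2⟩) c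
        · rw [if_neg d3, zero_mul, smul_zero, ite_self]
      · rw [if_neg d2, mul_zero, smul_zero, ite_self]
    · rw [if_neg d1]

theorem counit_left_aux (a c : T.BoxAlg ϑ) (t : T.BoxAlg ϑ ⊗[k] T.BoxAlg ϑ) :
    LinearMap.mul' k k (TensorProduct.map (counit ∘ₗ LinearMap.mulLeft k a)
      (counit ∘ₗ LinearMap.mulRight k c) t) =
    LinearMap.mul' k k (TensorProduct.map (counit (R := k)) (counit (R := k))
      ((a ⊗ₜ[k] 1) * t * (1 ⊗ₜ[k] c))) := by
  induction t using TensorProduct.induction_on with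
  | zero => simp only [map_zero, mul_zero, zero_mul]
  | tmul x y => simp
  | add x y hx hy => simp only [map_add, mul_add, add_mul, hx, hy]

theorem counit_right_aux (a c : T.BoxAlg ϑ) (t : T.BoxAlg ϑ ⊗[k] T.BoxAlg ϑ) :
    LinearMap.mul' k k (TensorProduct.map (counit ∘ₗ LinearMap.mulRight k c)
      (counit ∘ₗ LinearMap.mulLeft k a) t) =
    LinearMap.mul' k k (TensorProduct.map (counit (R := k)) (counit (R := k))
      ((1 ⊗ₜ[k] a) * t * (c ⊗ₜ[k] 1))) := by
  induction t using TensorProduct.induction_on with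
  | zero => simp only [map_zero, mul_zero, zero_mul]
  | tmul x y => simp
  | add x y hx hy => simp only [map_add, mul_add, add_mul, hx, hy]

noncomputable instance : WeakBialgebra k (T.BoxAlg ϑ) where
  comul_mul a b := by
    induction a using basis_induction with
    | zero => simp only [zero_mul, map_zero]
    | add x y hx hy => simp only [add_mul, map_add, hx, hy]
    | basis c A =>
      induction b using basis_induction with
      | zero => simp only [mul_zero, map_zero]
      | add x y hx hy => simp only [mul_add, map_add, hx, hy]
      | basis d A' => simp only [smul_mul_assoc, mul_smul_comm, map_smul, comul_mul_e]
  comul_one_left := unit_left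
  comul_one_right := unit_right
  counit_mul_left a b c := by
    induction a using basis_induction with
    | zero => simp only [counit_left_aux, TensorProduct.zero_tmul, TensorProduct.tmul_zero, zero_mul, map_zero]
    | add x y hx hy =>
      simp only [counit_left_aux] at hx hy ⊢
      simp only [TensorProduct.add_tmul, TensorProduct.tmul_add, add_mul, map_add, hx, hy]
    | basis r A =>
      induction b using basis_induction with
      | zero => simp only [mul_zero, zero_mul, map_zero]
      | add x y hx hy => simp only [mul_add, add_mul, map_add, hx, hy]
      | basis r' A' =>
        induction c using basis_induction with
        | zero => simp only [counit_left_aux, TensorProduct.zero_tmul, TensorProduct.tmul_zero, mul_zero, map_zero]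
        | add x y hx hy =>
          simp only [counit_left_aux] at hx hy ⊢
          simp only [TensorProduct.add_tmul, TensorProduct.tmul_add, mul_add, map_add, hx, hy]
        | basis r'' A'' =>
          have h := counit_left_e (ϑ := ϑ) A A' A''
          simp only [counit_left_aux] at h ⊢
          simp only [← TensorProduct.smul_tmul', TensorProduct.tmul_smul, smul_mul_assoc, mul_smul_comm, map_smul, h]
  counit_mul_right a b c := by
    induction a using basis_induction with
    | zero => simp only [counit_right_aux, TensorProduct.zero_tmul, TensorProduct.tmul_zero, zero_mul, map_zero]
    | add x y hx hy =>
      simp only [counit_right_aux] at hx hy ⊢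
      simp only [TensorProduct.add_tmul, TensorProduct.tmul_add, add_mul, map_add, hx, hy]
    | basis r A =>
      induction b using basis_induction with
      | zero => simp only [mul_zero, zero_mul, map_zero]
      | add x y hx hy => simp only [mul_add, add_mul, map_add, hx, hy]
      | basis r' A' =>
        induction c using basis_induction with
        | zero => simp only [counit_right_aux, TensorProduct.zero_tmul, TensorProduct.tmul_zero, mul_zero, map_zero]
        | add x y hx hy =>
          simp only [counit_right_aux] at hx hy ⊢
          simp only [TensorProduct.add_tmul, TensorProduct.tmul_add, mul_add, map_add, hx, hy]
        | basis r'' A'' =>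
          have h := counit_right_e (ϑ := ϑ) A A' A''
          simp only [counit_right_aux] at h ⊢
          simp only [← TensorProduct.smul_tmul', TensorProduct.tmul_smul, smul_mul_assoc, mul_smul_comm, map_smul, h]

end BoxAlg

end DoubleGroupoid

namespace DoubleGroupoid

/-- The set `E` of boxes whose right and top sides are identities (the arrows of the core
groupoid). -/
def core {P H V B : Type*} (T : DoubleGroupoid P H V B) : Set B :=
  {E | (∃ p, T.right E = T.ver.one p) ∧ ∃ q, T.top E = T.hor.one q}

end DoubleGroupoid

/-!
Most of the definition of a fusion category holds for `Rep H`, `H = T.BoxAlg ϑ`, without any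
condition on `T`; the exception is that the unit object is simple.

* As an algebra, `H` is the algebra of the finite groupoid of boxes with vertical composition. In
  characteristic `0` it is semisimple by averaging over arrows
  (`SetGroupoid.Alg.isSemisimpleRing`), so its finite-dimensional modules are finite direct sums of
  finitely many simple ones. Kernels, cokernels and biproducts are those of modules.
* The map `S(A) = ϑ(tr(A)) ϑ(br(A))⁻¹ A⁻¹`, with `A⁻¹` the inverse for both compositions, is a
  bijective antipode (`isAntipode_antipode`). The verification groups the factorizations `X Y = A`
  by the top side of `X`: by the interchange law the product `X / Y⁻¹` depends on that side alone,
  and the coefficients add up to `1` by the condition on `ϑ`.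
* For a weak bialgebra with an antipode, the dual space with `h` acting as the transpose of `S(h)`
  is a right dual (`right_zigzag`, `left_zigzag`). Since `S` is invertible, every module is
  isomorphic to such a dual, so left duals exist too.

The unit object `H_t` has a basis `u_E` indexed by the core, the boxes `E` whose right and top sides
are identities. A box `A` sends `u_E` to `u_{E'}` for some `E'` with `b(E') = t(A)⁻¹` if
`b(A) = b(E)⁻¹`, and to `0` otherwise (`exists_smul_coreUnit_eq`, `smul_coreUnit_eq_zero'`). Hence
`H_t` is a permutation representation of the groupoid of boxes, graded by the bottom sides of core
boxes. A linear form vanishing on an orbit of a vector vanishes on the submodule it generates.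
Applied to the sum of all coordinates, this shows that `u_E - u_{E'}` generates a proper submodule
when `b(E) = b(E')`; applied to the coordinate at `id q`, that `u_{id p}` does when `p` and `q` are
not joined by a vertical arrow. So simplicity implies both conditions. Conversely, if each graded
piece is at most one-dimensional, vertical identities extract from a nonzero vector one of the
`u_E`, and connectedness makes the boxes act transitively on these, so `H_t` is simple
(`isSimpleModule_of_isConnected`).
-/

/-! ### The abelian category of finite-dimensional modules -/

namespace FinRep

section Abelian

variable {k : Type u} {H : Type w} [Field k] [Ring H] [Algebra k H]

/-- The linear map underlying a morphism. -/
def toLin {V W : FinRep k H} (f : V ⟶ W) : (V : Type w) →ₗ[H] W := f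

@[ext]
theorem hom_ext {V W : FinRep k H} {f g : V ⟶ W} (h : ∀ x, toLin f x = toLin g x) : f = g :=
  LinearMap.ext h

theorem toLin_sum {ι : Type*} (s : Finset ι) {V W : FinRep k H} (f : ι → (V ⟶ W)) (x : V) :
    toLin (∑ i ∈ s, f i) x = ∑ i ∈ s, toLin (f i) x :=
  map_sum (⟨⟨fun f : V ⟶ W => toLin f x, rfl⟩, fun _ _ => rfl⟩ : (V ⟶ W) →+ W) f s

/-- A submodule of a finite-dimensional module. -/
def ofSubmodule (V : FinRep k H) (N : Submodule H V) : FinRep k H where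
  carrier := N
  finite := inferInstanceAs (Module.Finite k (N.restrictScalars k))

/-- A quotient of a finite-dimensional module. -/
def ofQuotient (V : FinRep k H) (N : Submodule H V) : FinRep k H where
  carrier := V ⧸ N
  finite := Module.Finite.of_surjective (N.mkQ.restrictScalars k) N.mkQ_surjective

/-- The inclusion of a submodule. -/
def subtypeHom (V : FinRep k H) (N : Submodule H V) : ofSubmodule V N ⟶ V := N.subtype

/-- The projection onto a quotient. -/
def mkHom (V : FinRep k H) (N : Submodule H V) : V ⟶ ofQuotient V N := N.mkQ

theorem subtypeHom_injective (V : FinRep k H) (N : Submodule H V) :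
    Function.Injective (toLin (subtypeHom V N)) := N.injective_subtype

theorem mkHom_surjective (V : FinRep k H) (N : Submodule H V) :
    Function.Surjective (toLin (mkHom V N)) := N.mkQ_surjective

theorem mono_of_injective {V W : FinRep k H} (f : V ⟶ W) (hf : Function.Injective (toLin f)) :
    Mono f :=
  ⟨fun _ _ e => hom_ext fun x => hf (DFunLike.congr_fun (congrArg toLin e) x)⟩

theorem epi_of_surjective {V W : FinRep k H} (f : V ⟶ W) (hf : Function.Surjective (toLin f)) :
    Epi f :=
  ⟨fun g h e => hom_ext fun y => by
    obtain ⟨x, rfl⟩ := hf y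
    exact DFunLike.congr_fun (congrArg toLin e) x⟩

theorem injective_of_mono {V W : FinRep k H} (f : V ⟶ W) [Mono f] :
    Function.Injective (toLin f) := by
  have h : subtypeHom V (LinearMap.ker (toLin f)) ≫ f =
      (0 : ofSubmodule V (LinearMap.ker (toLin f)) ⟶ V) ≫ f :=
    hom_ext fun x => x.2.trans (map_zero (toLin f)).symm
  have h' := (cancel_mono f).1 h
  rw [← LinearMap.ker_eq_bot, eq_bot_iff]
  intro x hx
  exact DFunLike.congr_fun (congrArg toLin h') ⟨x, hx⟩

theorem surjective_of_epi {V W : FinRep k H} (f : V ⟶ W) [Epi f] :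
    Function.Surjective (toLin f) := by
  have h : f ≫ mkHom W (LinearMap.range (toLin f)) =
      f ≫ (0 : W ⟶ ofQuotient W (LinearMap.range (toLin f))) :=
    hom_ext fun x => (Submodule.Quotient.mk_eq_zero _).2 ⟨x, rfl⟩
  have h' := (cancel_epi f).1 h
  rw [← LinearMap.range_eq_top, eq_top_iff]
  intro y _
  exact (Submodule.Quotient.mk_eq_zero _).1 (DFunLike.congr_fun (congrArg toLin h') y)

theorem isIso_of_bijective {V W : FinRep k H} (f : V ⟶ W) (hf : Function.Bijective (toLin f)) :
    IsIso f :=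
  (isoOfEquiv (LinearEquiv.ofBijective (toLin f) hf)).isIso_hom

/-- An injective module map is a kernel of any map whose linear kernel is its range. -/
noncomputable def isLimitOfExact {U V W : FinRep k H} (i : U ⟶ V) (f : V ⟶ W) (w : i ≫ f = 0)
    (hi : Function.Injective (toLin i))
    (h : LinearMap.ker (toLin f) ≤ LinearMap.range (toLin i)) :
    Limits.IsLimit (Limits.KernelFork.ofι i w) :=
  have := mono_of_injective i hi
  Limits.KernelFork.IsLimit.ofι' i w fun g hg =>
    let e := LinearEquiv.ofInjective (toLin i) hi
    ⟨e.symm.toLinearMap ∘ₗ (toLin g).codRestrict _ fun x =>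
      h (DFunLike.congr_fun (congrArg toLin hg) x), hom_ext fun _ =>
        congrArg Subtype.val (e.apply_symm_apply _)⟩

/-- A surjective module map is a cokernel of any map whose range is its linear kernel. -/
noncomputable def isColimitOfExact {U V W : FinRep k H} (f : U ⟶ V) (p : V ⟶ W) (w : f ≫ p = 0)
    (hp : Function.Surjective (toLin p))
    (h : LinearMap.ker (toLin p) ≤ LinearMap.range (toLin f)) :
    Limits.IsColimit (Limits.CokernelCofork.ofπ p w) :=
  have := epi_of_surjective p hp
  Limits.CokernelCofork.IsColimit.ofπ' p w fun g hg =>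
    let e := (toLin p).quotKerEquivOfSurjective hp
    have hg' : LinearMap.ker (toLin p) ≤ LinearMap.ker (toLin g) := fun x hx => by
      obtain ⟨y, rfl⟩ := h hx
      exact DFunLike.congr_fun (congrArg toLin hg) y
    ⟨(LinearMap.ker (toLin p)).liftQ (toLin g) hg' ∘ₗ e.symm.toLinearMap, hom_ext fun x =>
      congrArg ((LinearMap.ker (toLin p)).liftQ (toLin g) hg')
        (e.symm_apply_eq.2 rfl : e.symm (toLin p x) = Submodule.Quotient.mk x)⟩

instance : Limits.HasKernels (FinRep k H) where
  has_limit {V _} f := ⟨⟨_, isLimitOfExact (subtypeHom V (LinearMap.ker (toLin f))) f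
    (hom_ext fun x => x.2) (subtypeHom_injective _ _) fun x hx => ⟨⟨x, hx⟩, rfl⟩⟩⟩

instance : Limits.HasCokernels (FinRep k H) where
  has_colimit {_ W} f := ⟨⟨_, isColimitOfExact f (mkHom W (LinearMap.range (toLin f)))
    (hom_ext fun x => (Submodule.Quotient.mk_eq_zero _).2 ⟨x, rfl⟩) (mkHom_surjective _ _)
    fun _ hx => (Submodule.Quotient.mk_eq_zero _).1 hx⟩⟩

instance : IsNormalMonoCategory (FinRep k H) where
  normalMonoOfMono {_ W} f _ :=
    ⟨{ Z := ofQuotient W (LinearMap.range (toLin f))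
       g := mkHom W _
       w := hom_ext fun x => (Submodule.Quotient.mk_eq_zero _).2 ⟨x, rfl⟩
       isLimit := isLimitOfExact _ _ _ (injective_of_mono f) fun _ hx =>
         (Submodule.Quotient.mk_eq_zero _).1 hx }⟩

instance : IsNormalEpiCategory (FinRep k H) where
  normalEpiOfEpi {V _} f _ :=
    ⟨{ W := ofSubmodule V (LinearMap.ker (toLin f))
       g := subtypeHom V _
       w := hom_ext fun x => x.2
       isColimit := isColimitOfExact _ _ _ (surjective_of_epi f) fun x hx => ⟨⟨x, hx⟩, rfl⟩ }⟩

open scoped Classical in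
/-- The product of finitely many modules, as a bicone. -/
noncomputable def piBicone {n : ℕ} (S : Fin n → FinRep k H) : Limits.Bicone S where
  pt := { carrier := ∀ i, S i }
  π i := LinearMap.proj i
  ι i := LinearMap.single H (fun i => (S i : Type w)) i
  ι_π i j := by
    split_ifs with h
    · subst h
      exact hom_ext fun x => Pi.single_eq_same (M := fun i => (S i : Type w)) i x
    · exact hom_ext fun x => Pi.single_eq_of_ne (M := fun i => (S i : Type w)) (Ne.symm h) x

/-- The product of finitely many modules is their biproduct. -/
noncomputable def piBiconeIsBilimit {n : ℕ} (S : Fin n → FinRep k H) : (piBicone S).IsBilimit :=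
  Limits.isBilimitOfTotal _ (hom_ext fun x => by
    classical
    refine (toLin_sum _ _ _).trans ?_
    exact Finset.univ_sum_single (M := fun i => (S i : Type w)) x)

instance : Limits.HasFiniteProducts (FinRep k H) :=
  have : Limits.HasFiniteBiproducts (FinRep k H) :=
    ⟨fun _ => ⟨fun S => ⟨⟨⟨piBicone S, piBiconeIsBilimit S⟩⟩⟩⟩⟩
  inferInstance

theorem finite_hom (V W : FinRep k H) : Module.Finite k (V ⟶ W) :=
  Module.Finite.of_injective
    ({ toFun := fun f => (toLin f).restrictScalars k
       map_add' := fun _ _ => rfl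
       map_smul' := fun _ _ => rfl } : (V ⟶ W) →ₗ[k] (V : Type w) →ₗ[k] W)
    fun _ _ h => hom_ext fun x => DFunLike.congr_fun h x

theorem simple_iff_isSimpleModule (V : FinRep k H) : Simple V ↔ IsSimpleModule H V := by
  constructor
  · intro hV
    have hmono : ∀ N : Submodule H V, Mono (subtypeHom V N) := fun N =>
      mono_of_injective _ (subtypeHom_injective V N)
    have key : ∀ N : Submodule H V, N = ⊥ ∨ N = ⊤ := by
      intro N
      by_cases h0 : subtypeHom V N = 0
      · left
        rw [eq_bot_iff]
        intro x hx
        exact DFunLike.congr_fun (congrArg toLin h0) ⟨x, hx⟩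
      · right
        have := hmono N
        have := isIso_of_mono_of_nonzero h0
        rw [eq_top_iff]
        intro x _
        obtain ⟨y, rfl⟩ := surjective_of_epi (subtypeHom V N) x
        exact y.2
    have hne : (⊥ : Submodule H V) ≠ ⊤ := by
      intro h
      refine id_nonzero V (hom_ext fun x => ?_)
      have : x ∈ (⊥ : Submodule H V) := h ▸ Submodule.mem_top
      exact this
    rw [isSimpleModule_iff]
    exact { exists_pair_ne := ⟨_, _, hne⟩, eq_bot_or_eq_top := key }
  · intro hV
    refine ⟨fun {W} f _ => ⟨fun _ h0 => ?_, fun h0 => ?_⟩⟩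
    · have := IsSimpleModule.nontrivial H V
      obtain ⟨x, hx⟩ := exists_ne (0 : V)
      obtain ⟨y, rfl⟩ := surjective_of_epi f x
      exact hx (by rw [h0]; rfl)
    · exact isIso_of_bijective f ⟨injective_of_mono f,
        LinearMap.surjective_of_ne_zero (f := toLin f) h0⟩

theorem exists_iso_biproduct_simples [IsSemisimpleRing H] (V : FinRep k H) :
    ∃ (n : ℕ) (S : Fin n → FinRep k H) (b : Limits.Bicone S),
      (∀ i, Simple (S i)) ∧ Nonempty b.IsBilimit ∧ Nonempty (V ≅ b.pt) := by
  have : Module.Finite H V := Module.Finite.of_restrictScalars_finite k H V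
  obtain ⟨n, S, e, hS⟩ := IsSemisimpleModule.exists_linearEquiv_fin_dfinsupp H V
  refine ⟨n, fun i => ofSubmodule V (S i), piBicone _, fun i => ?_, ⟨piBiconeIsBilimit _⟩,
    ⟨isoOfEquiv (W := (piBicone fun i => ofSubmodule V (S i)).pt)
      (e.trans (DFinsupp.linearEquivFunOnFintype (R := H)))⟩⟩
  exact (simple_iff_isSimpleModule _).2 (hS i)

/-- Every simple module is a quotient of the regular module, hence isomorphic to one of the
finitely many simple summands of the latter. -/
theorem exists_simples [IsSemisimpleRing H] [Module.Finite k H] :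
    ∃ (n : ℕ) (S : Fin n → FinRep k H), ∀ V : FinRep k H, Simple V → ∃ i, Nonempty (V ≅ S i) := by
  obtain ⟨n, S, e, hS⟩ := IsSemisimpleModule.exists_linearEquiv_fin_dfinsupp H H
  refine ⟨n, fun i => ofSubmodule ⟨H⟩ (S i), fun V hV => ?_⟩
  have hV' := (simple_iff_isSimpleModule V).1 hV
  have := IsSimpleModule.nontrivial H V
  obtain ⟨x, hx⟩ := exists_ne (0 : V)
  let f : H →ₗ[H] V := LinearMap.toSpanSingleton H V x
  have hf : f ≠ 0 := fun h => hx (by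
    have := DFunLike.congr_fun h 1
    simpa [f] using this)
  by_contra! hcon
  refine hf ?_
  have : f ∘ₗ e.symm.toLinearMap = 0 := by
    refine DFinsupp.lhom_ext' fun i => ?_
    have := hS i
    rcases LinearMap.bijective_or_eq_zero ((f ∘ₗ e.symm.toLinearMap) ∘ₗ DFinsupp.lsingle i) with h | h
    · exact ((hcon i).false (isoOfEquiv (V := V) (W := ofSubmodule ⟨H⟩ (S i))
        (LinearEquiv.ofBijective _ h).symm)).elim
    · rw [h]; rfl
  refine LinearMap.ext fun y => ?_
  have := DFunLike.congr_fun this (e y)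
  simpa using this

end Abelian

section Linear

open WeakBialgebra

variable {k : Type u} {H : Type w} [Field k] [Ring H] [Algebra k H] [WeakBialgebra k H]
  [Module.Finite k H]

theorem incl_whiskerLeft (U : FinRep k H) {V W : FinRep k H} (f : V ⟶ W) (x) :
    incl k H U W (toLin (MonoidalCategory.whiskerLeft U f) x) =
      ((toLin f).restrictScalars k).lTensor U (incl k H U V x) :=
  incl_tensorMap (LinearMap.id : U →ₗ[H] U) (toLin f) x

theorem incl_whiskerRight {V W : FinRep k H} (f : V ⟶ W) (U : FinRep k H) (x) :
    incl k H W U (toLin (MonoidalCategory.whiskerRight f U) x) =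
      ((toLin f).restrictScalars k).rTensor U (incl k H V U x) :=
  incl_tensorMap (toLin f) (LinearMap.id : U →ₗ[H] U) x

instance : MonoidalPreadditive (FinRep k H) where
  whiskerLeft_zero {U V W} := hom_ext fun x => incl_injective ((incl_whiskerLeft _ _ x).trans (by
    refine (DFunLike.congr_fun (LinearMap.lTensor_zero _) _).trans ?_
    exact (map_zero (incl k H U W)).symm))
  zero_whiskerRight {U V W} := hom_ext fun x => incl_injective ((incl_whiskerRight _ _ x).trans (by
    refine (DFunLike.congr_fun (LinearMap.rTensor_zero _) _).trans ?_
    exact (map_zero (incl k H W U)).symm))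
  whiskerLeft_add {U V W} f g := hom_ext fun x => incl_injective ((incl_whiskerLeft _ _ x).trans (by
    refine (DFunLike.congr_fun (LinearMap.lTensor_add _ ((toLin f).restrictScalars k)
      ((toLin g).restrictScalars k)) _).trans ?_
    refine (congrArg₂ (· + ·) (incl_whiskerLeft U f x) (incl_whiskerLeft U g x)).symm.trans ?_
    exact (map_add (incl k H U W) _ _).symm))
  add_whiskerRight {U V W} f g := hom_ext fun x => incl_injective ((incl_whiskerRight _ _ x).trans (by
    refine (DFunLike.congr_fun (LinearMap.rTensor_add _ ((toLin f).restrictScalars k)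
      ((toLin g).restrictScalars k)) _).trans ?_
    refine (congrArg₂ (· + ·) (incl_whiskerRight f U x) (incl_whiskerRight g U x)).symm.trans ?_
    exact (map_add (incl k H W U) _ _).symm))

instance : MonoidalLinear k (FinRep k H) where
  whiskerLeft_smul U V W c f := hom_ext fun x => incl_injective ((incl_whiskerLeft _ _ x).trans (by
    refine (DFunLike.congr_fun (LinearMap.lTensor_smul _ c ((toLin f).restrictScalars k))
      _).trans ?_
    refine (congrArg _ (incl_whiskerLeft U f x)).symm.trans ?_
    exact (map_smul (incl k H U W) c _).symm))
  smul_whiskerRight c V W f U := hom_ext fun x => incl_injective ((incl_whiskerRight _ _ x).trans (by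
    refine (DFunLike.congr_fun (LinearMap.rTensor_smul _ c ((toLin f).restrictScalars k))
      _).trans ?_
    refine (congrArg _ (incl_whiskerRight f U x)).symm.trans ?_
    exact (map_smul (incl k H W U) c _).symm))

end Linear

end FinRep

/-! ### Duals of modules over a weak Hopf algebra -/

namespace WeakBialgebra

open Coalgebra

section Sweedler

variable {k : Type*} {H : Type*} [Field k] [Ring H] [Algebra k H] [WeakBialgebra k H]
variable {s : Finset (H × H)}

theorem sourceMap_eq
    (hs : ∑ i ∈ s, i.1 ⊗ₜ[k] i.2 = comul (R := k) (1 : H)) (h : H) :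
    sourceMap k H h = ∑ i ∈ s, counit (R := k) (h * i.2) • i.1 := by
  simp [sourceMap, ← hs, Finset.mul_sum]

theorem sourceMap_one : sourceMap k H 1 = 1 := by
  obtain ⟨s, hs⟩ := exists_repr_one (k := k) (H := H)
  rw [sourceMap_eq hs]
  have h1 := lTensor_counit_comul (R := k) (1 : H)
  rw [← hs] at h1
  simpa using congrArg (TensorProduct.rid k H) h1

theorem barMap_targetMap (h : H) : barMap k H (targetMap k H h) = barMap k H h := by
  simpa using barMap_mul_targetMap (k := k) 1 h

/-- `h₁ ⊗ ε_t(h₂) = 1₁ h ⊗ 1₂`. -/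
theorem lTensor_targetMap_comul (h : H) :
    (targetMap k H).lTensor H (comul (R := k) h) = comul (R := k) 1 * (h ⊗ₜ[k] 1) := by
  obtain ⟨s, hs⟩ := exists_repr_one (k := k) (H := H)
  have h1 : ∑ i ∈ s, comul (R := k) (i.1 * h) ⊗ₜ[k] i.2 =
      ∑ j ∈ s, (((1 : H) ⊗ₜ[k] j.1) * comul (R := k) h) ⊗ₜ[k] j.2 := by
    have h2 : ∑ j ∈ s, ((1 : H) ⊗ₜ[k] j.1 * comul (R := k) (1 : H)) ⊗ₜ[k] j.2 =
        ∑ i ∈ s, comul (R := k) i.1 ⊗ₜ[k] i.2 := by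
      rw [comul_fst_right hs, Finset.sum_comm, ← hs]
      simp [Finset.mul_sum, TensorProduct.sum_tmul]
    have h3 := congrArg (· * (comul (R := k) h ⊗ₜ[k] (1 : H))) h2
    simp only [Finset.sum_mul, Algebra.TensorProduct.tmul_mul_tmul, mul_one, mul_assoc,
      ← comul_mul, one_mul] at h3
    exact h3.symm
  let F : (H ⊗[k] H) ⊗[k] H →ₗ[k] H ⊗[k] H :=
    ((TensorProduct.rid k H).toLinearMap ∘ₗ counit.lTensor H).rTensor H
  have h4 := congrArg F h1
  have h5 : ∀ x : H, TensorProduct.rid k H (counit.lTensor H (comul (R := k) x)) = x := by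
    intro x
    rw [lTensor_counit_comul]
    simp
  simp only [F, map_sum, LinearMap.rTensor_tmul, LinearMap.comp_apply, LinearEquiv.coe_coe, h5]
    at h4
  rw [← hs]
  simp only [Finset.sum_mul, Algebra.TensorProduct.tmul_mul_tmul, mul_one]
  rw [h4]
  induction comul (R := k) h using TensorProduct.induction_on with
  | zero => simp
  | add x y hx hy =>
    simp only [map_add, mul_add, TensorProduct.add_tmul, Finset.sum_add_distrib, hx, hy]
  | tmul x y =>
    simp [targetMap_eq hs, TensorProduct.tmul_sum, TensorProduct.smul_tmul]

/-- `ε_s(h₁) ⊗ h₂ = 1₁ ⊗ h 1₂`. -/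
theorem rTensor_sourceMap_comul (h : H) :
    (sourceMap k H).rTensor H (comul (R := k) h) = (1 ⊗ₜ[k] h) * comul (R := k) 1 := by
  obtain ⟨s, hs⟩ := exists_repr_one (k := k) (H := H)
  have h1 : ∑ i ∈ s, i.1 ⊗ₜ[k] comul (R := k) (h * i.2) =
      ∑ i ∈ s, i.1 ⊗ₜ[k] (comul (R := k) h * (i.2 ⊗ₜ[k] (1 : H))) := by
    have h2 : ∑ i ∈ s, i.1 ⊗ₜ[k] (comul (R := k) (1 : H) * (i.2 ⊗ₜ[k] (1 : H))) =
        ∑ i ∈ s, i.1 ⊗ₜ[k] comul (R := k) i.2 := by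
      rw [comul_snd_right hs, ← hs]
      simp [Finset.sum_mul, TensorProduct.tmul_sum]
    have h3 := congrArg (((1 : H) ⊗ₜ[k] comul (R := k) h) * ·) h2
    simp only [Finset.mul_sum, Algebra.TensorProduct.tmul_mul_tmul, one_mul, ← mul_assoc,
      ← comul_mul, mul_one] at h3
    exact h3.symm
  let F : H ⊗[k] (H ⊗[k] H) →ₗ[k] H ⊗[k] H :=
    ((TensorProduct.lid k H).toLinearMap ∘ₗ counit.rTensor H).lTensor H
  have h4 := congrArg F h1
  have h5 : ∀ x : H, TensorProduct.lid k H (counit.rTensor H (comul (R := k) x)) = x := by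
    intro x
    rw [rTensor_counit_comul]
    simp
  simp only [F, map_sum, LinearMap.lTensor_tmul, LinearMap.comp_apply, LinearEquiv.coe_coe, h5]
    at h4
  rw [← hs]
  simp only [Finset.mul_sum, Algebra.TensorProduct.tmul_mul_tmul, one_mul]
  rw [h4]
  induction comul (R := k) h using TensorProduct.induction_on with
  | zero => simp
  | add x y hx hy =>
    simp only [map_add, add_mul, TensorProduct.tmul_add, Finset.sum_add_distrib, hx, hy]
  | tmul x y =>
    simp [sourceMap_eq hs, TensorProduct.sum_tmul, TensorProduct.smul_tmul]

/-- The first leg of `Δ(1)` commutes with the target subalgebra. -/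
theorem comul_one_comm_target {z : H} (hz : z ∈ LinearMap.range (targetMap k H)) :
    (z ⊗ₜ[k] (1 : H)) * comul (R := k) 1 = comul (R := k) 1 * (z ⊗ₜ[k] 1) := by
  obtain ⟨s, hs⟩ := exists_repr_one (k := k) (H := H)
  obtain ⟨g, rfl⟩ := hz
  let F : (H ⊗[k] H) ⊗[k] H →ₗ[k] H ⊗[k] H :=
    ((TensorProduct.lid k H).toLinearMap ∘ₗ (counit ∘ₗ LinearMap.mulRight k g).rTensor H).rTensor H
  have h1 := congrArg F ((comul_fst_left hs).symm.trans (comul_fst_right hs))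
  rw [targetMap_eq hs, ← hs]
  simp only [F, map_sum, LinearMap.rTensor_tmul, LinearMap.comp_apply, LinearEquiv.coe_coe,
    TensorProduct.lid_tmul, LinearMap.mulRight_apply] at h1
  rw [Finset.sum_comm] at h1
  simpa only [Finset.sum_mul, Finset.mul_sum, TensorProduct.sum_tmul, mul_one, one_mul,
    Algebra.TensorProduct.tmul_mul_tmul, smul_mul_assoc, mul_smul_comm, mul_assoc] using h1

end Sweedler

section Antipode

variable {k : Type*} {H : Type*} [Field k] [Ring H] [Algebra k H]

/-- The linear map underlying an algebra antihomomorphism. -/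
def antiLin (σ : H →ₐ[k] Hᵐᵒᵖ) : H →ₗ[k] H :=
  (MulOpposite.opLinearEquiv k).symm.toLinearMap ∘ₗ σ.toLinearMap

theorem antiLin_mul (σ : H →ₐ[k] Hᵐᵒᵖ) (g h : H) :
    antiLin σ (g * h) = antiLin σ h * antiLin σ g := by
  simp [antiLin]

theorem antiLin_one (σ : H →ₐ[k] Hᵐᵒᵖ) : antiLin σ 1 = 1 := by
  simp [antiLin]

theorem mul'_rTensor_mul_tmul (t : H ⊗[k] H) (a b : H) :
    LinearMap.mul' k H ((antiLin σ).rTensor H (t * (a ⊗ₜ[k] b))) =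
      antiLin σ a * LinearMap.mul' k H ((antiLin σ).rTensor H t) * b := by
  induction t using TensorProduct.induction_on with
  | zero => simp
  | add x y hx hy => simp only [map_add, add_mul, mul_add, hx, hy]
  | tmul x y => simp [antiLin_mul, mul_assoc]

/-- An algebra antihomomorphism satisfying the two axioms `h₁ S(h₂) = ε_t(h)` and
`S(h₁) h₂ = ε_s(h)` of an antipode. -/
structure IsAntipode [WeakBialgebra k H] (σ : H →ₐ[k] Hᵐᵒᵖ) : Prop where
  mul_right : ∀ h : H, LinearMap.mul' k H ((antiLin σ).lTensor H (comul (R := k) h)) =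
    targetMap k H h
  mul_left : ∀ h : H, LinearMap.mul' k H ((antiLin σ).rTensor H (comul (R := k) h)) =
    sourceMap k H h

namespace IsAntipode

variable [WeakBialgebra k H] {σ : H →ₐ[k] Hᵐᵒᵖ} (hσ : IsAntipode σ)
include hσ

/-- The linear map `a ⊗ b ↦ S(a) 1₁ b ⊗ 1₂` takes `Δ(h)` to `1₁ ⊗ ε_t(h 1₂)`. This makes the
evaluation `φ ⊗ v ↦ φ(1₁ v) 1₂` a module map. -/
theorem conj_comul {F : H ⊗[k] H →ₗ[k] H ⊗[k] H}
    (hF : ∀ a b, F (a ⊗ₜ[k] b) = (antiLin σ a ⊗ₜ[k] 1) * comul (R := k) 1 * (b ⊗ₜ[k] 1)) (h : H) :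
    F (comul (R := k) h) = (targetMap k H).lTensor H ((1 ⊗ₜ[k] h) * comul (R := k) 1) := by
  let G : H ⊗[k] (H ⊗[k] H) →ₗ[k] H ⊗[k] H :=
    (LinearMap.mul' k H).rTensor H ∘ₗ (TensorProduct.assoc k H H H).symm.toLinearMap ∘ₗ
      (antiLin σ).rTensor (H ⊗[k] H)
  have hG : ∀ a t, G (a ⊗ₜ[k] t) = (antiLin σ a ⊗ₜ[k] 1) * t := by
    intro a t
    induction t using TensorProduct.induction_on with
    | zero => simp
    | add x y hx hy => simp only [map_add, TensorProduct.tmul_add, mul_add, hx, hy]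
    | tmul x y => simp [G]
  have h1 : ∀ t : H ⊗[k] H, F t =
      G (((targetMap k H).lTensor H).lTensor H (comul.lTensor H t)) := by
    intro t
    induction t using TensorProduct.induction_on with
    | zero => simp
    | add x y hx hy => simp only [map_add, hx, hy]
    | tmul x y =>
      rw [hF, LinearMap.lTensor_tmul, LinearMap.lTensor_tmul, hG, lTensor_targetMap_comul,
        mul_assoc]
  have h2 : ∀ t : H ⊗[k] H, G (((targetMap k H).lTensor H).lTensor H
      (TensorProduct.assoc k H H H (comul.rTensor H t))) =
      (targetMap k H).lTensor H ((sourceMap k H).rTensor H t) := by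
    intro t
    induction t using TensorProduct.induction_on with
    | zero => simp
    | add x y hx hy => simp only [map_add, hx, hy]
    | tmul x y =>
      rw [LinearMap.rTensor_tmul, LinearMap.rTensor_tmul, LinearMap.lTensor_tmul,
        ← hσ.mul_left x]
      induction comul (R := k) x using TensorProduct.induction_on with
      | zero => simp
      | add x y hx hy => simp only [map_add, TensorProduct.add_tmul, hx, hy]
      | tmul a b => simp [hG]
  rw [h1, ← coassoc_apply, h2, rTensor_sourceMap_comul]

/-- The map `a ⊗ b ↦ a z S(b)` takes `Δ(h)` to `ε_t(h z)`, for `z` in the target subalgebra. -/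
theorem sandwich_comul {F : H ⊗[k] H →ₗ[k] H} {z : H} (hz : z ∈ LinearMap.range (targetMap k H))
    (hF : ∀ a b, F (a ⊗ₜ[k] b) = a * z * antiLin σ b) (h : H) :
    F (comul (R := k) h) = targetMap k H (h * z) := by
  rw [← hσ.mul_right, comul_mul_target h hz]
  induction comul (R := k) h using TensorProduct.induction_on with
  | zero => simp
  | add x y hx hy => simp only [map_add, add_mul, hx, hy]
  | tmul a b => simp [hF]

/-- The antipode is inverse to `z ↦ z̄` on the target subalgebra. -/
theorem antiLin_barMap {z : H} (hz : z ∈ LinearMap.range (targetMap k H)) :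
    antiLin σ (barMap k H z) = z := by
  have h1 := congrArg (fun t => LinearMap.mul' k H ((antiLin σ).rTensor H t)) (comul_one_bar hz)
  simpa [mul'_rTensor_mul_tmul, hσ.mul_left, sourceMap_one, antiLin_one] using h1

theorem isWeakHopf : IsWeakHopf k H := by
  refine ⟨antiLin σ, LinearMap.ext hσ.mul_right, LinearMap.ext hσ.mul_left, LinearMap.ext fun h => ?_⟩
  have h1 : LinearMap.mul' k H ∘ₗ (antiLin σ).lTensor H ∘ₗ comul = targetMap k H :=
    LinearMap.ext hσ.mul_right
  rw [h1, LinearMap.comp_apply, LinearMap.comp_apply, ← LinearMap.rTensor_comp_lTensor,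
    LinearMap.comp_apply, lTensor_targetMap_comul, mul'_rTensor_mul_tmul, hσ.mul_left,
    sourceMap_one, mul_one, mul_one]

end IsAntipode

end Antipode

section Dual

/-- The dual of a module, on which `h` acts as the transpose of the action of `S(h)`, for an
algebra antihomomorphism `S`. -/
def DualRep {k H : Type*} [Field k] [Ring H] [Algebra k H] (_ : H →ₐ[k] Hᵐᵒᵖ) (V : Type*)
    [AddCommGroup V] [Module k V] : Type _ := Module.Dual k V

variable {k : Type*} {H : Type*} [Field k] [Ring H] [Algebra k H] (σ : H →ₐ[k] Hᵐᵒᵖ)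
  (V : Type*) [AddCommGroup V] [Module k V] [Module H V] [IsScalarTower k H V]

namespace DualRep

noncomputable instance : AddCommGroup (DualRep σ V) := inferInstanceAs (AddCommGroup (Module.Dual k V))

noncomputable instance : Module k (DualRep σ V) := inferInstanceAs (Module k (Module.Dual k V))

instance [Module.Finite k V] : Module.Finite k (DualRep σ V) :=
  inferInstanceAs (Module.Finite k (Module.Dual k V))

variable {σ V}

/-- The value of a linear form at a vector. -/
def val (φ : DualRep σ V) : V →ₗ[k] k := φ

theorem ext {φ ψ : DualRep σ V} (h : ∀ v, val φ v = val ψ v) : φ = ψ := LinearMap.ext h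

theorem val_add (φ ψ : DualRep σ V) (v : V) : val (φ + ψ) v = val φ v + val ψ v := rfl

theorem val_smul_base (c : k) (φ : DualRep σ V) (v : V) : val (c • φ) v = c * val φ v := rfl

theorem val_zero (v : V) : val (0 : DualRep σ V) v = 0 := rfl

noncomputable instance : SMul H (DualRep σ V) where
  smul h φ := (val φ ∘ₗ Algebra.lsmul k k V (antiLin σ h) : V →ₗ[k] k)

theorem val_smul (h : H) (φ : DualRep σ V) (v : V) : val (h • φ) v = val φ (antiLin σ h • v) := rfl

noncomputable instance : Module H (DualRep σ V) where
  one_smul φ := ext fun v => by rw [val_smul, antiLin_one, one_smul]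
  mul_smul g h φ := ext fun v => by simp only [val_smul, antiLin_mul, mul_smul]
  smul_zero h := rfl
  smul_add h φ ψ := rfl
  add_smul g h φ := ext fun v => by simp only [val_smul, val_add, map_add, add_smul]
  zero_smul φ := ext fun v => by simp only [val_smul, val_zero, map_zero, zero_smul]

instance : IsScalarTower k H (DualRep σ V) where
  smul_assoc c h φ := ext fun v => by
    simp only [val_smul, val_smul_base, map_smul, smul_assoc, smul_eq_mul]

variable (σ V)

/-- The identification of `V ⊗ V*` with the endomorphisms of `V`. -/
noncomputable def toEnd [Module.Finite k V] : V ⊗[k] DualRep σ V ≃ₗ[k] Module.End k V :=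
  (TensorProduct.comm k V (Module.Dual k V)).trans (dualTensorHomEquiv k V V)

variable {σ V}

theorem toEnd_tmul [Module.Finite k V] (v : V) (φ : DualRep σ V) (u : V) :
    toEnd σ V (v ⊗ₜ[k] φ) u = val φ u • v := by
  simp [toEnd, dualTensorHomEquiv]
  rfl

theorem toEnd_act [Module.Finite k V] (a b : H) (x : V ⊗[k] DualRep σ V) (u : V) :
    toEnd σ V (act k H V (DualRep σ V) (a ⊗ₜ[k] b) x) u =
      a • toEnd σ V x (antiLin σ b • u) := by
  induction x using TensorProduct.induction_on with
  | zero => simp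
  | add x y hx hy => simp only [map_add, LinearMap.add_apply, hx, hy, smul_add]
  | tmul v φ =>
    rw [act_tmul, toEnd_tmul, toEnd_tmul, val_smul, smul_comm]

end DualRep

variable [WeakBialgebra k H] {σ V}

/-- The element of `V ⊗ V*` corresponding to the action of `h` on `V`. -/
noncomputable def coevFull (σ : H →ₐ[k] Hᵐᵒᵖ) (V : Type*) [AddCommGroup V] [Module k V]
    [Module H V] [IsScalarTower k H V] [Module.Finite k V] : H →ₗ[k] V ⊗[k] DualRep σ V :=
  (DualRep.toEnd σ V).symm.toLinearMap ∘ₗ (Algebra.lsmul k k V).toLinearMap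

theorem toEnd_coevFull [Module.Finite k V] (h : H) (u : V) :
    DualRep.toEnd σ V (coevFull σ V h) u = h • u := by
  simp [coevFull]

theorem act_coevFull [Module.Finite k V] (hσ : IsAntipode σ) (h : H) {z : H}
    (hz : z ∈ LinearMap.range (targetMap k H)) :
    act k H V (DualRep σ V) (comul (R := k) h) (coevFull σ V z) =
      coevFull σ V (targetMap k H (h * z)) := by
  let F : H ⊗[k] H →ₗ[k] H :=
    LinearMap.mul' k H ∘ₗ TensorProduct.map (LinearMap.mulRight k z) (antiLin σ)
  rw [← hσ.sandwich_comul (F := F) hz (fun a b => rfl) h]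
  induction comul (R := k) h using TensorProduct.induction_on with
  | zero => simp
  | add x y hx hy => simp only [map_add, LinearMap.add_apply, hx, hy]
  | tmul a b =>
    apply (DualRep.toEnd σ V).injective
    refine LinearMap.ext fun u => ?_
    rw [DualRep.toEnd_act, toEnd_coevFull, toEnd_coevFull]
    simp [F, mul_smul]

/-- The coevaluation `H_t → V ⊗ V*`. -/
noncomputable def coevMap [Module.Finite k V] (hσ : IsAntipode σ) :
    UnitRep k H →ₗ[H] TensorRep k H V (DualRep σ V) where
  toFun z := proj k H V (DualRep σ V) (coevFull σ V (UnitRep.val z))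
  map_add' x y := by simp only [map_add]
  map_smul' h z := incl_injective (by
    rw [RingHom.id_apply, incl_smul, incl_proj, incl_proj, act_mul_apply, comul_mul_one,
      act_coevFull hσ h (UnitRep.val_mem z), UnitRep.val_smul,
      act_coevFull hσ 1 ⟨_, rfl⟩, one_mul, targetMap_targetMap])

theorem incl_coevMap [Module.Finite k V] (hσ : IsAntipode σ) (z : UnitRep k H) :
    incl k H V (DualRep σ V) (coevMap hσ z) = coevFull σ V (UnitRep.val z) := by
  refine (act_coevFull hσ 1 (UnitRep.val_mem z)).trans ?_
  rw [one_mul, targetMap_eq_of_mem (UnitRep.val_mem z)]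

/-- The linear map `φ ⊗ v ↦ φ(x v) ε_t(y)`. -/
noncomputable def pairing (σ : H →ₐ[k] Hᵐᵒᵖ) (V : Type*) [AddCommGroup V] [Module k V]
    [Module H V] [IsScalarTower k H V] (φ : DualRep σ V) (v : V) : H ⊗[k] H →ₗ[k] UnitRep k H :=
  (TensorProduct.lid k (UnitRep k H)).toLinearMap ∘ₗ
    TensorProduct.map (DualRep.val φ ∘ₗ (Algebra.lsmul k k V).toLinearMap.flip v) UnitRep.mk

theorem pairing_tmul (φ : DualRep σ V) (v : V) (x y : H) :
    pairing σ V φ v (x ⊗ₜ[k] y) = DualRep.val φ (x • v) • UnitRep.mk (k := k) y := by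
  simp [pairing]

/-- The linear map `φ ⊗ v ↦ φ(1₁ v) 1₂`. -/
noncomputable def evFull (σ : H →ₐ[k] Hᵐᵒᵖ) (V : Type*) [AddCommGroup V] [Module k V]
    [Module H V] [IsScalarTower k H V] : DualRep σ V ⊗[k] V →ₗ[k] UnitRep k H :=
  TensorProduct.lift (LinearMap.mk₂ k (fun φ v => pairing σ V φ v (comul (R := k) 1))
    (fun φ ψ v => by
      induction comul (R := k) (1 : H) using TensorProduct.induction_on with
      | zero => simp
      | add x y hx hy => simp only [map_add, hx, hy]; abel
      | tmul a b => simp [pairing_tmul, DualRep.val_add, add_smul])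
    (fun c φ v => by
      induction comul (R := k) (1 : H) using TensorProduct.induction_on with
      | zero => simp
      | add x y hx hy => simp only [map_add, hx, hy, smul_add]
      | tmul a b => simp [pairing_tmul, DualRep.val_smul_base, mul_smul])
    (fun φ v w => by
      induction comul (R := k) (1 : H) using TensorProduct.induction_on with
      | zero => simp
      | add x y hx hy => simp only [map_add, hx, hy]; abel
      | tmul a b => simp [pairing_tmul, add_smul])
    (fun c φ v => by
      induction comul (R := k) (1 : H) using TensorProduct.induction_on with
      | zero => simp
      | add x y hx hy => simp only [map_add, hx, hy, smul_add]
      | tmul a b => simp [pairing_tmul, smul_comm a c, mul_smul]))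

theorem evFull_tmul (φ : DualRep σ V) (v : V) :
    evFull σ V (φ ⊗ₜ[k] v) = pairing σ V φ v (comul (R := k) 1) := rfl

theorem evFull_act (hσ : IsAntipode σ) (h : H) (x : DualRep σ V ⊗[k] V) :
    evFull σ V (act k H (DualRep σ V) V (comul (R := k) h) x) = h • evFull σ V x := by
  induction x using TensorProduct.induction_on with
  | zero => simp
  | add x y hx hy => simp only [map_add, hx, hy, smul_add]
  | tmul φ v =>
    let F : H ⊗[k] H →ₗ[k] H ⊗[k] H := TensorProduct.lift
      ((LinearMap.mul k (H ⊗[k] H)).compl₁₂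
        (LinearMap.mulRight k (comul (R := k) (1 : H)) ∘ₗ
          (TensorProduct.mk k H H).flip 1 ∘ₗ antiLin σ) ((TensorProduct.mk k H H).flip 1))
    have h1 : ∀ t : H ⊗[k] H, evFull σ V (act k H (DualRep σ V) V t (φ ⊗ₜ[k] v)) =
        pairing σ V φ v (F t) := by
      intro t
      induction t using TensorProduct.induction_on with
      | zero => simp
      | add x y hx hy => simp only [map_add, LinearMap.add_apply, hx, hy]
      | tmul a b =>
        rw [act_tmul, evFull_tmul]
        simp only [F, TensorProduct.lift.tmul, LinearMap.compl₁₂_apply, LinearMap.mul_apply',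
          LinearMap.comp_apply, LinearMap.flip_apply, TensorProduct.mk_apply,
          LinearMap.mulRight_apply]
        induction comul (R := k) (1 : H) using TensorProduct.induction_on with
        | zero => simp
        | add x y hx hy => simp only [map_add, mul_add, add_mul, hx, hy]
        | tmul x y => simp [pairing_tmul, DualRep.val_smul, mul_smul]
    rw [h1, hσ.conj_comul (F := F) (fun a b => rfl) h, evFull_tmul]
    induction comul (R := k) (1 : H) using TensorProduct.induction_on with
    | zero => simp
    | add x y hx hy => simp only [map_add, mul_add, smul_add, hx, hy]
    | tmul x y =>
      have h2 : UnitRep.mk (k := k) (targetMap k H (h * y)) = h • UnitRep.mk y :=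
        UnitRep.val_injective (by
          rw [UnitRep.val_smul, UnitRep.val_mk, UnitRep.val_mk, targetMap_targetMap,
            targetMap_mul_targetMap])
      simp [pairing_tmul, h2, smul_comm h]

/-- The evaluation `V* ⊗ V → H_t`. -/
noncomputable def evMap (hσ : IsAntipode σ) :
    TensorRep k H (DualRep σ V) V →ₗ[H] UnitRep k H where
  toFun x := evFull σ V (incl k H (DualRep σ V) V x)
  map_add' x y := by simp only [map_add]
  map_smul' h x := by rw [incl_smul, evFull_act hσ, RingHom.id_apply]

/-- The core of the first zigzag identity: the left side is `∑ b z 1₁ v` with `b` the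
value of `barMap` at `1₂`, the element `1₁` commutes with `z`, and `∑ b 1₁ = 1`. -/
theorem rightAct_evFull [Module.Finite k V] (z : UnitRep k H) (v : V) :
    rightAct k H V ((evFull σ V).lTensor V
      (TensorProduct.assoc k V (DualRep σ V) V (coevFull σ V (UnitRep.val z) ⊗ₜ[k] v))) =
      UnitRep.val z • v := by
  obtain ⟨s, hs⟩ := exists_repr_one (k := k) (H := H)
  have h1 : ∀ τ : V ⊗[k] DualRep σ V, rightAct k H V ((evFull σ V).lTensor V
      (TensorProduct.assoc k V (DualRep σ V) V (τ ⊗ₜ[k] v))) =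
      ∑ i ∈ s, barMap k H i.2 • DualRep.toEnd σ V τ (i.1 • v) := by
    intro τ
    induction τ using TensorProduct.induction_on with
    | zero => simp
    | add x y hx hy =>
      simp only [map_add, TensorProduct.add_tmul, LinearMap.add_apply, smul_add,
        Finset.sum_add_distrib, hx, hy]
    | tmul w φ =>
      rw [TensorProduct.assoc_tmul, LinearMap.lTensor_tmul, evFull_tmul, ← hs]
      simp [pairing_tmul, TensorProduct.tmul_sum, UnitRep.val_mk, barMap_targetMap,
        DualRep.toEnd_tmul, smul_comm (barMap k H _)]
  rw [h1]
  simp only [toEnd_coevFull]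
  have h2 := congrArg (fun t => LinearMap.mul' k H ((barMap k H).rTensor H
    (TensorProduct.comm k H H t)) • v) (comul_one_comm_target (UnitRep.val_mem z))
  have h3 := rightAct_act (k := k) (1 : H) ((UnitRep.val z • v) ⊗ₜ[k] (1 : UnitRep k H))
  have h4 := comul_one_comm_target (UnitRep.val_mem z)
  rw [← hs] at h2 h3
  simp only [one_smul, rightAct_tmul, UnitRep.val_one, barMap_one hs] at h3
  rw [← h3]
  simp only [Finset.mul_sum, Finset.sum_mul, Algebra.TensorProduct.tmul_mul_tmul, one_mul, mul_one,
    map_sum, TensorProduct.comm_tmul, LinearMap.rTensor_tmul, LinearMap.mul'_apply,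
    Finset.sum_smul, mul_smul] at h2
  rw [h2]
  simp [UnitRep.val_smul, UnitRep.val_one, barMap_targetMap]

/-- The core of the second zigzag identity: it comes down to `∑ 1₁ z S(1₂) = z` and to the fact that
the antipode inverts `z ↦ z̄`. -/
theorem leftAct_evFull [Module.Finite k V] (hσ : IsAntipode σ) (z : UnitRep k H)
    (φ : DualRep σ V) :
    leftAct k H (DualRep σ V) ((evFull σ V).rTensor (DualRep σ V)
      ((TensorProduct.assoc k (DualRep σ V) V (DualRep σ V)).symm
        (φ ⊗ₜ[k] coevFull σ V (UnitRep.val z)))) =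
      barMap k H (UnitRep.val z) • φ := by
  obtain ⟨s, hs⟩ := exists_repr_one (k := k) (H := H)
  refine DualRep.ext fun u => ?_
  rw [DualRep.val_smul, hσ.antiLin_barMap (UnitRep.val_mem z)]
  have h1 : ∀ τ : V ⊗[k] DualRep σ V, DualRep.val (leftAct k H (DualRep σ V)
      ((evFull σ V).rTensor (DualRep σ V)
      ((TensorProduct.assoc k (DualRep σ V) V (DualRep σ V)).symm (φ ⊗ₜ[k] τ)))) u =
      ∑ i ∈ s, DualRep.val φ (i.1 • DualRep.toEnd σ V τ (antiLin σ (targetMap k H i.2) • u)) := by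
    intro τ
    induction τ using TensorProduct.induction_on with
    | zero => simp [DualRep.val_zero]
    | add x y hx hy =>
      simp only [map_add, TensorProduct.tmul_add, LinearMap.add_apply, smul_add,
        Finset.sum_add_distrib, hx, hy, DualRep.val_add]
    | tmul w ψ =>
      have h2 : ∀ (t : Finset (H × H)) (f : H × H → DualRep σ V),
          DualRep.val (∑ i ∈ t, f i) u = ∑ i ∈ t, DualRep.val (f i) u := fun t f =>
        LinearMap.sum_apply t f u
      rw [TensorProduct.assoc_symm_tmul, LinearMap.rTensor_tmul, evFull_tmul, ← hs]
      simp [pairing_tmul, TensorProduct.sum_tmul, UnitRep.val_mk, h2, DualRep.val_smul_base,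
        DualRep.val_smul, DualRep.toEnd_tmul, smul_comm _ (DualRep.val ψ _), mul_comm]
  rw [h1]
  have h2 := lTensor_targetMap_comul (k := k) (1 : H)
  have h3 : LinearMap.mul' k H (TensorProduct.map (LinearMap.mulRight k (UnitRep.val z))
      (antiLin σ) (comul (R := k) 1)) = UnitRep.val z := by
    refine (hσ.sandwich_comul (F := LinearMap.mul' k H ∘ₗ TensorProduct.map
      (LinearMap.mulRight k (UnitRep.val z)) (antiLin σ)) (UnitRep.val_mem z)
      (fun a b => rfl) 1).trans ?_
    rw [one_mul, targetMap_eq_of_mem (UnitRep.val_mem z)]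
  rw [← Algebra.TensorProduct.one_def, mul_one] at h2
  rw [← h2, ← hs] at h3
  conv_rhs => rw [← h3]
  simp [toEnd_coevFull, Finset.sum_smul, mul_smul]

theorem right_zigzag [Module.Finite k V] (hσ : IsAntipode σ) (x : TensorRep k H (UnitRep k H) V) :
    rightUnitEquiv k H V (tensorMap LinearMap.id (evMap hσ)
      (assocEquiv k H V (DualRep σ V) V (tensorMap (coevMap hσ) LinearMap.id x))) =
      leftUnitEquiv k H V x := by
  rw [rightUnitEquiv_apply, leftUnitEquiv_apply, incl_tensorMap]
  have h1 : ∀ y : V ⊗[k] TensorRep k H (DualRep σ V) V,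
      TensorProduct.map ((LinearMap.id : V →ₗ[H] V).restrictScalars k)
        ((evMap hσ).restrictScalars k) y =
      (evFull σ V).lTensor V ((incl k H (DualRep σ V) V).lTensor V y) := by
    intro y
    induction y using TensorProduct.induction_on with
    | zero => simp
    | add x y hx hy => simp only [map_add, hx, hy]
    | tmul v y => rfl
  rw [h1]
  have h2 := inclR_assocEquiv (tensorMap (coevMap (V := V) hσ) (LinearMap.id : V →ₗ[H] V) x)
  simp only [inclR, inclL, LinearMap.comp_apply, incl_tensorMap] at h2
  rw [h2]
  induction incl k H (UnitRep k H) V x using TensorProduct.induction_on with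
  | zero => simp
  | add x y hx hy => simp only [map_add, hx, hy]
  | tmul z v =>
    rw [TensorProduct.map_tmul, LinearMap.rTensor_tmul]
    simp only [LinearMap.restrictScalars_apply, LinearMap.id_apply]
    rw [incl_coevMap, rightAct_evFull, leftAct_tmul]

theorem left_zigzag [Module.Finite k V] (hσ : IsAntipode σ)
    (x : TensorRep k H (DualRep σ V) (UnitRep k H)) :
    leftUnitEquiv k H (DualRep σ V) (tensorMap (evMap hσ) LinearMap.id
      ((assocEquiv k H (DualRep σ V) V (DualRep σ V)).symm
        (tensorMap LinearMap.id (coevMap hσ) x))) =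
      rightUnitEquiv k H (DualRep σ V) x := by
  rw [rightUnitEquiv_apply, leftUnitEquiv_apply, incl_tensorMap]
  have h1 : ∀ y : TensorRep k H (DualRep σ V) V ⊗[k] DualRep σ V,
      TensorProduct.map ((evMap hσ).restrictScalars k)
        ((LinearMap.id : DualRep σ V →ₗ[H] DualRep σ V).restrictScalars k) y =
      (evFull σ V).rTensor (DualRep σ V) ((incl k H (DualRep σ V) V).rTensor (DualRep σ V) y) := by
    intro y
    induction y using TensorProduct.induction_on with
    | zero => simp
    | add x y hx hy => simp only [map_add, hx, hy]
    | tmul v y => rfl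
  rw [h1]
  have h2 := inclR_assocEquiv ((assocEquiv k H (DualRep σ V) V (DualRep σ V)).symm
    (tensorMap (LinearMap.id : DualRep σ V →ₗ[H] DualRep σ V) (coevMap (V := V) hσ) x))
  rw [LinearEquiv.apply_symm_apply, ← LinearEquiv.symm_apply_eq] at h2
  simp only [inclR, inclL, LinearMap.comp_apply, incl_tensorMap] at h2
  rw [← h2]
  induction incl k H (DualRep σ V) (UnitRep k H) x using TensorProduct.induction_on with
  | zero => simp
  | add x y hx hy => simp only [map_add, hx, hy]
  | tmul φ z =>
    rw [TensorProduct.map_tmul, LinearMap.lTensor_tmul]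
    simp only [LinearMap.restrictScalars_apply, LinearMap.id_apply]
    rw [incl_coevMap, leftAct_evFull hσ, rightAct_tmul]

/-- The canonical isomorphism of `V` with its double dual, for mutually inverse
antihomomorphisms. -/
noncomputable def doubleDualEquiv [Module.Finite k V] {τ : H →ₐ[k] Hᵐᵒᵖ}
    (h : ∀ a, antiLin τ (antiLin σ a) = a) : V ≃ₗ[H] DualRep σ (DualRep τ V) where
  toFun v := Module.evalEquiv k V v
  invFun := (Module.evalEquiv k V).symm
  left_inv := (Module.evalEquiv k V).left_inv
  right_inv := (Module.evalEquiv k V).right_inv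
  map_add' := (Module.evalEquiv k V).map_add
  map_smul' a v := by
    have key : ∀ φ : DualRep τ V, DualRep.val φ (a • v) = DualRep.val (antiLin σ a • φ) v := by
      intro φ
      rw [DualRep.val_smul, h]
    exact LinearMap.ext key

end Dual

end WeakBialgebra

/-! ### Semisimplicity of groupoid algebras -/

namespace SetGroupoid

section Inverse

variable {P G : Type*} {𝒢 : SetGroupoid P G}

theorem comp_inv_comp {a b : G} (h : 𝒢.tgt a = 𝒢.src b) :
    𝒢.comp (𝒢.inv (𝒢.comp a b)) a = 𝒢.inv b := by
  have h1 : 𝒢.tgt (𝒢.inv (𝒢.comp a b)) = 𝒢.src a := by rw [𝒢.tgt_inv, 𝒢.src_comp _ _ h]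
  refine right_cancel (a := b) ?_ (𝒢.tgt_inv b) ?_
  · rw [𝒢.tgt_comp _ _ h1, h]
  · rw [𝒢.assoc _ _ _ h1 h, 𝒢.inv_comp, 𝒢.inv_comp, 𝒢.tgt_comp _ _ h]

theorem inv_eq_of_comp_eq_one {a b : G} {p : P} (h : 𝒢.tgt a = 𝒢.src b)
    (h' : 𝒢.comp a b = 𝒢.one p) : 𝒢.inv a = b := by
  have h1 : p = 𝒢.src a := by rw [← 𝒢.src_comp _ _ h, h', 𝒢.src_one]
  refine left_cancel (a := a) (𝒢.src_inv a).symm h ?_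
  rw [𝒢.comp_inv, h', h1]

theorem inv_inv (a : G) : 𝒢.inv (𝒢.inv a) = a :=
  inv_eq_of_comp_eq_one (𝒢.tgt_inv a) (𝒢.inv_comp a)

theorem inv_one (p : P) : 𝒢.inv (𝒢.one p) = 𝒢.one p :=
  inv_eq_of_comp_eq_one (p := p) (by rw [𝒢.tgt_one, 𝒢.src_one]) (one_comp' (𝒢.src_one p))

theorem inv_comp_rev {a b : G} (h : 𝒢.tgt a = 𝒢.src b) :
    𝒢.inv (𝒢.comp a b) = 𝒢.comp (𝒢.inv b) (𝒢.inv a) := by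
  have h1 : 𝒢.tgt (𝒢.inv b) = 𝒢.src (𝒢.inv a) := by rw [𝒢.tgt_inv, 𝒢.src_inv, h]
  have h2 : 𝒢.tgt b = 𝒢.src (𝒢.comp (𝒢.inv b) (𝒢.inv a)) := by
    rw [𝒢.src_comp _ _ h1, 𝒢.src_inv]
  refine inv_eq_of_comp_eq_one (p := 𝒢.src a) (by rw [𝒢.tgt_comp _ _ h, h2]) ?_
  rw [𝒢.assoc _ _ _ h h2, comp_inv_cancel (by rw [𝒢.src_inv, h]), 𝒢.comp_inv]

end Inverse

namespace Alg

variable {P G : Type*} {𝒢 : SetGroupoid P G} [Fintype P] [Fintype G] {k : Type*} [Field k]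

open scoped Classical in
theorem card_filter_tgt (a : G) :
    (Finset.univ.filter fun c => 𝒢.tgt c = 𝒢.tgt a).card =
      (Finset.univ.filter fun c => 𝒢.src c = 𝒢.src a).card := by
  refine Finset.card_nbij' (fun c => 𝒢.comp a (𝒢.inv c))
    (fun d => 𝒢.comp (𝒢.inv d) a) ?_ ?_ ?_ ?_
  · intro c hc
    simp only [Finset.coe_filter, Finset.mem_univ, true_and, Set.mem_ofPred_eq] at hc ⊢
    exact 𝒢.src_comp _ _ (by rw [𝒢.src_inv, hc])
  · intro c hc
    simp only [Finset.coe_filter, Finset.mem_univ, true_and, Set.mem_ofPred_eq] at hc ⊢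
    exact 𝒢.tgt_comp _ _ (by rw [𝒢.tgt_inv, hc])
  · intro c hc
    simp only [Finset.coe_filter, Finset.mem_univ, true_and, Set.mem_ofPred_eq] at hc ⊢
    rw [comp_inv_comp (by rw [𝒢.src_inv, hc]), inv_inv]
  · intro c hc
    simp only [Finset.coe_filter, Finset.mem_univ, true_and, Set.mem_ofPred_eq] at hc ⊢
    have h : 𝒢.tgt (𝒢.inv c) = 𝒢.src a := by rw [𝒢.tgt_inv, hc]
    rw [inv_comp_rev h, inv_inv, comp_inv_cancel hc.symm]

open scoped Classical in
/-- The inverse of the number of arrows with the same target as `a`. It depends only on the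
connected component of `a`. -/
noncomputable def averageWeight (𝒢 : SetGroupoid P G) (k : Type*) [Field k] (a : G) : k :=
  ((Finset.univ.filter fun c => 𝒢.tgt c = 𝒢.tgt a).card : k)⁻¹

open scoped Classical in
theorem sum_averageWeight [CharZero k] (p : P) :
    ∑ a with 𝒢.src a = p, averageWeight 𝒢 k a = 1 := by
  have h1 : ∀ a ∈ Finset.univ.filter (fun a => 𝒢.src a = p), averageWeight 𝒢 k a =
      ((Finset.univ.filter fun c => 𝒢.src c = p).card : k)⁻¹ := by
    intro a ha
    rw [averageWeight, card_filter_tgt, (Finset.mem_filter.1 ha).2]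
  rw [Finset.sum_congr rfl h1, Finset.sum_const, nsmul_eq_mul, mul_inv_cancel₀]
  exact Nat.cast_ne_zero.2 (Finset.card_ne_zero.2
    ⟨𝒢.one p, Finset.mem_filter.2 ⟨Finset.mem_univ _, 𝒢.src_one p⟩⟩)

variable {V W : Type*} [AddCommGroup V] [Module k V] [Module (𝒢.Alg k) V]
  [IsScalarTower k (𝒢.Alg k) V] [AddCommGroup W] [Module k W] [Module (𝒢.Alg k) W]
  [IsScalarTower k (𝒢.Alg k) W]

/-- The average `∑ w(a) a π a⁻¹` of a linear map. -/
noncomputable def average (π : V →ₗ[k] W) : V →ₗ[k] W :=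
  ∑ a, averageWeight 𝒢 k a • (Algebra.lsmul k k W (e 𝒢 a : 𝒢.Alg k) ∘ₗ π ∘ₗ
    Algebra.lsmul k k V (e 𝒢 (𝒢.inv a) : 𝒢.Alg k))

theorem average_apply (π : V →ₗ[k] W) (v : V) : average (𝒢 := 𝒢) π v =
    ∑ a, averageWeight 𝒢 k a • (e 𝒢 a : 𝒢.Alg k) • π ((e 𝒢 (𝒢.inv a) : 𝒢.Alg k) • v) := by
  simp [average]

theorem average_smul_e (π : V →ₗ[k] W) (b : G) (v : V) :
    average (𝒢 := 𝒢) π ((e 𝒢 b : 𝒢.Alg k) • v) = (e 𝒢 b : 𝒢.Alg k) • average (𝒢 := 𝒢) π v := by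
  classical
  rw [average_apply, average_apply, Finset.smul_sum]
  have h1 : ∀ c, averageWeight 𝒢 k c • (e 𝒢 c : 𝒢.Alg k) •
      π ((e 𝒢 (𝒢.inv c) : 𝒢.Alg k) • (e 𝒢 b : 𝒢.Alg k) • v) =
      if 𝒢.src c = 𝒢.src b then averageWeight 𝒢 k c • (e 𝒢 c : 𝒢.Alg k) •
        π ((e 𝒢 (𝒢.comp (𝒢.inv c) b) : 𝒢.Alg k) • v) else 0 := by
    intro c
    rw [← mul_smul, e_mul_e, 𝒢.tgt_inv]
    split_ifs
    · rfl
    · rw [zero_smul, map_zero, smul_zero, smul_zero]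
  have h2 : ∀ a, (e 𝒢 b : 𝒢.Alg k) • averageWeight 𝒢 k a • (e 𝒢 a : 𝒢.Alg k) •
      π ((e 𝒢 (𝒢.inv a) : 𝒢.Alg k) • v) =
      if 𝒢.tgt b = 𝒢.src a then averageWeight 𝒢 k a • (e 𝒢 (𝒢.comp b a) : 𝒢.Alg k) •
        π ((e 𝒢 (𝒢.inv a) : 𝒢.Alg k) • v) else 0 := by
    intro a
    rw [smul_comm, ← mul_smul, e_mul_e]
    split_ifs
    · rfl
    · rw [zero_smul, smul_zero]
  simp only [h1, h2, ← Finset.sum_filter]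
  -- The substitution `c = b a`; the weight of `a` depends only on its target.
  refine Finset.sum_nbij' (fun c => 𝒢.comp (𝒢.inv b) c) (fun a => 𝒢.comp b a) ?_ ?_ ?_ ?_ ?_
  · intro c hc
    rw [Finset.mem_filter] at hc ⊢
    exact ⟨Finset.mem_univ _, by rw [𝒢.src_comp _ _ ((𝒢.tgt_inv b).trans hc.2.symm), 𝒢.src_inv]⟩
  · intro a ha
    rw [Finset.mem_filter] at ha ⊢
    exact ⟨Finset.mem_univ _, 𝒢.src_comp _ _ ha.2⟩
  · intro c hc
    exact comp_inv_cancel (Finset.mem_filter.1 hc).2.symm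
  · intro a ha
    exact inv_comp_cancel (Finset.mem_filter.1 ha).2
  · intro c hc
    have h3 : 𝒢.src b = 𝒢.src c := (Finset.mem_filter.1 hc).2.symm
    have h4 : 𝒢.tgt (𝒢.inv b) = 𝒢.src c := (𝒢.tgt_inv b).trans h3
    rw [comp_inv_cancel h3, inv_comp_rev h4, inv_inv, averageWeight, averageWeight,
      𝒢.tgt_comp _ _ h4]

/-- The average of a linear map is a module map. -/
theorem average_smul (π : V →ₗ[k] W) (x : 𝒢.Alg k) (v : V) :
    average (𝒢 := 𝒢) π (x • v) = x • average (𝒢 := 𝒢) π v := by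
  induction x using basis_induction with
  | zero => rw [zero_smul, zero_smul, map_zero]
  | add x y hx hy => rw [add_smul, add_smul, map_add, hx, hy]
  | basis c a => rw [smul_assoc, smul_assoc, map_smul, average_smul_e]

/-- The average of a linear retraction of a submodule is again a retraction. -/
theorem average_eq [CharZero k] (π : V →ₗ[k] W) (ι : W →ₗ[𝒢.Alg k] V) (h : ∀ x, π (ι x) = x)
    (x : W) : average (𝒢 := 𝒢) π (ι x) = x := by
  classical
  rw [average_apply]
  have h1 : ∀ a, averageWeight 𝒢 k a • (e 𝒢 a : 𝒢.Alg k) •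
      π ((e 𝒢 (𝒢.inv a) : 𝒢.Alg k) • ι x) =
      averageWeight 𝒢 k a • (e 𝒢 (𝒢.one (𝒢.src a)) : 𝒢.Alg k) • x := by
    intro a
    rw [← ι.map_smul, h, ← mul_smul, e_mul_e, if_pos (𝒢.src_inv a).symm, 𝒢.comp_inv]
  simp only [h1]
  rw [← Finset.sum_fiberwise (Finset.univ : Finset G) 𝒢.src]
  have h2 : ∀ p : P, ∑ a with 𝒢.src a = p, averageWeight 𝒢 k a •
      (e 𝒢 (𝒢.one (𝒢.src a)) : 𝒢.Alg k) • x = (e 𝒢 (𝒢.one p) : 𝒢.Alg k) • x := by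
    intro p
    rw [← one_smul k ((e 𝒢 (𝒢.one p) : 𝒢.Alg k) • x), ← sum_averageWeight (𝒢 := 𝒢) p,
      Finset.sum_smul]
    refine Finset.sum_congr rfl fun a ha => ?_
    rw [(Finset.mem_filter.1 ha).2]
  simp only [h2, ← Finset.sum_smul]
  rw [← one_def, one_smul]

/-- Maschke's theorem for the algebra of a finite groupoid. -/
theorem isSemisimpleRing [CharZero k] : IsSemisimpleRing (𝒢.Alg k) := by
  refine (isSemisimpleModule_iff _ _).2 ⟨fun N => ?_⟩
  obtain ⟨π, hπ⟩ := (N.subtype.restrictScalars k).exists_leftInverse_of_injective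
    (LinearMap.ker_eq_bot.2 N.injective_subtype)
  let f : 𝒢.Alg k →ₗ[𝒢.Alg k] N :=
    { toFun := average (𝒢 := 𝒢) π
      map_add' := map_add _
      map_smul' := average_smul π }
  exact ⟨_, LinearMap.isCompl_of_proj (f := f)
    (average_eq π N.subtype fun x => DFunLike.congr_fun hπ x)⟩

end Alg

end SetGroupoid

/-! ### Inverses in a double groupoid -/

namespace DoubleGroupoid

section Inverses

variable {P H V B : Type*} (T : DoubleGroupoid P H V B)

theorem top_hinv (A : B) : T.vbox.src (T.hbox.inv A) = T.hor.inv (T.vbox.src A) := by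
  have h := (T.hbox.src_inv A).symm
  refine (SetGroupoid.inv_eq_of_comp_eq_one (p := T.hor.src (T.vbox.src A)) ?_ ?_).symm
  · rw [← T.top_right, ← T.top_left, h]
  · rw [← T.top_hcomp _ _ h, T.hbox.comp_inv, T.top_hone, T.top_left]

theorem bot_hinv (A : B) : T.vbox.tgt (T.hbox.inv A) = T.hor.inv (T.vbox.tgt A) :=
  T.flip.top_hinv A

theorem left_vinv (A : B) : T.hbox.src (T.vbox.inv A) = T.ver.inv (T.hbox.src A) :=
  T.transpose.top_hinv A

theorem right_vinv (A : B) : T.hbox.tgt (T.vbox.inv A) = T.ver.inv (T.hbox.tgt A) :=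
  T.transpose.bot_hinv A

theorem hinv_vcomp {A A' : B} (h : T.vbox.tgt A = T.vbox.src A') :
    T.hbox.inv (T.vbox.comp A A') = T.vbox.comp (T.hbox.inv A) (T.hbox.inv A') := by
  have h1 : T.vbox.tgt (T.hbox.inv A) = T.vbox.src (T.hbox.inv A') := by
    rw [T.bot_hinv, T.top_hinv, h]
  refine SetGroupoid.inv_eq_of_comp_eq_one
    (p := T.ver.comp (T.hbox.src A) (T.hbox.src A')) ?_ ?_
  · rw [T.right_vcomp _ _ h, T.left_vcomp _ _ h1, T.hbox.src_inv, T.hbox.src_inv]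
  · rw [← T.interchange _ _ _ _ (T.hbox.src_inv A).symm (T.hbox.src_inv A').symm h h1,
      T.hbox.comp_inv, T.hbox.comp_inv, T.hone_comp]
    rw [T.bot_left, T.top_left, h]

theorem vinv_hcomp {A A' : B} (h : T.hbox.tgt A = T.hbox.src A') :
    T.vbox.inv (T.hbox.comp A A') = T.hbox.comp (T.vbox.inv A) (T.vbox.inv A') :=
  T.transpose.hinv_vcomp h

theorem hinv_vone (x : H) : T.hbox.inv (T.vbox.one x) = T.vbox.one (T.hor.inv x) := by
  refine SetGroupoid.inv_eq_of_comp_eq_one (p := T.ver.one (T.hor.src x)) ?_ ?_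
  · rw [T.right_vone, T.left_vone, T.hor.src_inv]
  · rw [← T.vone_comp _ _ (T.hor.src_inv x).symm, T.hor.comp_inv, T.one_one]

theorem hinv_vinv (A : B) : T.hbox.inv (T.vbox.inv A) = T.vbox.inv (T.hbox.inv A) := by
  refine (SetGroupoid.inv_eq_of_comp_eq_one (p := T.hor.inv (T.vbox.src A)) ?_ ?_).symm
  · rw [T.bot_hinv, T.top_hinv, T.vbox.src_inv]
  · rw [← T.hinv_vcomp (T.vbox.src_inv A).symm, T.vbox.comp_inv, T.hinv_vone]

/-- The inverse of a box with respect to both compositions. -/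
def rot (A : B) : B := T.vbox.inv (T.hbox.inv A)

theorem top_rot (A : B) : T.vbox.src (T.rot A) = T.hor.inv (T.vbox.tgt A) := by
  rw [rot, T.vbox.src_inv, T.bot_hinv]

theorem bot_rot (A : B) : T.vbox.tgt (T.rot A) = T.hor.inv (T.vbox.src A) := by
  rw [rot, T.vbox.tgt_inv, T.top_hinv]

theorem left_rot (A : B) : T.hbox.src (T.rot A) = T.ver.inv (T.hbox.tgt A) := by
  rw [rot, T.left_vinv, T.hbox.src_inv]

theorem right_rot (A : B) : T.hbox.tgt (T.rot A) = T.ver.inv (T.hbox.src A) := by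
  rw [rot, T.right_vinv, T.hbox.tgt_inv]

theorem rot_rot (A : B) : T.rot (T.rot A) = A := by
  rw [rot, rot, T.hinv_vinv, SetGroupoid.inv_inv, SetGroupoid.inv_inv]

theorem rot_vcomp {A A' : B} (h : T.vbox.tgt A = T.vbox.src A') :
    T.rot (T.vbox.comp A A') = T.vbox.comp (T.rot A') (T.rot A) := by
  rw [rot, T.hinv_vcomp h, SetGroupoid.inv_comp_rev]
  · rfl
  · rw [T.bot_hinv, T.top_hinv, h]

theorem rot_vone (x : H) : T.rot (T.vbox.one x) = T.vbox.one (T.hor.inv x) := by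
  rw [rot, T.hinv_vone, SetGroupoid.inv_one]

variable {T}

theorem hor_inv_injective : Function.Injective T.hor.inv := fun x y h => by
  rw [← SetGroupoid.inv_inv (𝒢 := T.hor) x, h, SetGroupoid.inv_inv]

end Inverses

namespace BoxAlg

variable {P H V B : Type*} {T : DoubleGroupoid P H V B} [Fintype H] [Fintype B]
  {k : Type*} [Field k] {ϑ : T.CornerWeight k}

open Coalgebra WeakBialgebra

/-! ### The antipode -/

/-- The algebra antihomomorphism `A ↦ c(A) A⁻¹`, where the inverse is with respect to both
compositions and `c` is multiplicative for the vertical composition. -/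
noncomputable def antiHom (ϑ : T.CornerWeight k) (c : B → k) (h1 : ∀ x, c (T.vbox.one x) = 1)
    (h2 : ∀ A A', T.vbox.tgt A = T.vbox.src A' → c (T.vbox.comp A A') = c A * c A') :
    T.BoxAlg ϑ →ₐ[k] (T.BoxAlg ϑ)ᵐᵒᵖ :=
  AlgHom.ofLinearMap ((MulOpposite.opLinearEquiv k).toLinearMap ∘ₗ
      lin ϑ fun A => c A • e ϑ (T.rot A))
    (by
      rw [one_def]
      simp only [map_sum, LinearMap.comp_apply, lin_e, h1, one_smul, T.rot_vone]
      rw [← map_sum]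
      have h3 : ∑ x, e ϑ (T.vbox.one (T.hor.inv x)) = (1 : T.BoxAlg ϑ) := by
        rw [one_def]
        exact Function.Bijective.sum_comp ⟨hor_inv_injective, fun x =>
          ⟨T.hor.inv x, SetGroupoid.inv_inv x⟩⟩ (fun x => e ϑ (T.vbox.one x))
      rw [h3]
      rfl)
    (fun a b => by
      induction a using basis_induction with
      | zero => simp only [zero_mul, map_zero]
      | add x y hx hy => simp only [add_mul, map_add, hx, hy]
      | basis r A =>
        induction b using basis_induction with
        | zero => simp only [mul_zero, map_zero]
        | add x y hx hy => simp only [mul_add, map_add, hx, hy]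
        | basis r' A' =>
          simp only [smul_mul_assoc, mul_smul_comm, map_smul]
          congr 2
          apply MulOpposite.unop_injective
          simp only [LinearMap.comp_apply, LinearEquiv.coe_coe, MulOpposite.unop_mul,
            MulOpposite.coe_opLinearEquiv, MulOpposite.unop_op, lin_e]
          rw [smul_mul_smul_comm, e_mul_e, e_mul_e, T.bot_rot, T.top_rot]
          by_cases h : T.vbox.tgt A = T.vbox.src A'
          · rw [if_pos h, if_pos (congrArg _ h.symm), lin_e, h2 _ _ h, T.rot_vcomp h, mul_comm]
          · rw [if_neg h, if_neg fun h' => h (hor_inv_injective h').symm, map_zero, smul_zero])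

theorem antiLin_antiHom (c : B → k) (h1) (h2) (A : B) :
    antiLin (antiHom ϑ c h1 h2) (e ϑ A) = c A • e ϑ (T.rot A) := by
  simp [antiLin, antiHom]

/-- The antipode `S(A) = ϑ(tr(A)) ϑ(br(A))⁻¹ A⁻¹`, where `tr` and `br` are the vertices of the
right side. -/
noncomputable def antipode (ϑ : T.CornerWeight k) : T.BoxAlg ϑ →ₐ[k] (T.BoxAlg ϑ)ᵐᵒᵖ :=
  antiHom ϑ (fun A => (ϑ.weight (T.ver.src (T.hbox.tgt A)) : k) *
      (ϑ.weight (T.ver.tgt (T.hbox.tgt A)) : k)⁻¹)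
    (fun x => by
      rw [T.right_vone, T.ver.src_one, T.ver.tgt_one, mul_inv_cancel₀ (Units.ne_zero _)])
    (fun A A' h => by
      have h' : T.ver.tgt (T.hbox.tgt A) = T.ver.src (T.hbox.tgt A') := by
        rw [T.bot_right, T.top_right, h]
      rw [T.right_vcomp _ _ h, T.ver.src_comp _ _ h', T.ver.tgt_comp _ _ h', h', mul_assoc,
        inv_mul_cancel_left₀ (Units.ne_zero _)])

/-- The inverse `A ↦ ϑ(tl(A)) ϑ(bl(A))⁻¹ A⁻¹` of the antipode. -/
noncomputable def antipodeInv (ϑ : T.CornerWeight k) : T.BoxAlg ϑ →ₐ[k] (T.BoxAlg ϑ)ᵐᵒᵖ :=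
  antiHom ϑ (fun A => (ϑ.weight (T.ver.src (T.hbox.src A)) : k) *
      (ϑ.weight (T.ver.tgt (T.hbox.src A)) : k)⁻¹)
    (fun x => by
      rw [T.left_vone, T.ver.src_one, T.ver.tgt_one, mul_inv_cancel₀ (Units.ne_zero _)])
    (fun A A' h => by
      have h' : T.ver.tgt (T.hbox.src A) = T.ver.src (T.hbox.src A') := by
        rw [T.bot_left, T.top_left, h]
      rw [T.left_vcomp _ _ h, T.ver.src_comp _ _ h', T.ver.tgt_comp _ _ h', h', mul_assoc,
        inv_mul_cancel_left₀ (Units.ne_zero _)])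

theorem antipodeInv_antipode (a : T.BoxAlg ϑ) :
    antiLin (antipodeInv ϑ) (antiLin (antipode ϑ) a) = a := by
  have h : antiLin (antipodeInv ϑ) ∘ₗ antiLin (antipode ϑ) = LinearMap.id := by
    refine hom_ext fun A => ?_
    rw [LinearMap.comp_apply, antipode, antiLin_antiHom, map_smul, antipodeInv, antiLin_antiHom,
      T.rot_rot, T.left_rot, T.ver.src_inv, T.ver.tgt_inv, smul_smul, LinearMap.id_apply,
      mul_assoc, inv_mul_cancel_left₀ (Units.ne_zero _), mul_inv_cancel₀ (Units.ne_zero _),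
      one_smul]
  exact DFunLike.congr_fun h a

open scoped Classical in
/-- The sum of `ϑ(br(X))` over the boxes `X` with given left and top sides. -/
theorem sum_left_top (g : V) (x : H) :
    ∑ X : B, (if T.hbox.src X = g ∧ T.vbox.src X = x then
      (ϑ.weight (T.ver.tgt (T.hbox.tgt X)) : k) else 0) =
      if T.hor.src x = T.ver.src g then 1 else 0 := by
  split_ifs with h
  · rw [← ϑ.sum_eq_one g (T.hor.inv x) (by rw [T.hor.tgt_inv, h])]
    refine Finset.sum_nbij' T.hbox.inv T.hbox.inv (fun _ _ => Finset.mem_univ _)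
      (fun _ _ => Finset.mem_univ _) (fun X _ => SetGroupoid.inv_inv X)
      (fun X _ => SetGroupoid.inv_inv X) fun X _ => ?_
    simp only [top, right, botLeft, left, T.top_hinv, T.hbox.tgt_inv, T.hbox.src_inv]
    refine if_congr ?_ rfl rfl
    rw [and_comm, hor_inv_injective.eq_iff]
  · refine Finset.sum_eq_zero fun X _ => if_neg ?_
    rintro ⟨rfl, rfl⟩
    exact h (T.top_left X).symm

open scoped Classical in
/-- The sum of `ϑ(tl(Y))` over the boxes `Y` with given right and bottom sides. -/
theorem sum_right_bot (g : V) (x : H) :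
    ∑ Y : B, (if T.hbox.tgt Y = g ∧ T.vbox.tgt Y = x then
      (ϑ.weight (T.ver.src (T.hbox.src Y)) : k) else 0) =
      if T.hor.tgt x = T.ver.tgt g then 1 else 0 := by
  have hinj : Function.Injective T.ver.inv := T.transpose.hor_inv_injective
  split_ifs with h
  · rw [← ϑ.sum_eq_one (T.ver.inv g) x (by rw [T.ver.src_inv, h])]
    refine Finset.sum_nbij' T.vbox.inv T.vbox.inv (fun _ _ => Finset.mem_univ _)
      (fun _ _ => Finset.mem_univ _) (fun X _ => SetGroupoid.inv_inv X)
      (fun X _ => SetGroupoid.inv_inv X) fun X _ => ?_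
    simp only [top, right, botLeft, left, T.left_vinv, T.right_vinv, T.vbox.src_inv,
      T.ver.tgt_inv]
    refine if_congr ?_ rfl rfl
    rw [and_comm, hinj.eq_iff]
  · refine Finset.sum_eq_zero fun X _ => if_neg ?_
    rintro ⟨rfl, rfl⟩
    exact h (T.bot_right X).symm

end BoxAlg

end DoubleGroupoid

/-! ### Boxes with an identity side -/

namespace DoubleGroupoid

section Corner

variable {P H V B : Type*} (T : DoubleGroupoid P H V B)

/-- For a box `A` whose bottom side is an identity, the box `id l(A) / A⁻¹`, which belongs to the
core. -/
def coreBox (A : B) : B := T.vbox.comp (T.hbox.one (T.hbox.src A)) (T.rot A)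

variable {T} {A : B} {p : P}

theorem coreBox_composable (h : T.vbox.tgt A = T.hor.one p) :
    T.vbox.tgt (T.hbox.one (T.hbox.src A)) = T.vbox.src (T.rot A) := by
  rw [T.bot_hone, T.top_rot, h, SetGroupoid.inv_one, T.bot_left, h, T.hor.src_one]

theorem top_coreBox (h : T.vbox.tgt A = T.hor.one p) :
    T.vbox.src (T.coreBox A) = T.hor.one (T.ver.src (T.hbox.src A)) := by
  rw [coreBox, T.vbox.src_comp _ _ (coreBox_composable h), T.top_hone]

theorem bot_coreBox (h : T.vbox.tgt A = T.hor.one p) :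
    T.vbox.tgt (T.coreBox A) = T.hor.inv (T.vbox.src A) := by
  rw [coreBox, T.vbox.tgt_comp _ _ (coreBox_composable h), T.bot_rot]

theorem right_coreBox (h : T.vbox.tgt A = T.hor.one p) :
    T.hbox.tgt (T.coreBox A) = T.ver.one (T.ver.src (T.hbox.src A)) := by
  rw [coreBox, T.right_vcomp _ _ (coreBox_composable h), T.hbox.tgt_one, T.right_rot,
    T.ver.comp_inv]

theorem botLeft_coreBox (h : T.vbox.tgt A = T.hor.one p) :
    T.ver.tgt (T.hbox.src (T.coreBox A)) = T.ver.src (T.hbox.tgt A) := by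
  rw [T.bot_left, bot_coreBox h, T.hor.src_inv, T.top_right]

theorem coreBox_mem_core (h : T.vbox.tgt A = T.hor.one p) : T.coreBox A ∈ T.core :=
  ⟨⟨_, right_coreBox h⟩, _, top_coreBox h⟩

theorem hinv_coreBox (h : T.vbox.tgt A = T.hor.one p) :
    T.hbox.inv (T.coreBox A) = T.vbox.comp (T.hbox.one (T.hbox.src A)) (T.vbox.inv A) := by
  rw [coreBox, T.hinv_vcomp (coreBox_composable h), SetGroupoid.inv_one, rot, T.hinv_vinv,
    SetGroupoid.inv_inv]

/-- The factorizations `X Y` of vertical identities for which `X / A` is a horizontal identity. -/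
theorem target_pair_iff (h : T.vbox.tgt A = T.hor.one p) (X Y : B) :
    ((T.hbox.tgt X = T.hbox.src Y ∧ T.IsVId (T.hbox.comp X Y)) ∧
      (T.vbox.tgt X = T.vbox.src A ∧ T.IsHId (T.vbox.comp X A))) ↔
    (T.hor.src (T.vbox.src Y) = T.ver.src (T.hbox.src A) ∧
      Y = T.hbox.comp (T.coreBox A) (T.vbox.one (T.vbox.src Y))) ∧
      X = T.hbox.inv (T.coreBox A) := by
  have hl : T.vbox.tgt (T.hbox.one (T.hbox.src A)) = T.vbox.src (T.vbox.inv A) := by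
    rw [T.bot_hone, T.vbox.src_inv, T.bot_left, h, T.hor.src_one]
  constructor
  · rintro ⟨⟨h1, x, h2⟩, h3, g, h4⟩
    have hlX : T.hbox.src X = T.ver.one (T.hor.src x) := by
      rw [← T.hbox.src_comp _ _ h1, h2, T.left_vone]
    have hg : T.hbox.src A = g := by
      have h5 := T.left_vcomp _ _ h3
      rw [h4, T.hbox.src_one, hlX] at h5
      rw [h5]
      refine (SetGroupoid.one_comp' ?_).symm
      have h6 := T.bot_left X
      rw [h3, ← T.top_left, hlX, T.ver.tgt_one] at h6
      exact h6.symm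
    have hX : X = T.hbox.inv (T.coreBox A) := by
      rw [hinv_coreBox h, hg, ← h4, SetGroupoid.comp_comp_inv_cancel h3]
    have hY : Y = T.hbox.comp (T.coreBox A) (T.vbox.one x) := by
      rw [← h2, ← SetGroupoid.inv_inv (𝒢 := T.hbox) (T.coreBox A), ← hX,
        SetGroupoid.inv_comp_cancel h1]
    have hC : T.hbox.tgt (T.coreBox A) = T.hbox.src (T.vbox.one x) := by
      rw [← T.hbox.src_inv, ← hX, hlX, T.left_vone]
    have hx : T.hor.src x = T.ver.src (T.hbox.src A) := by
      have h7 := congrArg T.ver.src hC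
      rw [right_coreBox h, T.left_vone, T.ver.src_one, T.ver.src_one] at h7
      exact h7.symm
    have htY : T.vbox.src Y = x := by
      rw [hY, T.top_hcomp _ _ hC, top_coreBox h, T.vbox.src_one]
      exact SetGroupoid.one_comp' hx
    rw [htY]
    exact ⟨⟨hx, hY⟩, hX⟩
  · rintro ⟨⟨h1, h2⟩, h3⟩
    have hC : T.hbox.tgt (T.coreBox A) = T.hbox.src (T.vbox.one (T.vbox.src Y)) := by
      rw [right_coreBox h, T.left_vone, h1]
    have h4 : T.hbox.tgt X = T.hbox.src Y := by
      rw [h3, T.hbox.tgt_inv, h2, T.hbox.src_comp _ _ hC]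
    refine ⟨⟨h4, T.vbox.src Y, ?_⟩, ?_, T.hbox.src A, ?_⟩
    · rw [h3]
      conv_lhs => rw [h2]
      rw [SetGroupoid.inv_comp_cancel hC]
    · rw [h3, T.bot_hinv, bot_coreBox h, SetGroupoid.inv_inv]
    · rw [h3, hinv_coreBox h, SetGroupoid.comp_inv_comp_cancel]
      rw [T.bot_hone, T.bot_left, h, T.hor.src_one]

theorem hcomp_eq_iff (X Y : B) :
    (T.hbox.tgt X = T.hbox.src Y ∧ T.hbox.comp X Y = A) ↔
      T.hbox.src X = T.hbox.src A ∧ Y = T.hbox.comp (T.hbox.inv X) A := by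
  constructor
  · rintro ⟨h, rfl⟩
    exact ⟨(T.hbox.src_comp _ _ h).symm, (SetGroupoid.inv_comp_cancel h).symm⟩
  · rintro ⟨h, rfl⟩
    exact ⟨by rw [T.hbox.src_comp _ _ ((T.hbox.tgt_inv X).trans h), T.hbox.src_inv],
      SetGroupoid.comp_inv_cancel h⟩

/-- If `X Y = A` and `X / Y⁻¹` is defined, then the bottom side of `A` is an identity. -/
theorem bot_eq_one_of_hcomp {X Y : B} (h : T.hbox.tgt X = T.hbox.src Y)
    (h' : T.vbox.tgt X = T.vbox.src (T.rot Y)) :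
    T.vbox.tgt (T.hbox.comp X Y) = T.hor.one (T.hor.tgt (T.vbox.tgt Y)) := by
  rw [T.bot_hcomp _ _ h, h', T.top_rot, T.hor.inv_comp]

theorem bot_eq_top_rot (h : T.vbox.tgt A = T.hor.one p) {X : B} (hX : T.hbox.src X = T.hbox.src A) :
    T.vbox.tgt X = T.vbox.src (T.rot (T.hbox.comp (T.hbox.inv X) A)) := by
  rw [T.top_rot, T.bot_hcomp _ _ ((T.hbox.tgt_inv X).trans hX), T.bot_hinv, h,
    SetGroupoid.comp_one', SetGroupoid.inv_inv]
  rw [T.hor.tgt_inv, ← T.bot_left, hX, T.bot_left, h, T.hor.src_one]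

/-- Interchange shows that `X / (X⁻¹ A)⁻¹` depends only on `A` and on the top side of `X`. -/
theorem vcomp_rot_hcomp (h : T.vbox.tgt A = T.hor.one p) {X : B}
    (hX : T.hbox.src X = T.hbox.src A) :
    T.vbox.comp X (T.rot (T.hbox.comp (T.hbox.inv X) A)) =
      T.hbox.comp (T.coreBox A) (T.vbox.one (T.vbox.src X)) := by
  have h1 : T.hbox.tgt (T.hbox.inv X) = T.hbox.src A := (T.hbox.tgt_inv X).trans hX
  have h2 : T.rot (T.hbox.comp (T.hbox.inv X) A) = T.hbox.comp (T.rot A) (T.vbox.inv X) := by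
    rw [rot, SetGroupoid.inv_comp_rev h1, SetGroupoid.inv_inv, T.vinv_hcomp]
    · rfl
    · rw [T.hbox.tgt_inv, hX]
  have h3 : T.hbox.tgt (T.rot A) = T.hbox.src (T.vbox.inv X) := by
    rw [T.right_rot, T.left_vinv, hX]
  have h4 : T.hbox.tgt (T.hbox.one (T.hbox.src A)) = T.hbox.src X := by
    rw [T.hbox.tgt_one, hX]
  have h5 := T.interchange _ _ _ _ h4 h3 (coreBox_composable h) (T.vbox.src_inv X).symm
  rw [SetGroupoid.one_comp' hX, T.vbox.comp_inv] at h5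
  rw [h2, h5]
  rfl

end Corner

section Rotate

variable {P H V B : Type*} (T : DoubleGroupoid P H V B)

/-- The double groupoid obtained by reversing both directions. -/
def rotate : DoubleGroupoid P H V B := T.flip.transpose.flip.transpose

variable {T} {A : B} {p : P}

/-- The factorizations `X Y` of vertical identities for which `A / Y` is a horizontal identity. -/
theorem source_pair_iff (h : T.vbox.src A = T.hor.one p) (X Y : B) :
    ((T.hbox.tgt X = T.hbox.src Y ∧ T.IsVId (T.hbox.comp X Y)) ∧
      (T.vbox.tgt A = T.vbox.src Y ∧ T.IsHId (T.vbox.comp A Y))) ↔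
    (T.hor.tgt (T.vbox.tgt X) = T.ver.tgt (T.hbox.tgt A) ∧
      X = T.hbox.comp (T.vbox.one (T.vbox.tgt X)) (T.rotate.coreBox A)) ∧
      Y = T.hbox.inv (T.rotate.coreBox A) := by
  rw [eq_comm (a := T.hbox.tgt X), eq_comm (a := T.vbox.tgt A)]
  exact target_pair_iff (T := T.rotate) h Y X

theorem hcomp_eq_iff' (X Y : B) :
    (T.hbox.tgt X = T.hbox.src Y ∧ T.hbox.comp X Y = A) ↔
      T.hbox.tgt Y = T.hbox.tgt A ∧ X = T.hbox.comp A (T.hbox.inv Y) := by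
  rw [eq_comm (a := T.hbox.tgt X)]
  exact hcomp_eq_iff (T := T.rotate) Y X

theorem top_eq_one_of_hcomp {X Y : B} (h : T.hbox.tgt X = T.hbox.src Y)
    (h' : T.vbox.tgt (T.rot X) = T.vbox.src Y) :
    T.vbox.src (T.hbox.comp X Y) = T.hor.one (T.hor.src (T.vbox.src X)) :=
  bot_eq_one_of_hcomp (T := T.rotate) h.symm h'.symm

theorem bot_rot_eq_top (h : T.vbox.src A = T.hor.one p) {Y : B} (hY : T.hbox.tgt Y = T.hbox.tgt A) :
    T.vbox.tgt (T.rot (T.hbox.comp A (T.hbox.inv Y))) = T.vbox.src Y :=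
  (bot_eq_top_rot (T := T.rotate) h hY).symm

theorem rot_hcomp_vcomp (h : T.vbox.src A = T.hor.one p) {Y : B}
    (hY : T.hbox.tgt Y = T.hbox.tgt A) :
    T.vbox.comp (T.rot (T.hbox.comp A (T.hbox.inv Y))) Y =
      T.hbox.comp (T.vbox.one (T.vbox.tgt Y)) (T.rotate.coreBox A) :=
  vcomp_rot_hcomp (T := T.rotate) h hY

end Rotate

namespace BoxAlg

/-! ### The target and source maps and the antipode axioms -/

variable {P H V B : Type*} {T : DoubleGroupoid P H V B} [Fintype H] [Fintype B]
  {k : Type*} [Field k] {ϑ : T.CornerWeight k}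

open Coalgebra WeakBialgebra

section Sums

variable {ι κ M : Type*} [Fintype ι] [Fintype κ] [AddCommMonoid M]

theorem sum_ite_and_eq_apply [DecidableEq ι] (c : ι → Prop) [DecidablePred c] (a : ι) (f : ι → M) :
    ∑ i, (if c i ∧ i = a then f i else 0) = if c a then f a else 0 := by
  rw [Finset.sum_eq_single a]
  · simp
  · intro b _ hb
    rw [if_neg fun h => hb h.2]
  · intro h
    exact absurd (Finset.mem_univ a) h

/-- A sum over the image of a section `j` of `t` is a sum over its domain. -/
theorem sum_ite_section [DecidableEq κ] (c : ι → Prop) [DecidablePred c] (j : ι → κ)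
    (t : κ → ι) (f : κ → M) (h : ∀ x, c x → t (j x) = x) :
    ∑ Y, (if c (t Y) ∧ Y = j (t Y) then f Y else 0) = ∑ x, if c x then f (j x) else 0 := by
  rw [← Finset.sum_filter, ← Finset.sum_filter]
  refine Finset.sum_nbij' t j ?_ ?_ ?_ ?_ ?_
  · intro Y hY
    exact Finset.mem_filter.2 ⟨Finset.mem_univ _, (Finset.mem_filter.1 hY).2.1⟩
  · intro x hx
    have hx' := (Finset.mem_filter.1 hx).2
    refine Finset.mem_filter.2 ⟨Finset.mem_univ _, ?_⟩
    rw [h x hx']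
    exact ⟨hx', rfl⟩
  · intro Y hY
    exact (Finset.mem_filter.1 hY).2.2.symm
  · intro x hx
    exact h x (Finset.mem_filter.1 hx).2
  · intro Y hY
    rw [← (Finset.mem_filter.1 hY).2.2]

end Sums

theorem onBox_coreBox {A : B} {p : P} (h : T.vbox.tgt A = T.hor.one p) :
    ϑ.onBox (T.coreBox A) = ϑ.weight (T.ver.src (T.hbox.tgt A)) := by
  rw [CornerWeight.onBox, botLeft, left, botLeft_coreBox h]

theorem top_coreBox_hcomp {A : B} {p : P} (h : T.vbox.tgt A = T.hor.one p) {x : H}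
    (hx : T.hor.src x = T.ver.src (T.hbox.src A)) :
    T.vbox.src (T.hbox.comp (T.coreBox A) (T.vbox.one x)) = x := by
  rw [T.top_hcomp, top_coreBox h, T.vbox.src_one]
  · exact SetGroupoid.one_comp' hx
  · rw [right_coreBox h, T.left_vone, hx]

theorem bot_hcomp_coreBox {A : B} {p : P} (h : T.vbox.src A = T.hor.one p) {x : H}
    (hx : T.hor.tgt x = T.ver.tgt (T.hbox.tgt A)) :
    T.vbox.tgt (T.hbox.comp (T.vbox.one x) (T.rotate.coreBox A)) = x := by
  rw [T.bot_hcomp, T.vbox.tgt_one]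
  · exact (congrArg (T.hor.comp x) (top_coreBox (T := T.rotate) h)).trans
      (SetGroupoid.comp_one' hx)
  · rw [T.right_vone, hx]
    exact (right_coreBox (T := T.rotate) h).symm

open scoped Classical in
theorem targetMap_e_eq_zero {A : B} (h : ∀ p, T.vbox.tgt A ≠ T.hor.one p) :
    targetMap k (T.BoxAlg ϑ) (e ϑ A) = 0 := by
  refine (map_comul_one ((TensorProduct.lid k _).toLinearMap ∘ₗ counit.rTensor (T.BoxAlg ϑ) ∘ₗ
    LinearMap.mulRight k (e ϑ A ⊗ₜ[k] (1 : T.BoxAlg ϑ)))).trans ?_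
  refine Finset.sum_eq_zero fun X _ => Finset.sum_eq_zero fun Y _ => ?_
  simp only [LinearMap.comp_apply, LinearMap.mulRight_apply, Algebra.TensorProduct.tmul_mul_tmul,
    mul_one, LinearMap.rTensor_tmul, LinearEquiv.coe_coe, TensorProduct.lid_tmul, counit_mul_e]
  rw [if_neg (fun h' : T.vbox.tgt X = T.vbox.src A ∧ T.IsHId (T.vbox.comp X A) => ?_), zero_smul,
    smul_zero, ite_self]
  obtain ⟨h1, g, h2⟩ := h'
  exact h (T.ver.tgt g) (by rw [← T.vbox.tgt_comp _ _ h1, h2, T.bot_hone])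

open scoped Classical in
/-- The target map on a box whose bottom side is an identity. -/
theorem targetMap_e {A : B} {p : P} (h : T.vbox.tgt A = T.hor.one p) :
    targetMap k (T.BoxAlg ϑ) (e ϑ A) =
      (ϑ.weight (T.ver.src (T.hbox.tgt A)) * (ϑ.onBox A)⁻¹ : k) •
        ∑ x, if T.hor.src x = T.ver.src (T.hbox.src A) then
          e ϑ (T.hbox.comp (T.coreBox A) (T.vbox.one x)) else 0 := by
  refine (map_comul_one ((TensorProduct.lid k _).toLinearMap ∘ₗ counit.rTensor (T.BoxAlg ϑ) ∘ₗ
    LinearMap.mulRight k (e ϑ A ⊗ₜ[k] (1 : T.BoxAlg ϑ)))).trans ?_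
  simp only [LinearMap.comp_apply, LinearMap.mulRight_apply, Algebra.TensorProduct.tmul_mul_tmul,
    mul_one, LinearMap.rTensor_tmul, LinearEquiv.coe_coe, TensorProduct.lid_tmul, counit_mul_e,
    ite_smul, zero_smul, smul_ite, smul_zero, ← ite_and, target_pair_iff h]
  rw [Finset.sum_comm]
  simp only [sum_ite_and_eq_apply]
  rw [sum_ite_section (fun x => T.hor.src x = T.ver.src (T.hbox.src A))
    (fun x => T.hbox.comp (T.coreBox A) (T.vbox.one x)) T.vbox.src _
    fun x hx => top_coreBox_hcomp h hx, Finset.smul_sum]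
  refine Finset.sum_congr rfl fun x _ => ?_
  split_ifs with hx
  · have h1 : T.hbox.tgt (T.coreBox A) = T.hbox.src (T.vbox.one x) := by
      rw [right_coreBox h, T.left_vone, hx]
    rw [onBox_hcomp h1, smul_smul, onBox_coreBox h]
  · rw [smul_zero]

open scoped Classical in
theorem sourceMap_e_eq_zero {A : B} (h : ∀ p, T.vbox.src A ≠ T.hor.one p) :
    sourceMap k (T.BoxAlg ϑ) (e ϑ A) = 0 := by
  refine (map_comul_one ((TensorProduct.rid k _).toLinearMap ∘ₗ counit.lTensor (T.BoxAlg ϑ) ∘ₗ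
    LinearMap.mulLeft k ((1 : T.BoxAlg ϑ) ⊗ₜ[k] e ϑ A))).trans ?_
  refine Finset.sum_eq_zero fun X _ => Finset.sum_eq_zero fun Y _ => ?_
  simp only [LinearMap.comp_apply, LinearMap.mulLeft_apply, Algebra.TensorProduct.tmul_mul_tmul,
    one_mul, LinearMap.lTensor_tmul, LinearEquiv.coe_coe, TensorProduct.rid_tmul, counit_mul_e]
  rw [if_neg (fun h' : T.vbox.tgt A = T.vbox.src Y ∧ T.IsHId (T.vbox.comp A Y) => ?_), zero_smul,
    smul_zero, ite_self]
  obtain ⟨h1, g, h2⟩ := h'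
  exact h (T.ver.src g) (by rw [← T.vbox.src_comp _ _ h1, h2, T.top_hone])

open scoped Classical in
/-- The source map on a box whose top side is an identity. -/
theorem sourceMap_e {A : B} {p : P} (h : T.vbox.src A = T.hor.one p) :
    sourceMap k (T.BoxAlg ϑ) (e ϑ A) =
        ∑ x, if T.hor.tgt x = T.ver.tgt (T.hbox.tgt A) then
          e ϑ (T.hbox.comp (T.vbox.one x) (T.rotate.coreBox A)) else 0 := by
  refine (map_comul_one ((TensorProduct.rid k _).toLinearMap ∘ₗ counit.lTensor (T.BoxAlg ϑ) ∘ₗ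
    LinearMap.mulLeft k ((1 : T.BoxAlg ϑ) ⊗ₜ[k] e ϑ A))).trans ?_
  simp only [LinearMap.comp_apply, LinearMap.mulLeft_apply, Algebra.TensorProduct.tmul_mul_tmul,
    one_mul, LinearMap.lTensor_tmul, LinearEquiv.coe_coe, TensorProduct.rid_tmul, counit_mul_e,
    ite_smul, zero_smul, smul_ite, smul_zero, smul_smul, mul_inv_cancel₀ (ϑ.onBox_ne_zero _),
    one_smul, ← ite_and, source_pair_iff h]
  simp only [sum_ite_and_eq_apply]
  exact sum_ite_section (fun x => T.hor.tgt x = T.ver.tgt (T.hbox.tgt A))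
    (fun x => T.hbox.comp (T.vbox.one x) (T.rotate.coreBox A)) T.vbox.tgt _
    fun x hx => bot_hcomp_coreBox h hx

open scoped Classical in
/-- The axiom `h₁ S(h₂) = ε_t(h)`. The terms for the factorizations `X Y = A` are grouped by the top
side `x` of `X`; those of one group are multiples of the same box, with coefficients adding up to
one. -/
theorem mul_antipode_e (A : B) : LinearMap.mul' k (T.BoxAlg ϑ)
    ((antiLin (antipode ϑ)).lTensor (T.BoxAlg ϑ) (comul (R := k) (e ϑ A))) =
      targetMap k (T.BoxAlg ϑ) (e ϑ A) := by
  refine (map_comul_e (LinearMap.mul' k (T.BoxAlg ϑ) ∘ₗ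
    (antiLin (antipode ϑ)).lTensor (T.BoxAlg ϑ)) A).trans ?_
  simp only [LinearMap.comp_apply, LinearMap.lTensor_tmul, LinearMap.mul'_apply, antipode,
    antiLin_antiHom, mul_smul_comm, e_mul_e]
  by_cases h : ∃ p, T.vbox.tgt A = T.hor.one p
  · obtain ⟨p, hp⟩ := h
    simp only [hcomp_eq_iff, sum_ite_and_eq_apply]
    rw [targetMap_e hp]
    have h1 : ∀ X : B, (if T.hbox.src X = T.hbox.src A then
        ϑ.onBox (T.hbox.comp (T.hbox.inv X) A) •
          ((ϑ.weight (T.ver.src (T.hbox.tgt (T.hbox.comp (T.hbox.inv X) A))) : k) *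
            (ϑ.weight (T.ver.tgt (T.hbox.tgt (T.hbox.comp (T.hbox.inv X) A))) : k)⁻¹) •
          (if T.vbox.tgt X = T.vbox.src (T.rot (T.hbox.comp (T.hbox.inv X) A)) then
            e ϑ (T.vbox.comp X (T.rot (T.hbox.comp (T.hbox.inv X) A))) else 0) else 0) =
        ∑ x, (if T.hbox.src X = T.hbox.src A ∧ T.vbox.src X = x then
          (ϑ.weight (T.ver.tgt (T.hbox.tgt X)) : k) else 0) •
          (ϑ.weight (T.ver.src (T.hbox.tgt A)) * (ϑ.onBox A)⁻¹ : k) •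
          e ϑ (T.hbox.comp (T.coreBox A) (T.vbox.one x)) := by
      intro X
      by_cases hX : T.hbox.src X = T.hbox.src A
      · have h2 : T.hbox.tgt (T.hbox.inv X) = T.hbox.src A := (T.hbox.tgt_inv X).trans hX
        have h3 : T.ver.tgt (T.hbox.tgt A) = T.ver.tgt (T.hbox.src A) := by
          rw [T.bot_right, T.bot_left, hp, T.hor.src_one, T.hor.tgt_one]
        rw [if_pos hX, if_pos (bot_eq_top_rot hp hX), vcomp_rot_hcomp hp hX, onBox_hcomp h2,
          T.hbox.tgt_comp _ _ h2, h3]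
        rw [Finset.sum_eq_single (T.vbox.src X), if_pos ⟨hX, rfl⟩, CornerWeight.onBox, botLeft,
          left, T.hbox.src_inv]
        · rfl
        · intro x _ hx
          rw [if_neg fun h => hx h.2.symm, zero_smul]
        · intro h
          exact absurd (Finset.mem_univ _) h
      · rw [if_neg hX]
        refine (Finset.sum_eq_zero fun x _ => ?_).symm
        rw [if_neg fun h => hX h.1, zero_smul]
    simp only [h1]
    rw [Finset.sum_comm, Finset.smul_sum]
    refine Finset.sum_congr rfl fun x _ => ?_
    rw [← Finset.sum_smul, sum_left_top]
    split_ifs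
    · rw [one_smul]
    · rw [zero_smul, smul_zero]
  · rw [targetMap_e_eq_zero fun p hp => h ⟨p, hp⟩]
    refine Finset.sum_eq_zero fun X _ => Finset.sum_eq_zero fun Y _ => ?_
    split_ifs with h1 h2
    · exact absurd ⟨_, h1.2 ▸ bot_eq_one_of_hcomp h1.1 h2⟩ h
    · rw [smul_zero, smul_zero]
    · rfl

open scoped Classical in
/-- The axiom `S(h₁) h₂ = ε_s(h)`. The terms are grouped by the bottom side of `Y`. -/
theorem antipode_mul_e (A : B) : LinearMap.mul' k (T.BoxAlg ϑ)
    ((antiLin (antipode ϑ)).rTensor (T.BoxAlg ϑ) (comul (R := k) (e ϑ A))) =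
      sourceMap k (T.BoxAlg ϑ) (e ϑ A) := by
  refine (map_comul_e (LinearMap.mul' k (T.BoxAlg ϑ) ∘ₗ
    (antiLin (antipode ϑ)).rTensor (T.BoxAlg ϑ)) A).trans ?_
  simp only [LinearMap.comp_apply, LinearMap.rTensor_tmul, LinearMap.mul'_apply, antipode,
    antiLin_antiHom, smul_mul_assoc, e_mul_e]
  by_cases h : ∃ p, T.vbox.src A = T.hor.one p
  · obtain ⟨p, hp⟩ := h
    rw [Finset.sum_comm]
    simp only [hcomp_eq_iff', sum_ite_and_eq_apply]
    rw [sourceMap_e hp]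
    have h1 : ∀ Y : B, (if T.hbox.tgt Y = T.hbox.tgt A then
        ϑ.onBox Y •
          ((ϑ.weight (T.ver.src (T.hbox.tgt (T.hbox.comp A (T.hbox.inv Y)))) : k) *
            (ϑ.weight (T.ver.tgt (T.hbox.tgt (T.hbox.comp A (T.hbox.inv Y)))) : k)⁻¹) •
          (if T.vbox.tgt (T.rot (T.hbox.comp A (T.hbox.inv Y))) = T.vbox.src Y then
            e ϑ (T.vbox.comp (T.rot (T.hbox.comp A (T.hbox.inv Y))) Y) else 0) else 0) =
        ∑ x, (if T.hbox.tgt Y = T.hbox.tgt A ∧ T.vbox.tgt Y = x then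
          (ϑ.weight (T.ver.src (T.hbox.src Y)) : k) else 0) •
          e ϑ (T.hbox.comp (T.vbox.one x) (T.rotate.coreBox A)) := by
      intro Y
      by_cases hY : T.hbox.tgt Y = T.hbox.tgt A
      · have h2 : T.hbox.tgt A = T.hbox.src (T.hbox.inv Y) := by rw [T.hbox.src_inv, hY]
        rw [if_pos hY, if_pos (bot_rot_eq_top hp hY), rot_hcomp_vcomp hp hY,
          T.hbox.tgt_comp _ _ h2, T.hbox.tgt_inv, smul_smul, CornerWeight.onBox, mul_left_comm,
          mul_inv_cancel₀ (Units.ne_zero _), mul_one]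
        rw [Finset.sum_eq_single (T.vbox.tgt Y), if_pos ⟨hY, rfl⟩]
        · intro x _ hx
          rw [if_neg fun h => hx h.2.symm, zero_smul]
        · intro h
          exact absurd (Finset.mem_univ _) h
      · rw [if_neg hY]
        refine (Finset.sum_eq_zero fun x _ => ?_).symm
        rw [if_neg fun h => hY h.1, zero_smul]
    simp only [h1]
    rw [Finset.sum_comm]
    refine Finset.sum_congr rfl fun x _ => ?_
    rw [← Finset.sum_smul, sum_right_bot]
    split_ifs
    · rw [one_smul]
    · rw [zero_smul]
  · rw [sourceMap_e_eq_zero fun p hp => h ⟨p, hp⟩]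
    refine Finset.sum_eq_zero fun X _ => Finset.sum_eq_zero fun Y _ => ?_
    split_ifs with h1 h2
    · exact absurd ⟨_, h1.2 ▸ top_eq_one_of_hcomp h1.1 h2⟩ h
    · rw [smul_zero, smul_zero]
    · rfl

theorem isAntipode_antipode : IsAntipode (antipode ϑ) where
  mul_right h := by
    induction h using basis_induction with
    | zero => simp only [map_zero]
    | add x y hx hy => simp only [map_add, hx, hy]
    | basis c A => simp only [map_smul, mul_antipode_e]
  mul_left h := by
    induction h using basis_induction with
    | zero => simp only [map_zero]
    | add x y hx hy => simp only [map_add, hx, hy]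
    | basis c A => simp only [map_smul, antipode_mul_e]

end BoxAlg

end DoubleGroupoid

/-! ### The unit object -/

namespace DoubleGroupoid

section Core

variable {P H V B : Type*} {T : DoubleGroupoid P H V B} {E E' : B}

theorem top_of_mem_core (hE : E ∈ T.core) :
    T.vbox.src E = T.hor.one (T.ver.src (T.hbox.tgt E)) := by
  obtain ⟨-, q, hq⟩ := hE
  have h : T.vbox.src E = T.hor.one q := hq
  rw [T.top_right, h, T.hor.tgt_one]

theorem right_of_mem_core (hE : E ∈ T.core) :
    T.hbox.tgt E = T.ver.one (T.ver.src (T.hbox.tgt E)) := by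
  obtain ⟨⟨p, hp⟩, -⟩ := hE
  have h : T.hbox.tgt E = T.ver.one p := hp
  rw [h, T.ver.src_one]

theorem tgt_bot_of_mem_core (hE : E ∈ T.core) :
    T.hor.tgt (T.vbox.tgt E) = T.ver.src (T.hbox.tgt E) := by
  rw [← T.bot_right, right_of_mem_core hE, T.ver.src_one, T.ver.tgt_one]

theorem one_mem_core (p : P) : T.hbox.one (T.ver.one p) ∈ T.core :=
  ⟨⟨p, T.hbox.tgt_one _⟩, p, (T.top_hone _).trans (by rw [T.ver.src_one])⟩

theorem bot_rot_of_mem_core (hE : E ∈ T.core) :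
    T.vbox.tgt (T.rot E) = T.hor.one (T.ver.src (T.hbox.tgt E)) := by
  rw [T.bot_rot, top_of_mem_core hE, SetGroupoid.inv_one]

theorem coreBox_rot (hE : E ∈ T.core) : T.coreBox (T.rot E) = E := by
  rw [coreBox, T.rot_rot, T.left_rot, right_of_mem_core hE, SetGroupoid.inv_one, ← T.one_one,
    SetGroupoid.one_comp' (top_of_mem_core hE)]

theorem composable_of_mem_core (hE : E ∈ T.core) {x : H}
    (hx : T.hor.src x = T.ver.src (T.hbox.tgt E)) :
    T.hbox.tgt E = T.hbox.src (T.vbox.one x) := by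
  rw [T.left_vone, hx, ← right_of_mem_core hE]

theorem top_hcomp_of_mem_core (hE : E ∈ T.core) {x : H}
    (hx : T.hor.src x = T.ver.src (T.hbox.tgt E)) :
    T.vbox.src (T.hbox.comp E (T.vbox.one x)) = x := by
  rw [T.top_hcomp _ _ (composable_of_mem_core hE hx), T.vbox.src_one, top_of_mem_core hE,
    SetGroupoid.one_comp' hx]

theorem hcomp_one_of_mem_core (hE : E ∈ T.core) :
    T.hbox.comp E (T.vbox.one (T.hor.one (T.ver.src (T.hbox.tgt E)))) = E := by
  rw [T.one_one, ← right_of_mem_core hE, T.hbox.comp_one]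

/-- Among the boxes `E · id x`, only the one with `x` an identity belongs to the core. -/
theorem eq_of_hcomp_mem_core (hE : E ∈ T.core) (hE' : E' ∈ T.core) {x : H}
    (hx : T.hor.src x = T.ver.src (T.hbox.tgt E)) (h : T.hbox.comp E (T.vbox.one x) = E') :
    x = T.hor.one (T.ver.src (T.hbox.tgt E)) ∧ E = E' := by
  have h1 : x = T.hor.one (T.ver.src (T.hbox.tgt E)) := by
    have h2 := top_hcomp_of_mem_core hE hx
    rw [h, top_of_mem_core hE'] at h2
    rw [← h2, T.hor.src_one] at hx
    rw [← h2, hx]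
  exact ⟨h1, by rw [← h, h1, hcomp_one_of_mem_core hE]⟩

end Core

namespace BoxAlg

variable {P H V B : Type*} {T : DoubleGroupoid P H V B} [Fintype H] [Fintype B]
  {k : Type*} [Field k] {ϑ : T.CornerWeight k}

open Coalgebra WeakBialgebra

/-- The element `ε_t(ϑ(tr(E)) E⁻¹)` of the unit object. If `E` is in the core, it is the sum of the
boxes `E · id x` times `ϑ(bl(E))`, and these elements form a basis of the unit object. -/
noncomputable def coreUnit (ϑ : T.CornerWeight k) (E : B) : UnitRep k (T.BoxAlg ϑ) :=
  (ϑ.weight (T.ver.src (T.hbox.tgt E)) : k) • UnitRep.mk (e ϑ (T.rot E))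

open scoped Classical in
theorem val_coreUnit {E : B} (hE : E ∈ T.core) : UnitRep.val (coreUnit ϑ E) =
    ϑ.onBox E • ∑ x, if T.hor.src x = T.ver.src (T.hbox.tgt E) then
      e ϑ (T.hbox.comp E (T.vbox.one x)) else 0 := by
  rw [coreUnit, map_smul, UnitRep.val_mk, targetMap_e (bot_rot_of_mem_core hE), coreBox_rot hE,
    smul_smul, CornerWeight.onBox, botLeft, left, T.left_rot, T.right_rot, T.ver.src_inv,
    T.ver.tgt_inv, T.ver.src_inv, mul_left_comm, mul_inv_cancel₀ (Units.ne_zero _), mul_one]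
  have h1 : T.ver.tgt (T.hbox.tgt E) = T.ver.src (T.hbox.tgt E) := by
    rw [T.bot_right, tgt_bot_of_mem_core hE]
  rw [h1]
  rfl

theorem mk_e {A : B} {p : P} (h : T.vbox.tgt A = T.hor.one p) :
    UnitRep.mk (k := k) (e ϑ A) = (ϑ.onBox A)⁻¹ • coreUnit ϑ (T.coreBox A) := by
  apply UnitRep.val_injective
  rw [UnitRep.val_mk, targetMap_e h, map_smul, val_coreUnit (coreBox_mem_core h), smul_smul,
    right_coreBox h, T.ver.src_one, mul_comm, onBox_coreBox h]

theorem mk_e_eq_zero {A : B} (h : ∀ p, T.vbox.tgt A ≠ T.hor.one p) :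
    UnitRep.mk (k := k) (e ϑ A) = 0 := by
  apply UnitRep.val_injective
  rw [UnitRep.val_mk, targetMap_e_eq_zero h, map_zero]

theorem smul_coreUnit_eq_zero {E : B} (hE : E ∈ T.core) {A : B}
    (h : T.hor.src (T.vbox.tgt A) ≠ T.ver.src (T.hbox.tgt E)) :
    e ϑ A • coreUnit ϑ E = 0 := by
  classical
  rw [UnitRep.smul_def, val_coreUnit hE, mul_smul_comm, Finset.mul_sum, Finset.sum_eq_zero,
    smul_zero, map_zero]
  intro x _
  split_ifs with hx
  · rw [e_mul_e, top_hcomp_of_mem_core hE hx, if_neg]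
    rintro rfl
    exact h hx
  · rw [mul_zero]

theorem smul_coreUnit {E : B} (hE : E ∈ T.core) {A : B}
    (h : T.hor.src (T.vbox.tgt A) = T.ver.src (T.hbox.tgt E)) :
    e ϑ A • coreUnit ϑ E = ϑ.onBox E •
      UnitRep.mk (e ϑ (T.vbox.comp A (T.hbox.comp E (T.vbox.one (T.vbox.tgt A))))) := by
  classical
  rw [UnitRep.smul_def, val_coreUnit hE, mul_smul_comm, Finset.mul_sum, map_smul]
  congr 2
  rw [Finset.sum_eq_single (T.vbox.tgt A)]
  · rw [if_pos h, e_mul_e, top_hcomp_of_mem_core hE h, if_pos rfl]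
  · intro x _ hx
    split_ifs with hx'
    · rw [e_mul_e, top_hcomp_of_mem_core hE hx', if_neg hx.symm]
    · rw [mul_zero]
  · intro h
    exact absurd (Finset.mem_univ _) h

/-- A box `A` with `b(A) = b(E)⁻¹` maps the basis vector of `E` to a basis vector. -/
theorem exists_smul_coreUnit_eq {E : B} (hE : E ∈ T.core) {A : B}
    (h : T.vbox.tgt E = T.hor.inv (T.vbox.tgt A)) :
    ∃ E' ∈ T.core, T.vbox.tgt E' = T.hor.inv (T.vbox.src A) ∧
      e ϑ A • coreUnit ϑ E = coreUnit ϑ E' := by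
  have h1 : T.hor.src (T.vbox.tgt A) = T.ver.src (T.hbox.tgt E) := by
    rw [← tgt_bot_of_mem_core hE, h, T.hor.tgt_inv]
  have h2 := composable_of_mem_core hE h1
  have h3 := (top_hcomp_of_mem_core hE h1).symm
  set A' := T.vbox.comp A (T.hbox.comp E (T.vbox.one (T.vbox.tgt A))) with hA'
  have h4 : T.vbox.tgt A' = T.hor.one (T.hor.tgt (T.vbox.tgt A)) := by
    rw [hA', T.vbox.tgt_comp _ _ h3, T.bot_hcomp _ _ h2, T.vbox.tgt_one, h, T.hor.inv_comp]
  refine ⟨T.coreBox A', coreBox_mem_core h4, ?_, ?_⟩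
  · rw [bot_coreBox h4, hA', T.vbox.src_comp _ _ h3]
  · rw [smul_coreUnit hE h1, mk_e h4, hA', onBox_vcomp h3, onBox_hcomp h2, smul_smul,
      mul_inv_cancel₀ (ϑ.onBox_ne_zero E), one_smul]

/-- A box `A` with `b(A) ≠ b(E)⁻¹` annihilates the basis vector of `E`. -/
theorem smul_coreUnit_eq_zero' {E : B} (hE : E ∈ T.core) {A : B}
    (h : T.vbox.tgt E ≠ T.hor.inv (T.vbox.tgt A)) : e ϑ A • coreUnit ϑ E = 0 := by
  by_cases h1 : T.hor.src (T.vbox.tgt A) = T.ver.src (T.hbox.tgt E)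
  · have h2 := composable_of_mem_core hE h1
    have h3 := (top_hcomp_of_mem_core hE h1).symm
    rw [smul_coreUnit hE h1, mk_e_eq_zero, smul_zero]
    intro p hp
    rw [T.vbox.tgt_comp _ _ h3, T.bot_hcomp _ _ h2, T.vbox.tgt_one] at hp
    have h4 : T.hor.tgt (T.vbox.tgt E) = T.hor.src (T.vbox.tgt A) := by
      rw [tgt_bot_of_mem_core hE, h1]
    refine h ?_
    rw [← SetGroupoid.inv_eq_of_comp_eq_one h4 hp, SetGroupoid.inv_inv]
  · exact smul_coreUnit_eq_zero hE h1

open scoped Classical in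
/-- The coordinate of an element of the unit object at the basis vector given by a core box. -/
noncomputable def coreCoord (ϑ : T.CornerWeight k) (E : B) : UnitRep k (T.BoxAlg ϑ) →ₗ[k] k :=
  lin ϑ (fun A => if A = E then (ϑ.onBox E)⁻¹ else 0) ∘ₗ UnitRep.val

open scoped Classical in
theorem coreCoord_coreUnit {E E' : B} (hE : E ∈ T.core) (hE' : E' ∈ T.core) :
    coreCoord ϑ E' (coreUnit ϑ E) = if E = E' then 1 else 0 := by
  rw [coreCoord, LinearMap.comp_apply, val_coreUnit hE, map_smul, map_sum]
  by_cases h : E = E'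
  · subst h
    rw [if_pos rfl, Finset.sum_eq_single (T.hor.one (T.ver.src (T.hbox.tgt E))),
      if_pos (T.hor.src_one _), hcomp_one_of_mem_core hE, lin_e, if_pos rfl, smul_eq_mul,
      mul_inv_cancel₀ (ϑ.onBox_ne_zero E)]
    · intro x _ hx
      split_ifs with hx'
      · rw [lin_e, if_neg]
        intro h
        exact hx (eq_of_hcomp_mem_core hE hE hx' h).1
      · rw [map_zero]
    · intro h
      exact absurd (Finset.mem_univ _) h
  · rw [if_neg h, Finset.sum_eq_zero, smul_zero]
    intro x _
    split_ifs with hx'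
    · rw [lin_e, if_neg]
      intro h'
      exact h (eq_of_hcomp_mem_core hE hE' hx' h').2
    · rw [map_zero]

theorem coreUnit_ne_zero {E : B} (hE : E ∈ T.core) : coreUnit ϑ E ≠ 0 := fun h => by
  have h1 := coreCoord_coreUnit (ϑ := ϑ) hE hE
  rw [h, map_zero, if_pos rfl] at h1
  exact zero_ne_one h1

open scoped Classical in
theorem sum_coreCoord_smul (v : UnitRep k (T.BoxAlg ϑ)) :
    ∑ E with E ∈ T.core, coreCoord ϑ E v • coreUnit ϑ E = v := by
  rw [← UnitRep.mk_val v]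
  induction UnitRep.val v using basis_induction with
  | zero => simp only [map_zero, zero_smul, Finset.sum_const_zero]
  | add x y hx hy => simp only [map_add, add_smul, Finset.sum_add_distrib, hx, hy]
  | basis c A =>
    simp only [map_smul, smul_assoc, ← Finset.smul_sum]
    congr 1
    by_cases h : ∃ p, T.vbox.tgt A = T.hor.one p
    · obtain ⟨p, hp⟩ := h
      rw [mk_e hp]
      simp only [map_smul, smul_assoc, ← Finset.smul_sum]
      congr 1
      have hC := coreBox_mem_core hp
      rw [Finset.sum_eq_single (T.coreBox A), coreCoord_coreUnit hC hC, if_pos rfl, one_smul]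
      · intro E hE hne
        rw [coreCoord_coreUnit hC (Finset.mem_filter.1 hE).2, if_neg hne.symm, zero_smul]
      · intro h
        exact absurd (Finset.mem_filter.2 ⟨Finset.mem_univ _, hC⟩) h
    · rw [mk_e_eq_zero fun p hp => h ⟨p, hp⟩]
      simp only [map_zero, zero_smul, Finset.sum_const_zero]

/-- The largest submodule on which a linear form vanishes. -/
def annihilatedBy {R M : Type*} [Ring R] [Algebra k R] [AddCommGroup M] [Module k M] [Module R M]
    (f : M →ₗ[k] k) : Submodule R M where
  carrier := {v | ∀ a : R, f (a • v) = 0}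
  add_mem' hv hw a := by rw [smul_add, map_add, hv a, hw a, add_zero]
  zero_mem' a := by rw [smul_zero, map_zero]
  smul_mem' b v hv a := by rw [smul_smul, hv]

theorem annihilatedBy_ne_top {R M : Type*} [Ring R] [Algebra k R] [AddCommGroup M] [Module k M]
    [Module R M] {f : M →ₗ[k] k} {v : M} (h : f v ≠ 0) : annihilatedBy (R := R) f ≠ ⊤ := fun h' =>
  h (by
    have h1 : v ∈ annihilatedBy (R := R) f := h' ▸ Submodule.mem_top
    rw [← one_smul R v]
    exact h1 1)

theorem mem_annihilatedBy {f : UnitRep k (T.BoxAlg ϑ) →ₗ[k] k} {v : UnitRep k (T.BoxAlg ϑ)}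
    (h : ∀ A : B, f (e ϑ A • v) = 0) : v ∈ annihilatedBy (R := T.BoxAlg ϑ) f := by
  intro a
  induction a using basis_induction with
  | zero => rw [zero_smul, map_zero]
  | add x y hx hy => rw [add_smul, map_add, hx, hy, add_zero]
  | basis c A => rw [smul_assoc, map_smul, h, smul_zero]

/-- If the unit object is simple, the elements `u_E - u_{E'}` with `b(E) = b(E')` vanish, because
they lie in the largest submodule on which the sum of the coordinates vanishes. -/
theorem eq_of_bot_eq_of_isSimpleModule [IsSimpleModule (T.BoxAlg ϑ) (UnitRep k (T.BoxAlg ϑ))]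
    {E E' : B} (hE : E ∈ T.core) (hE' : E' ∈ T.core) (h : T.vbox.tgt E = T.vbox.tgt E') :
    E = E' := by
  classical
  let f : UnitRep k (T.BoxAlg ϑ) →ₗ[k] k := ∑ F with F ∈ T.core, coreCoord ϑ F
  have hf : ∀ F ∈ T.core, f (coreUnit ϑ F) = 1 := by
    intro F hF
    rw [LinearMap.sum_apply, Finset.sum_eq_single F, coreCoord_coreUnit hF hF, if_pos rfl]
    · intro F' hF' hne
      rw [coreCoord_coreUnit hF (Finset.mem_filter.1 hF').2, if_neg hne.symm]
    · intro h
      exact absurd (Finset.mem_filter.2 ⟨Finset.mem_univ _, hF⟩) h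
  have h1 : coreUnit ϑ E - coreUnit ϑ E' ∈ annihilatedBy (R := T.BoxAlg ϑ) f := by
    refine mem_annihilatedBy fun A => ?_
    rw [smul_sub, map_sub, sub_eq_zero]
    by_cases hA : T.vbox.tgt E = T.hor.inv (T.vbox.tgt A)
    · obtain ⟨F, hF, -, h2⟩ := exists_smul_coreUnit_eq (ϑ := ϑ) hE hA
      obtain ⟨F', hF', -, h3⟩ := exists_smul_coreUnit_eq (ϑ := ϑ) hE' (h ▸ hA)
      rw [h2, h3, hf _ hF, hf _ hF']
    · rw [smul_coreUnit_eq_zero' hE hA, smul_coreUnit_eq_zero' hE' (h ▸ hA)]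
  have h2 : annihilatedBy (R := T.BoxAlg ϑ) f ≠ ⊤ :=
    annihilatedBy_ne_top (v := coreUnit ϑ E) (by rw [hf _ hE]; exact one_ne_zero)
  rw [(eq_bot_or_eq_top _).resolve_right h2, Submodule.mem_bot, sub_eq_zero] at h1
  by_contra hne
  have h3 := coreCoord_coreUnit (ϑ := ϑ) hE hE'
  rw [h1, coreCoord_coreUnit hE' hE', if_pos rfl, if_neg hne] at h3
  exact one_ne_zero h3

/-- If the unit object is simple, the vertical groupoid is connected: an element of the submodule
generated by `u_{id p}` has zero coordinate at `id q` unless `p` and `q` are joined by an arrow. -/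
theorem isConnected_of_isSimpleModule [IsSimpleModule (T.BoxAlg ϑ) (UnitRep k (T.BoxAlg ϑ))] :
    T.ver.IsConnected := by
  classical
  refine ⟨?_, fun q p => ?_⟩
  · have := IsSimpleModule.nontrivial (T.BoxAlg ϑ) (UnitRep k (T.BoxAlg ϑ))
    obtain ⟨v, hv⟩ := exists_ne (0 : UnitRep k (T.BoxAlg ϑ))
    by_contra hP
    refine hv ?_
    rw [← sum_coreCoord_smul v]
    exact Finset.sum_eq_zero fun E _ => (hP ⟨T.botLeft E⟩).elim
  · by_contra! hg
    have hp := one_mem_core (T := T) p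
    have hq := one_mem_core (T := T) q
    have h1 : coreUnit ϑ (T.hbox.one (T.ver.one p)) ∈ annihilatedBy (R := T.BoxAlg ϑ)
        (coreCoord ϑ (T.hbox.one (T.ver.one q))) := by
      refine mem_annihilatedBy fun A => ?_
      by_cases hA : T.vbox.tgt (T.hbox.one (T.ver.one p)) = T.hor.inv (T.vbox.tgt A)
      · obtain ⟨F, hF, h2, h3⟩ := exists_smul_coreUnit_eq (ϑ := ϑ) hp hA
        rw [h3, coreCoord_coreUnit hF hq, if_neg]
        rintro rfl
        refine hg (T.hbox.src A) ?_ ?_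
        · rw [T.bot_hone, T.ver.tgt_one] at h2
          rw [T.top_left, ← T.hor.tgt_inv, ← h2, T.hor.tgt_one]
        · rw [T.bot_hone, T.ver.tgt_one] at hA
          rw [T.bot_left, ← T.hor.tgt_inv, ← hA, T.hor.tgt_one]
      · rw [smul_coreUnit_eq_zero' hp hA, map_zero]
    have h2 : annihilatedBy (R := T.BoxAlg ϑ) (coreCoord ϑ (T.hbox.one (T.ver.one q))) ≠ ⊤ :=
      annihilatedBy_ne_top (v := coreUnit ϑ (T.hbox.one (T.ver.one q))) (by
        rw [coreCoord_coreUnit hq hq, if_pos rfl]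
        exact one_ne_zero)
    rw [(eq_bot_or_eq_top _).resolve_right h2, Submodule.mem_bot] at h1
    exact coreUnit_ne_zero hp h1

/-- If the vertical groupoid is connected, the boxes act transitively on the bottom sides of the
core boxes. -/
theorem exists_box_of_isConnected (hT : T.ver.IsConnected) {E E' : B} (hE : E ∈ T.core)
    (hE' : E' ∈ T.core) : ∃ A : B, T.vbox.tgt E = T.hor.inv (T.vbox.tgt A) ∧
      T.vbox.tgt E' = T.hor.inv (T.vbox.src A) := by
  obtain ⟨g, hg1, hg2⟩ := hT.2 (T.ver.src (T.hbox.tgt E')) (T.ver.src (T.hbox.tgt E))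
  have h1 : T.vbox.tgt (T.rot E') = T.vbox.src (T.hbox.one g) := by
    rw [bot_rot_of_mem_core hE', T.top_hone, hg1]
  have h2 : T.vbox.tgt (T.hbox.one g) = T.vbox.src (T.hbox.inv E) := by
    rw [T.bot_hone, T.top_hinv, top_of_mem_core hE, SetGroupoid.inv_one, hg2]
  have h3 : T.vbox.tgt (T.rot E') = T.vbox.src (T.vbox.comp (T.hbox.one g) (T.hbox.inv E)) := by
    rw [T.vbox.src_comp _ _ h2, h1]
  refine ⟨T.vbox.comp (T.rot E') (T.vbox.comp (T.hbox.one g) (T.hbox.inv E)), ?_, ?_⟩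
  · rw [T.vbox.tgt_comp _ _ h3, T.vbox.tgt_comp _ _ h2, T.bot_hinv, SetGroupoid.inv_inv]
  · rw [T.vbox.src_comp _ _ h3, T.top_rot, SetGroupoid.inv_inv]

/-- Under the two conditions the unit object is simple: `id b(E)⁻¹` extracts the coordinate at `E`
of an element, and the boxes permute the basis vectors transitively. -/
theorem isSimpleModule_of_isConnected (hT : T.ver.IsConnected)
    (hE : ∀ x : H, {E | E ∈ T.core ∧ T.bot E = x}.Subsingleton) :
    IsSimpleModule (T.BoxAlg ϑ) (UnitRep k (T.BoxAlg ϑ)) := by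
  classical
  rw [isSimpleModule_iff]
  refine { exists_pair_ne := ⟨⊥, ⊤, fun h => ?_⟩, eq_bot_or_eq_top := fun N => ?_ }
  · obtain ⟨p⟩ := hT.1
    have h1 : coreUnit ϑ (T.hbox.one (T.ver.one p)) ∈
        (⊥ : Submodule (T.BoxAlg ϑ) (UnitRep k (T.BoxAlg ϑ))) := h ▸ Submodule.mem_top
    exact coreUnit_ne_zero (one_mem_core p) h1
  · by_cases h : ∀ v ∈ N, ∀ E ∈ T.core, coreCoord ϑ E v = 0
    · left
      rw [eq_bot_iff]
      intro v hv
      rw [Submodule.mem_bot, ← sum_coreCoord_smul v]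
      exact Finset.sum_eq_zero fun E hE => by
        rw [h v hv E (Finset.mem_filter.1 hE).2, zero_smul]
    · right
      push Not at h
      obtain ⟨v, hv, E, hEc, hne⟩ := h
      have h1 : e ϑ (T.vbox.one (T.hor.inv (T.vbox.tgt E))) • v = coreCoord ϑ E v • coreUnit ϑ E := by
        conv_lhs => rw [← sum_coreCoord_smul v]
        rw [Finset.smul_sum, Finset.sum_eq_single E]
        · obtain ⟨F, hF, h2, h3⟩ := exists_smul_coreUnit_eq (ϑ := ϑ) hEc
            (A := T.vbox.one (T.hor.inv (T.vbox.tgt E)))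
            (by rw [T.vbox.tgt_one, SetGroupoid.inv_inv])
          rw [T.vbox.src_one, SetGroupoid.inv_inv] at h2
          rw [smul_comm, h3, hE _ ⟨hF, h2⟩ ⟨hEc, rfl⟩]
        · intro F hF hFE
          rw [smul_comm, smul_coreUnit_eq_zero' (Finset.mem_filter.1 hF).2, smul_zero]
          rw [T.vbox.tgt_one, SetGroupoid.inv_inv]
          intro h2
          exact hFE (hE _ ⟨(Finset.mem_filter.1 hF).2, h2⟩ ⟨hEc, rfl⟩)
        · intro h
          exact absurd (Finset.mem_filter.2 ⟨Finset.mem_univ _, hEc⟩) h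
      have hbase : ∀ (c : k) (w : UnitRep k (T.BoxAlg ϑ)), w ∈ N → c • w ∈ N := fun c w hw => by
        rw [← one_smul (T.BoxAlg ϑ) w, ← smul_assoc]
        exact N.smul_mem _ hw
      have h2 : coreUnit ϑ E ∈ N := by
        have h3 := hbase (coreCoord ϑ E v)⁻¹ _ (h1 ▸ N.smul_mem _ hv)
        rwa [inv_smul_smul₀ hne] at h3
      rw [eq_top_iff]
      intro w _
      rw [← sum_coreCoord_smul w]
      refine N.sum_mem fun E' hE' => hbase _ _ ?_
      have hE'c := (Finset.mem_filter.1 hE').2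
      obtain ⟨A, hA1, hA2⟩ := exists_box_of_isConnected hT hEc hE'c
      obtain ⟨F, hF, h4, h5⟩ := exists_smul_coreUnit_eq (ϑ := ϑ) hEc hA1
      rw [← hE _ ⟨hF, h4.trans hA2.symm⟩ ⟨hE'c, rfl⟩, ← h5]
      exact N.smul_mem _ h2

theorem isSimpleModule_unitRep_iff (ϑ : T.CornerWeight k) :
    IsSimpleModule (T.BoxAlg ϑ) (UnitRep k (T.BoxAlg ϑ)) ↔
      T.ver.IsConnected ∧ ∀ x : H, {E | E ∈ T.core ∧ T.bot E = x}.Subsingleton :=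
  ⟨fun _ => ⟨isConnected_of_isSimpleModule (ϑ := ϑ), fun _ _ hE _ hE' =>
    eq_of_bot_eq_of_isSimpleModule (ϑ := ϑ) hE.1 hE'.1 (hE.2.trans hE'.2.symm)⟩,
    fun h => isSimpleModule_of_isConnected h.1 h.2⟩

end BoxAlg

end DoubleGroupoid

/-! ### The representation category -/

namespace DoubleGroupoid

namespace BoxAlg

variable {P H V B : Type*} {T : DoubleGroupoid P H V B} [Fintype H] [Fintype B]
  {k : Type*} [Field k] {ϑ : T.CornerWeight k}

open Coalgebra WeakBialgebra

instance [CharZero k] : IsSemisimpleRing (T.BoxAlg ϑ) :=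
  SetGroupoid.Alg.isSemisimpleRing (𝒢 := T.vbox)

/-- The dual of a representation, twisted by an antihomomorphism. -/
noncomputable def dual (σ : T.BoxAlg ϑ →ₐ[k] (T.BoxAlg ϑ)ᵐᵒᵖ) (X : FinRep k (T.BoxAlg ϑ)) :
    FinRep k (T.BoxAlg ϑ) where
  carrier := DualRep σ X

/-- A representation is in exact pairing with its dual, twisted by the antipode. -/
@[reducible]
noncomputable def exactPairingDual (X : FinRep k (T.BoxAlg ϑ)) :
    ExactPairing X (dual (antipode ϑ) X) where
  coevaluation' := coevMap (V := X) isAntipode_antipode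
  evaluation' := evMap (V := X) isAntipode_antipode
  coevaluation_evaluation' := FinRep.hom_ext fun x =>
    (LinearEquiv.eq_symm_apply _).2 (left_zigzag (V := X) isAntipode_antipode x)
  evaluation_coevaluation' := FinRep.hom_ext fun x =>
    (LinearEquiv.eq_symm_apply _).2 (right_zigzag (V := X) isAntipode_antipode x)

/-- A left dual is the dual twisted by the inverse of the antipode: the representation is the
dual, twisted by the antipode, of the latter. -/
theorem rigid (X : FinRep k (T.BoxAlg ϑ)) :
    Nonempty (HasLeftDual X) ∧ Nonempty (HasRightDual X) := by
  let Y := dual (antipodeInv ϑ) X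
  let _ := exactPairingDual X
  let _ := exactPairingDual Y
  have i : X ≅ dual (antipode ϑ) Y :=
    FinRep.isoOfEquiv (W := dual (antipode ϑ) Y)
      (doubleDualEquiv (V := X) antipodeInv_antipode)
  exact ⟨⟨{ leftDual := Y, exact := exactPairingCongrRight i }⟩,
    ⟨{ rightDual := dual (antipode ϑ) X }⟩⟩

/-- Apart from the simplicity of the unit object, all axioms of a fusion category hold. -/
theorem isFusionCategory_iff [CharZero k] (ϑ : T.CornerWeight k) :
    IsFusionCategory k (FinRep k (T.BoxAlg ϑ)) ↔
      IsSimpleModule (T.BoxAlg ϑ) (UnitRep k (T.BoxAlg ϑ)) :=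
  ⟨fun h => (FinRep.simple_iff_isSimpleModule _).1 h.simple_unit, fun h =>
    { rigid := rigid
      finite_hom := FinRep.finite_hom
      semisimple := FinRep.exists_iso_biproduct_simples
      finite_simples := FinRep.exists_simples
      simple_unit := (FinRep.simple_iff_isSimpleModule _).2 h }⟩

end BoxAlg

end DoubleGroupoid

theorem mainTheorem3 {k P H V B : Type*} [Field k] [CharZero k] [Fintype H] [Fintype B]
    (T : DoubleGroupoid P H V B) (ϑ : T.CornerWeight k) :
    (IsFusionCategory k (FinRep k (T.BoxAlg ϑ)) ↔
      T.ver.IsConnected ∧ ∀ x : H, {E | E ∈ T.core ∧ T.bot E = x}.Subsingleton) ∧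
    (IsConnectedWeakHopf k (T.BoxAlg ϑ) ↔
      T.ver.IsConnected ∧ ∀ x : H, {E | E ∈ T.core ∧ T.bot E = x}.Subsingleton) := by
  have h := (DoubleGroupoid.BoxAlg.isFusionCategory_iff ϑ).trans
    (DoubleGroupoid.BoxAlg.isSimpleModule_unitRep_iff ϑ)
  exact ⟨h, fun hc => h.1 hc.isFusion, fun hc =>
    ⟨DoubleGroupoid.BoxAlg.isAntipode_antipode.isWeakHopf, inferInstance, h.2 hc⟩⟩
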